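/- Let $n\ge 1$, let $R=\mathbb{C}[x_0,\dots,x_n][\lambda]$, and let $f\in R$. Let $\Omega_/^{k}=R\otimes_{\mathbb{C}}\Lambda^k((\mathbb{C}^{n+1})^*)$, where $(\mathbb{C}^{n+1})^*=\oplus_{i=0}^{n}\mathbb{C}\,dx_i$, be the module of $\lambda$-relative differential forms of degree $k$, with the $\lambda$-relative differential $d_/$ (differentiation in $x$ only); $\partial\xi/\partial\lambda$ is obtained by differentiating the coefficients of $\xi$. Put $$E_f=\Omega_/^{n+1}\big/ d_/f\wedge d_/\Omega_/^{n-1},$$ with its $\mathbb{C}[\lambda]$-linear operators $a$ (multiplication by $f$) and $b=d_/f\wedge d_/^{-1}$, that is, $b[d_/\xi]=[d_/f\wedge\xi]$ for $\xi\in\Omega_/^n$; they satisfy $ab-ba=b^2$. Let $\tilde E_f$ be the quotient of $E_f$ by its $b$-torsion (the elements killed by some power of $b$), with the induced operators $a,b$. There is a $\mathbb{C}$-linear operator $\nabla:E_f\to E_f$ with the following properties. 1. For every $\xi\in\Omega_/^n$, $\ \nabla[d_/\xi]=\big[d_/f\wedge\frac{\partial\xi}{\partial\lambda}-\frac{\partial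 f}{\partial\lambda}\,d_/\xi\big]$. 2. On $E_f$ one has $\nabla b=b\nabla$, $\ \nabla a=(a-b)\nabla$, and $\nabla(\varphi\,e)=\varphi'\,b\,e+\varphi\,\nabla e$ for $\varphi\in\mathbb{C}[\lambda]$, $e\in E_f$. The operator $\nabla$ induces an operator on $\tilde E_f$, where $b$ is injective, and $b^{-1}\nabla$ is a well-defined $\mathbb{C}$-linear map $b\tilde E_f\to\tilde E_f$. The submodule $b\tilde E_f$ is stable under $a$ and $b$, and $b^{-1}\nabla$ commutes with $a$ and $b$ and is a $\lambda$-connection: $b^{-1}\nabla(\varphi y)=\varphi' y+\varphi\, b^{-1}\nabla y$ for $\varphi\in\mathbb{C}[\lambda]$, $y\in b\tilde E_f$. 3. Let $C(f,\lambda)$ be the set of critical values of the map $(x,\lambda)\mapsto(f(x,\lambda),\lambda)$ from $\mathbb{C}^{n+1}\times\mathbb{C}^*$ to $\mathbb{C}\times\mathbb{C}^*$, let $U\subset(\mathbb{C}\times\mathbb{C}^*)\setminus C(f,\lambda)$ be open, and let $(\gamma_{s,\lambda})_{(s,\lambda)\in U}$ be a horizontal family of compact $n$-cycles in the fibres of this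 map (near every point of $U$, the cycle $\gamma_{s,\lambda}$ is homologous in its fibre to the member at $(s,\lambda)$ of a smooth family of singular cycles). For $\omega\in\Omega_/^{n+1}$ let $\omega/d_/f$ be its Gelfand–Leray form on the fibres. Then the period $(s,\lambda)\mapsto\int_{\gamma_{s,\lambda}}\omega/d_/f$ depends only on the class $[\omega]\in E_f$ and is holomorphic on $U$. For all $\omega\in\Omega_/^{n+1}$, with $\int_{\gamma}\frac{b[\omega]}{d_/f}$ and $\int_{\gamma}\frac{\nabla[\omega]}{d_/f}$ computed on any representatives, $$\frac{\partial}{\partial s}\int_{\gamma_{s,\lambda}}\frac{b[\omega]}{d_/f}=\int_{\gamma_{s,\lambda}}\frac{\omega}{d_/f},\qquad \frac{\partial}{\partial\lambda}\int_{\gamma_{s,\lambda}}\frac{b[\omega]}{d_/f}=\int_{\gamma_{s,\lambda}}\frac{\nabla[\omega]}{d_/f},$$ and consequently $$\frac{\partial}{\partial\lambda}\int_{\gamma_{s,\lambda}}\frac{\omega}{d_/f}=\frac{\partial}{\partial s}\int_{\gamma_{s,\lambda}}\frac{\nabla[\omega]}{d_/f}.$$ -/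

import Mathlib

open scoped Polynomial

namespace PeriodConnection

noncomputable section

section Abstract

variable {K R V : Type*} [CommRing K] [CommRing R] [Algebra K R] [AddCommGroup V] [Module K V]

theorem abstract_wedge_wedge {k : ℕ} (D : V →ₗ[K] R →ₗ[K] R) (f : R) (η : V [⋀^Fin k]→ₗ[K] R)
    (v : Fin (k + 2) → V) :
    ∑ i : Fin (k + 2), (-1 : ℤ) ^ (i : ℕ) • (D (v i) f * ∑ j : Fin (k + 1), (-1 : ℤ) ^ (j : ℕ) •
      (D (i.removeNth v j) f * η (j.removeNth (i.removeNth v)))) = 0 := by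
  let B : V →ₗ[K] V →ₗ[K] V [⋀^Fin k]→ₗ[K] R :=
    LinearMap.mk₂ K (fun v w => (D v f * D w f) • η)
      (fun _ _ _ => by ext; simp [add_mul]) (fun _ _ _ => by ext; simp)
      (fun _ _ _ => by ext; simp [mul_add, add_mul]) (fun _ _ _ => by ext; simp)
  have hB : ∀ v w, B v w = B w v := fun v w => by
    simp only [B, LinearMap.mk₂_apply, mul_comm]
  have h := congrArg (fun θ : V [⋀^Fin (k + 2)]→ₗ[K] R => θ v)
    (AlternatingMap.alternatizeUncurryFin_alternatizeUncurryFinLM_comp_of_symmetric hB)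
  simpa only [AlternatingMap.alternatizeUncurryFin_apply, LinearMap.comp_apply,
    AlternatingMap.alternatizeUncurryFinLM_apply, B, LinearMap.mk₂_apply,
    AlternatingMap.smul_apply, smul_eq_mul, Finset.mul_sum, mul_smul_comm, mul_assoc,
    AlternatingMap.zero_apply] using h

theorem abstract_d_wedge {k : ℕ} (D : V →ₗ[K] R →ₗ[K] R)
    (hmul : ∀ v g h, D v (g * h) = D v g * h + g * D v h)
    (hcomm : ∀ v w g, D v (D w g) = D w (D v g)) (f : R) (η : V [⋀^Fin k]→ₗ[K] R)
    (v : Fin (k + 2) → V) :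
    ∑ i : Fin (k + 2), (-1 : ℤ) ^ (i : ℕ) • D (v i) (∑ j : Fin (k + 1), (-1 : ℤ) ^ (j : ℕ) •
      (D (i.removeNth v j) f * η (j.removeNth (i.removeNth v)))) +
    ∑ i : Fin (k + 2), (-1 : ℤ) ^ (i : ℕ) • (D (v i) f * ∑ j : Fin (k + 1), (-1 : ℤ) ^ (j : ℕ) •
      D (i.removeNth v j) (η (j.removeNth (i.removeNth v)))) = 0 := by
  let F : V →ₗ[K] V [⋀^Fin k]→ₗ[K] R :=
    { toFun := fun v => (D v).compAlternatingMap η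
      map_add' := fun v w => by ext; simp
      map_smul' := fun c v => by ext; simp }
  let B : V →ₗ[K] V →ₗ[K] V [⋀^Fin k]→ₗ[K] R :=
    LinearMap.mk₂ K (fun v w => D v (D w f) • η + (D w f • F v + D v f • F w))
      (fun _ _ _ => by ext1; simp [add_mul]; ring) (fun _ _ _ => by ext1; simp)
      (fun _ _ _ => by ext1; simp [add_mul]; ring) (fun _ _ _ => by ext1; simp)
  have hB : ∀ v w, B v w = B w v := fun v w => by
    simp only [B, LinearMap.mk₂_apply, hcomm v w]
    rw [add_comm (D w f • F v)]
  have h := congrArg (fun θ : V [⋀^Fin (k + 2)]→ₗ[K] R => θ v)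
    (AlternatingMap.alternatizeUncurryFin_alternatizeUncurryFinLM_comp_of_symmetric hB)
  refine Eq.trans ?_ h
  simp only [AlternatingMap.alternatizeUncurryFin_apply, LinearMap.comp_apply,
    AlternatingMap.alternatizeUncurryFinLM_apply]
  rw [← Finset.sum_add_distrib]
  refine Finset.sum_congr rfl fun i _ => ?_
  rw [← smul_add, map_sum, Finset.mul_sum, ← Finset.sum_add_distrib]
  congr 1
  refine Finset.sum_congr rfl fun j _ => ?_
  rw [map_zsmul, mul_smul_comm, ← smul_add, hmul]
  congr 1
  simp only [B, F, LinearMap.mk₂_apply, AlternatingMap.add_apply, AlternatingMap.smul_apply,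
    smul_eq_mul, LinearMap.coe_mk, AddHom.coe_mk, LinearMap.compAlternatingMap_apply]
  ring

theorem abstract_cartan {k N : ℕ} (D : (Fin N → K) →ₗ[K] R →ₗ[K] R) (x : Fin N → R)
    (hx : ∀ v i, D v (x i) = algebraMap K R (v i))
    (hmul : ∀ v g h, D v (g * h) = D v g * h + g * D v h)
    (η : (Fin N → K) [⋀^Fin (k + 1)]→ₗ[K] R) (v : Fin (k + 1) → Fin N → K) :
    ∑ j : Fin (k + 1), (-1 : ℤ) ^ (j : ℕ) •
        D (v j) (∑ i, x i * η (Fin.cons (Pi.single i 1) (j.removeNth v))) +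
      ∑ i, x i * ∑ j : Fin (k + 2), (-1 : ℤ) ^ (j : ℕ) •
        D ((Fin.cons (Pi.single i 1) v : Fin (k + 2) → Fin N → K) j)
          (η (j.removeNth (Fin.cons (Pi.single i 1) v : Fin (k + 2) → Fin N → K))) =
      ∑ i, x i * D (Pi.single i 1) (η v) + (k + 1) • η v := by
  have h1 : ∑ i, x i * ∑ j : Fin (k + 2), (-1 : ℤ) ^ (j : ℕ) •
        D ((Fin.cons (Pi.single i 1) v : Fin (k + 2) → Fin N → K) j)
          (η (j.removeNth (Fin.cons (Pi.single i 1) v : Fin (k + 2) → Fin N → K))) =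
      ∑ i, x i * D (Pi.single i 1) (η v) -
        ∑ j : Fin (k + 1), (-1 : ℤ) ^ (j : ℕ) • ∑ i, x i *
          D (v j) (η (Fin.cons (Pi.single i 1) (j.removeNth v))) := by
    simp only [Fin.sum_univ_succ (n := k + 1)]
    simp only [mul_add, Finset.sum_add_distrib]
    rw [sub_eq_add_neg]
    congr 1
    · refine Finset.sum_congr rfl fun i _ => ?_
      simp
    · rw [← Finset.sum_neg_distrib]
      simp only [Finset.mul_sum, Finset.smul_sum]
      rw [Finset.sum_comm]
      refine Finset.sum_congr rfl fun j _ => ?_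
      rw [← Finset.sum_neg_distrib]
      refine Finset.sum_congr rfl fun i _ => ?_
      have : (j.succ).removeNth (Fin.cons (Pi.single i 1) v : Fin (k + 2) → Fin N → K) =
          Fin.cons (Pi.single i 1) (j.removeNth v) := by
        ext l : 1
        refine Fin.cases ?_ (fun l => ?_) l <;> simp [Fin.removeNth]
      rw [this, Fin.cons_succ, Fin.val_succ, pow_succ, mul_neg_one, neg_smul, mul_neg,
        mul_smul_comm]
  have h2 : ∑ j : Fin (k + 1), (-1 : ℤ) ^ (j : ℕ) •
        D (v j) (∑ i, x i * η (Fin.cons (Pi.single i 1) (j.removeNth v))) =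
      ∑ j : Fin (k + 1), (-1 : ℤ) ^ (j : ℕ) • (η (Fin.cons (v j) (j.removeNth v)) +
        ∑ i, x i * D (v j) (η (Fin.cons (Pi.single i 1) (j.removeNth v)))) := by
    refine Finset.sum_congr rfl fun j _ => ?_
    congr 1
    rw [map_sum]
    simp only [hmul, hx, Finset.sum_add_distrib]
    congr 1
    have h := LinearMap.pi_apply_eq_sum_univ η.curryLeft (v j)
    let e : ((Fin N → K) [⋀^Fin k]→ₗ[K] R) →+ R :=
      { toFun := fun θ => θ (j.removeNth v), map_zero' := rfl, map_add' := fun _ _ => rfl }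
    have h' := congrArg e h
    rw [map_sum] at h'
    refine Eq.trans ?_ h'.symm
    refine Finset.sum_congr rfl fun i _ => ?_
    rw [← Algebra.smul_def]
    have : (fun l => if i = l then (1 : K) else 0) = Pi.single i 1 := by
      ext l; simp [Pi.single_apply, eq_comm]
    rw [this]
    rfl
  have h3 : ∑ j : Fin (k + 1), (-1 : ℤ) ^ (j : ℕ) • η (Fin.cons (v j) (j.removeNth v)) =
      (k + 1) • η v := by
    have := congrArg (fun θ : (Fin N → K) [⋀^Fin (k + 1)]→ₗ[K] R => θ v)
      (AlternatingMap.alternatizeUncurryFin_curryLeft η)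
    simp only [AlternatingMap.alternatizeUncurryFin_apply] at this
    exact this
  rw [h1, h2, ← h3]
  simp only [smul_add, Finset.sum_add_distrib]
  ring

theorem pderiv_comm {σ : Type*} (i j : σ) (g : MvPolynomial σ R) :
    MvPolynomial.pderiv i (MvPolynomial.pderiv j g) =
      MvPolynomial.pderiv j (MvPolynomial.pderiv i g) := by
  induction g using MvPolynomial.induction_on with
  | C a => simp
  | add p q hp hq => simp only [map_add, hp, hq]
  | mul_X p l hp =>
    classical
    simp only [Derivation.leibniz, MvPolynomial.pderiv_X, map_add, smul_eq_mul, hp,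
      Pi.single_apply]
    split_ifs <;> simp <;> ring

/-- The operator `c x^m ↦ u(|m|) c x^m` on polynomials, for a sequence of coefficients `u`. -/
def degScale {N : ℕ} (u : ℕ → R) : MvPolynomial (Fin N) R →ₗ[R] MvPolynomial (Fin N) R :=
  (MvPolynomial.basisMonomials (Fin N) R).constr R fun m =>
    MvPolynomial.monomial m (u m.degree)

theorem degScale_monomial {N : ℕ} (u : ℕ → R) (m : Fin N →₀ ℕ) (a : R) :
    degScale u (MvPolynomial.monomial m a) = MvPolynomial.monomial m (a * u m.degree) := by
  have : MvPolynomial.monomial m a = a • MvPolynomial.basisMonomials (Fin N) R m := by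
    simp [MvPolynomial.smul_monomial]
  rw [this, map_smul, degScale, Module.Basis.constr_basis, MvPolynomial.smul_monomial, smul_eq_mul]

theorem pderiv_degScale {N : ℕ} (u : ℕ → R) (i : Fin N) (g : MvPolynomial (Fin N) R) :
    MvPolynomial.pderiv i (degScale u g) =
      degScale (fun d => u (d + 1)) (MvPolynomial.pderiv i g) := by
  induction g using MvPolynomial.induction_on' with
  | add p q hp hq => simp only [map_add, hp, hq]
  | monomial m a =>
    rw [degScale_monomial, MvPolynomial.pderiv_monomial, MvPolynomial.pderiv_monomial,
      degScale_monomial]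
    by_cases h : m i = 0
    · simp [h]
    · have hd : (m - Finsupp.single i 1).degree + 1 = m.degree := by
        have hle : Finsupp.single i 1 ≤ m := by
          simpa [Finsupp.single_le_iff] using Nat.one_le_iff_ne_zero.mpr h
        conv_rhs => rw [← tsub_add_cancel_of_le hle]
        simp [Finsupp.degree_single]
      rw [hd]
      congr 1
      ring

theorem euler_degScale {N c : ℕ} (u : ℕ → R) (hu : ∀ d : ℕ, ((d + c : ℕ) : R) * u d = 1)
    (g : MvPolynomial (Fin N) R) :
    ∑ i, MvPolynomial.X i * MvPolynomial.pderiv i (degScale u g) + c • degScale u g = g := by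
  induction g using MvPolynomial.induction_on' with
  | add p q hp hq =>
    conv_rhs => rw [← hp, ← hq]
    simp only [map_add, mul_add, smul_add, Finset.sum_add_distrib]
    ring
  | monomial m a =>
    rw [degScale_monomial]
    simp only [MvPolynomial.X_mul_pderiv_monomial]
    rw [← Finset.sum_smul, ← add_smul, ← Finsupp.degree_eq_sum, ← map_nsmul]
    congr 1
    rw [nsmul_eq_mul, mul_left_comm, hu, mul_one]

end Abstract

/-- The ring `ℂ[x_0, …, x_{N-1}][λ]`, presented as polynomials in `x` over `ℂ[λ]`. -/
abbrev PolyRing (N : ℕ) : Type := MvPolynomial (Fin N) ℂ[X]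

/-- The `λ`-relative differential forms of degree `k`: alternating `k`-forms on `ℂ^N` with
coefficients in `ℂ[x][λ]`, that is, `ℂ[x][λ] ⊗ Λ^k((ℂ^N)^*)`. -/
abbrev RelForm (N k : ℕ) : Type := (Fin N → ℂ) [⋀^Fin k]→ₗ[ℂ] PolyRing N

instance (N k : ℕ) : AddCommGroup (RelForm N k) := AlternatingMap.instAddCommGroup

instance (N k : ℕ) : IsScalarTower ℂ ℂ[X] (RelForm N k) :=
  ⟨fun c φ η => by ext1 v; exact smul_assoc c φ (η v)⟩

/-- `∂g/∂λ` for `g ∈ ℂ[x][λ]`: differentiate every coefficient. -/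
def lamDeriv (N : ℕ) : PolyRing N →ₗ[ℂ] PolyRing N where
  toFun g := AddMonoidAlgebra.map (Polynomial.derivative (R := ℂ)).toAddMonoidHom g
  map_add' g h := by ext m : 1; simp
  map_smul' c g := by ext m : 1; simp

/-- The derivative `∑ i, v_i ∂g/∂x_i` of `g` in the constant direction `v`. -/
def dirDeriv (N : ℕ) : (Fin N → ℂ) →ₗ[ℂ] PolyRing N →ₗ[ℂ] PolyRing N :=
  LinearMap.mk₂ ℂ (fun v g => ∑ i, v i • MvPolynomial.pderiv i g)
    (fun v w g => by simp [add_smul, Finset.sum_add_distrib])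
    (fun c v g => by simp [mul_smul, Finset.smul_sum])
    (fun v g h => by simp [Finset.sum_add_distrib])
    (fun c v g => by
      simp only [Finset.smul_sum]
      refine Finset.sum_congr rfl fun i _ => ?_
      rw [smul_comm, Derivation.map_smul_of_tower])

theorem dirDeriv_apply {N : ℕ} (v : Fin N → ℂ) (g : PolyRing N) :
    dirDeriv N v g = ∑ i, v i • MvPolynomial.pderiv i g := rfl

theorem dirDeriv_mul {N : ℕ} (v : Fin N → ℂ) (g h : PolyRing N) :
    dirDeriv N v (g * h) = dirDeriv N v g * h + g * dirDeriv N v h := by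
  simp only [dirDeriv_apply, Derivation.leibniz, smul_add, Finset.sum_add_distrib,
    Finset.sum_mul, Finset.mul_sum, smul_eq_mul]
  rw [add_comm]
  congr 1 <;> refine Finset.sum_congr rfl fun i _ => ?_
  · rw [smul_mul_assoc, mul_comm]
  · rw [mul_smul_comm]

theorem dirDeriv_smul {N : ℕ} (v : Fin N → ℂ) (φ : ℂ[X]) (g : PolyRing N) :
    dirDeriv N v (φ • g) = φ • dirDeriv N v g := by
  simp only [dirDeriv_apply, Derivation.map_smul, Finset.smul_sum]
  exact Finset.sum_congr rfl fun i _ => smul_comm _ _ _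

theorem dirDeriv_comm {N : ℕ} (v w : Fin N → ℂ) (g : PolyRing N) :
    dirDeriv N v (dirDeriv N w g) = dirDeriv N w (dirDeriv N v g) := by
  have key : ∀ v w : Fin N → ℂ, dirDeriv N v (dirDeriv N w g) =
      ∑ i, ∑ j, (v i * w j) • MvPolynomial.pderiv i (MvPolynomial.pderiv j g) := by
    intro v w
    rw [dirDeriv_apply w, map_sum, Finset.sum_comm]
    refine Finset.sum_congr rfl fun j _ => ?_
    rw [map_smul, dirDeriv_apply, Finset.smul_sum]
    exact Finset.sum_congr rfl fun i _ => by rw [smul_smul, mul_comm]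
  rw [key, key, Finset.sum_comm]
  exact Finset.sum_congr rfl fun i _ => Finset.sum_congr rfl fun j _ => by
    rw [pderiv_comm, mul_comm]

/-- The derivative of a form along constant vectors, as a linear function of the vector. -/
def formDeriv {N k : ℕ} (η : RelForm N k) : (Fin N → ℂ) →ₗ[ℂ] RelForm N k where
  toFun v := (dirDeriv N v).compAlternatingMap η
  map_add' v w := by ext; simp
  map_smul' c v := by ext; simp

/-- `v ↦ (d_/ f)(v) η`. -/
def dfSmul {N k : ℕ} (f : PolyRing N) (η : RelForm N k) : (Fin N → ℂ) →ₗ[ℂ] RelForm N k where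
  toFun v := dirDeriv N v f • η
  map_add' v w := by ext; simp [add_mul]
  map_smul' c v := by ext; simp

/-- The `λ`-relative exterior differential `d_/ : Ω_/^k → Ω_/^{k+1}`,
`(d_/ η)(v_0, …, v_k) = ∑ i, (-1)^i ∂_{v_i} (η(v_0, …, v̂_i, …, v_k))`. -/
def dRel (N k : ℕ) : RelForm N k →ₗ[ℂ[X]] RelForm N (k + 1) where
  toFun η := AlternatingMap.alternatizeUncurryFin (formDeriv η)
  map_add' η θ := by
    ext1 v
    simp [AlternatingMap.alternatizeUncurryFin_apply, formDeriv, Finset.sum_add_distrib]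
  map_smul' φ η := by
    ext1 v
    simp only [AlternatingMap.alternatizeUncurryFin_apply, formDeriv, LinearMap.coe_mk,
      AddHom.coe_mk, LinearMap.compAlternatingMap_apply, AlternatingMap.smul_apply,
      dirDeriv_smul, Finset.smul_sum, RingHom.id_apply]
    exact Finset.sum_congr rfl fun i _ => smul_comm _ _ _

/-- The exterior product `d_/ f ∧ · : Ω_/^k → Ω_/^{k+1}`,
`(d_/ f ∧ η)(v_0, …, v_k) = ∑ i, (-1)^i (∂_{v_i} f) η(v_0, …, v̂_i, …, v_k)`. -/
def dfWedge {N : ℕ} (f : PolyRing N) (k : ℕ) : RelForm N k →ₗ[ℂ[X]] RelForm N (k + 1) where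
  toFun η := AlternatingMap.alternatizeUncurryFin (dfSmul f η)
  map_add' η θ := by
    ext1 v
    simp [AlternatingMap.alternatizeUncurryFin_apply, dfSmul, Finset.sum_add_distrib]
  map_smul' φ η := by
    ext1 v
    simp only [AlternatingMap.alternatizeUncurryFin_apply, dfSmul, LinearMap.coe_mk,
      AddHom.coe_mk, AlternatingMap.smul_apply, smul_eq_mul, Algebra.mul_smul_comm,
      Finset.smul_sum, RingHom.id_apply]
    exact Finset.sum_congr rfl fun i _ => smul_comm _ _ _

/-- `∂ξ/∂λ` for a relative form `ξ`: differentiate the coefficients. -/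
def lamDerivForm (N k : ℕ) : RelForm N k →ₗ[ℂ] RelForm N k :=
  { toFun := fun η => (lamDeriv N).compAlternatingMap η
    map_add' := fun η θ => by ext1; simp
    map_smul' := fun c η => by ext1; simp }

theorem dRel_apply {N k : ℕ} (η : RelForm N k) (v : Fin (k + 1) → Fin N → ℂ) :
    dRel N k η v = ∑ i : Fin (k + 1), (-1 : ℤ) ^ (i : ℕ) • dirDeriv N (v i) (η (i.removeNth v)) := by
  simp [dRel, AlternatingMap.alternatizeUncurryFin_apply, formDeriv]

theorem dfWedge_apply {N k : ℕ} (f : PolyRing N) (η : RelForm N k)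
    (v : Fin (k + 1) → Fin N → ℂ) :
    dfWedge f k η v =
      ∑ i : Fin (k + 1), (-1 : ℤ) ^ (i : ℕ) • (dirDeriv N (v i) f * η (i.removeNth v)) := by
  simp [dfWedge, AlternatingMap.alternatizeUncurryFin_apply, dfSmul]

theorem dRel_smul_eq {N k : ℕ} (f : PolyRing N) (η : RelForm N k) :
    dRel N k (f • η) = dfWedge f k η + f • dRel N k η := by
  ext1 v
  simp only [dRel_apply, dfWedge_apply, AlternatingMap.add_apply, AlternatingMap.smul_apply,
    smul_eq_mul, dirDeriv_mul, Finset.mul_sum, ← Finset.sum_add_distrib, smul_add]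
  refine Finset.sum_congr rfl fun i _ => ?_
  rw [mul_smul_comm]

theorem dfWedge_smul_eq {N k : ℕ} (f g : PolyRing N) (η : RelForm N k) :
    dfWedge f k (g • η) = g • dfWedge f k η := by
  ext1 v
  rw [AlternatingMap.smul_apply, dfWedge_apply, dfWedge_apply, smul_eq_mul, Finset.mul_sum]
  refine Finset.sum_congr rfl fun i _ => ?_
  rw [mul_smul_comm, AlternatingMap.smul_apply, smul_eq_mul, mul_left_comm]

theorem dfWedge_dfWedge {N k : ℕ} (f : PolyRing N) (η : RelForm N k) :
    dfWedge f (k + 1) (dfWedge f k η) = 0 := by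
  ext1 v
  simp only [dfWedge_apply]
  exact abstract_wedge_wedge (dirDeriv N) f η v

theorem dRel_dfWedge {N k : ℕ} (f : PolyRing N) (η : RelForm N k) :
    dRel N (k + 1) (dfWedge f k η) + dfWedge f (k + 1) (dRel N k η) = 0 := by
  ext1 v
  rw [AlternatingMap.add_apply]
  simp only [dfWedge_apply, dRel_apply]
  exact abstract_d_wedge (dirDeriv N) dirDeriv_mul dirDeriv_comm f η v

/-- Contraction of a form with the Euler vector field `∑ i, x_i ∂/∂x_i`. -/
def eulerContr {N k : ℕ} (η : RelForm N (k + 1)) : RelForm N k :=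
  ∑ i : Fin N, (MvPolynomial.X i : PolyRing N) • η.curryLeft (Pi.single i 1)

theorem eulerContr_apply {N k : ℕ} (η : RelForm N (k + 1)) (v : Fin k → Fin N → ℂ) :
    eulerContr η v = ∑ i : Fin N, MvPolynomial.X i * η (Fin.cons (Pi.single i 1) v) := by
  let e : RelForm N k →+ PolyRing N :=
    { toFun := fun θ => θ v, map_zero' := rfl, map_add' := fun _ _ => rfl }
  change e (∑ i : Fin N, (MvPolynomial.X i : PolyRing N) • η.curryLeft (Pi.single i 1)) = _
  rw [map_sum]
  rfl

theorem dirDeriv_X {N : ℕ} (v : Fin N → ℂ) (i : Fin N) :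
    dirDeriv N v (MvPolynomial.X i) = algebraMap ℂ (PolyRing N) (v i) := by
  rw [dirDeriv_apply, Finset.sum_eq_single i, MvPolynomial.pderiv_X_self, Algebra.algebraMap_eq_smul_one]
  · intro j _ h
    rw [MvPolynomial.pderiv_X_of_ne h.symm, smul_zero]
  · simp

theorem dirDeriv_single {N : ℕ} (i : Fin N) (g : PolyRing N) :
    dirDeriv N (Pi.single i 1) g = MvPolynomial.pderiv i g := by
  rw [dirDeriv_apply, Finset.sum_eq_single i, Pi.single_eq_same, one_smul]
  · intro j _ h
    rw [Pi.single_eq_of_ne h, zero_smul]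
  · simp

theorem cartan_euler {N k : ℕ} (η : RelForm N (k + 1)) (v : Fin (k + 1) → Fin N → ℂ) :
    dRel N k (eulerContr η) v + eulerContr (dRel N (k + 1) η) v =
      ∑ i, MvPolynomial.X i * MvPolynomial.pderiv i (η v) + (k + 1) • η v := by
  have h := abstract_cartan (dirDeriv N) MvPolynomial.X dirDeriv_X dirDeriv_mul η v
  simp only [dirDeriv_single] at h
  simp only [dRel_apply, eulerContr_apply]
  exact h

/-- Polynomial Poincaré lemma: closed relative forms of positive degree are exact. -/
theorem exists_dRel_eq {N k : ℕ} (η : RelForm N (k + 1)) (h : dRel N (k + 1) η = 0) :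
    ∃ θ : RelForm N k, dRel N k θ = η := by
  let u : ℕ → ℂ[X] := fun d => Polynomial.C (((d + (k + 1) : ℕ) : ℂ)⁻¹)
  have hu : ∀ d : ℕ, ((d + (k + 1) : ℕ) : ℂ[X]) * u d = 1 := fun d => by
    have h2 : ((d + (k + 1) : ℕ) : ℂ) ≠ 0 := Nat.cast_ne_zero.mpr (by omega)
    rw [← Polynomial.C_eq_natCast, ← Polynomial.C_mul, mul_inv_cancel₀ h2, Polynomial.C_1]
  let T : RelForm N (k + 1) := ((degScale u).restrictScalars ℂ).compAlternatingMap η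
  have hT : dRel N (k + 1) T = 0 := by
    ext1 v
    have h1 : dRel N (k + 1) T v = degScale (fun d => u (d + 1)) (dRel N (k + 1) η v) := by
      rw [dRel_apply, dRel_apply, map_sum]
      refine Finset.sum_congr rfl fun j _ => ?_
      rw [map_zsmul]
      congr 1
      rw [dirDeriv_apply, dirDeriv_apply, map_sum]
      refine Finset.sum_congr rfl fun i _ => ?_
      rw [LinearMap.map_smul_of_tower, ← pderiv_degScale]
      rfl
    rw [h1, h, AlternatingMap.zero_apply, map_zero]
  refine ⟨eulerContr T, ?_⟩
  ext1 v
  have := cartan_euler T v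
  rw [hT] at this
  have h0 : eulerContr (0 : RelForm N (k + 2)) v = 0 := by
    rw [eulerContr_apply]; simp
  rw [h0, add_zero] at this
  rw [this]
  exact euler_degScale u hu (η v)

theorem dRel_top {N : ℕ} (ω : RelForm N N) : dRel N N ω = 0 := by
  ext1 v
  exact AlternatingMap.map_linearDependent _ v fun hv => by
    have := hv.fintype_card_le_finrank
    simp at this

/-! In what follows `n = m + 1 ≥ 1`, and the variables are `x_0, …, x_n`. -/

/-- The `ℂ[λ]`-submodule `d_/ f ∧ d_/ Ω_/^{n-1}` of `Ω_/^{n+1}`. -/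
def brieskornRel {m : ℕ} (f : PolyRing (m + 2)) : Submodule ℂ[X] (RelForm (m + 2) (m + 2)) :=
  LinearMap.range (dfWedge f (m + 1) ∘ₗ dRel (m + 2) m)

/-- `E_f = Ω_/^{n+1} / d_/ f ∧ d_/ Ω_/^{n-1}`. -/
abbrev BrieskornModule {m : ℕ} (f : PolyRing (m + 2)) : Type :=
  RelForm (m + 2) (m + 2) ⧸ brieskornRel f

/-- The class `[ω] ∈ E_f` of a relative form `ω` of top degree. -/
def toE {m : ℕ} (f : PolyRing (m + 2)) :
    RelForm (m + 2) (m + 2) →ₗ[ℂ[X]] BrieskornModule f :=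
  (brieskornRel f).mkQ

theorem toE_surjective {m : ℕ} (f : PolyRing (m + 2)) : Function.Surjective (toE f) :=
  Submodule.mkQ_surjective _

theorem toE_rel {m : ℕ} (f : PolyRing (m + 2)) (η : RelForm (m + 2) m) :
    toE f (dfWedge f (m + 1) (dRel (m + 2) m η)) = 0 :=
  (Submodule.Quotient.mk_eq_zero _).mpr ⟨η, rfl⟩

theorem dRel_top_surjective (N : ℕ) : Function.Surjective (dRel (N + 1) N) := fun ω =>
  exists_dRel_eq ω (dRel_top ω)

/-- Multiplication by `g ∈ ℂ[x][λ]` on relative forms. -/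
def mulForm {N k : ℕ} (g : PolyRing N) : RelForm N k →ₗ[ℂ[X]] RelForm N k where
  toFun η := g • η
  map_add' := smul_add g
  map_smul' φ η := smul_comm g φ η

/-- The operator `a` on `E_f`, given by multiplication by `f`: `a[ω] = [f ω]`. -/
def opA {m : ℕ} (f : PolyRing (m + 2)) : BrieskornModule f →ₗ[ℂ[X]] BrieskornModule f :=
  (brieskornRel f).liftQ (toE f ∘ₗ mulForm f) (by
    rintro _ ⟨η, rfl⟩
    rw [LinearMap.mem_ker]
    have h : mulForm f (dfWedge f (m + 1) (dRel (m + 2) m η)) =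
        dfWedge f (m + 1) (dRel (m + 2) m (f • η)) := by
      rw [dRel_smul_eq, map_add, dfWedge_dfWedge, zero_add, dfWedge_smul_eq]
      rfl
    change toE f (mulForm f (dfWedge f (m + 1) (dRel (m + 2) m η))) = 0
    rw [h, toE_rel])

theorem opA_toE {m : ℕ} (f : PolyRing (m + 2)) (ω : RelForm (m + 2) (m + 2)) :
    opA f (toE f ω) = toE f (f • ω) := rfl

/-- The map `ω ↦ [d_/ f ∧ d_/^{-1} ω]` from `Ω_/^{n+1}` to `E_f`. -/
def preB {m : ℕ} (f : PolyRing (m + 2)) :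
    RelForm (m + 2) (m + 2) →ₗ[ℂ[X]] BrieskornModule f :=
  (LinearMap.ker (dRel (m + 2) (m + 1))).liftQ (toE f ∘ₗ dfWedge f (m + 1)) (by
    intro ξ hξ
    obtain ⟨η, rfl⟩ := exists_dRel_eq ξ hξ
    exact toE_rel f η) ∘ₗ
  ((dRel (m + 2) (m + 1)).quotKerEquivOfSurjective (dRel_top_surjective (m + 1))).symm

theorem preB_dRel {m : ℕ} (f : PolyRing (m + 2)) (ξ : RelForm (m + 2) (m + 1)) :
    preB f (dRel (m + 2) (m + 1) ξ) = toE f (dfWedge f (m + 1) ξ) := by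
  have h : ((dRel (m + 2) (m + 1)).quotKerEquivOfSurjective (dRel_top_surjective (m + 1))).symm
      (dRel (m + 2) (m + 1) ξ) = Submodule.Quotient.mk ξ := by
    rw [LinearEquiv.symm_apply_eq]
    rfl
  simp only [preB, LinearMap.comp_apply, LinearEquiv.coe_coe]
  rw [h]
  rfl

/-- The operator `b = d_/ f ∧ d_/^{-1}` on `E_f`: `b[d_/ ξ] = [d_/ f ∧ ξ]` for `ξ ∈ Ω_/^n`. -/
def opB {m : ℕ} (f : PolyRing (m + 2)) : BrieskornModule f →ₗ[ℂ[X]] BrieskornModule f :=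
  (brieskornRel f).liftQ (preB f) (by
    rintro _ ⟨η, rfl⟩
    rw [LinearMap.mem_ker]
    have h : dfWedge f (m + 1) (dRel (m + 2) m η) = dRel (m + 2) (m + 1) (-dfWedge f m η) := by
      rw [map_neg]
      exact eq_neg_of_add_eq_zero_right (dRel_dfWedge f η)
    change preB f (dfWedge f (m + 1) (dRel (m + 2) m η)) = 0
    rw [h, preB_dRel, map_neg, dfWedge_dfWedge, neg_zero, map_zero])

theorem opB_toE {m : ℕ} (f : PolyRing (m + 2)) (ξ : RelForm (m + 2) (m + 1)) :
    opB f (toE f (dRel (m + 2) (m + 1) ξ)) = toE f (dfWedge f (m + 1) ξ) :=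
  preB_dRel f ξ

/-- The commutation relation `a b - b a = b²`; with `ℂ[λ]`-linearity of `a` and `b` it says that
`E_f` is a left module over `𝒜[λ]`. -/
theorem opA_opB {m : ℕ} (f : PolyRing (m + 2)) (e : BrieskornModule f) :
    opA f (opB f e) = opB f (opA f e) + opB f (opB f e) := by
  obtain ⟨ω, rfl⟩ := toE_surjective f e
  obtain ⟨ξ, rfl⟩ := dRel_top_surjective (m + 1) ω
  rw [opB_toE, opA_toE, opA_toE, ← map_add, ← map_add, ← dfWedge_smul_eq, ← opB_toE,
    dRel_smul_eq, add_comm (dfWedge f (m + 1) ξ)]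

/-- The `b`-torsion of `E_f`: the elements killed by a power of `b`. -/
def bTorsion {m : ℕ} (f : PolyRing (m + 2)) : Submodule ℂ[X] (BrieskornModule f) :=
  ⨆ k : ℕ, LinearMap.ker (opB f ^ k)

theorem mem_bTorsion {m : ℕ} (f : PolyRing (m + 2)) (e : BrieskornModule f) :
    e ∈ bTorsion f ↔ ∃ k : ℕ, (opB f ^ k) e = 0 := by
  rw [bTorsion, Submodule.mem_iSup_of_directed]
  · rfl
  · refine directed_of_isDirected_le fun i j hij e he => ?_
    obtain ⟨l, rfl⟩ := Nat.exists_eq_add_of_le' hij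
    rw [LinearMap.mem_ker, pow_add, Module.End.mul_apply, LinearMap.mem_ker.mp he, map_zero]

theorem opB_pow_opA {m : ℕ} (f : PolyRing (m + 2)) (k : ℕ) (e : BrieskornModule f) :
    (opB f ^ k) (opA f e) = opA f ((opB f ^ k) e) - k • (opB f ^ (k + 1)) e := by
  induction k generalizing e with
  | zero => simp
  | succ k ih =>
    rw [pow_succ', Module.End.mul_apply, ih, map_sub, eq_sub_iff_add_eq.mpr (opA_opB f _).symm,
      map_nsmul, ← Module.End.mul_apply (opB f) (opB f ^ k), ← pow_succ',
      ← Module.End.mul_apply (opB f) (opB f ^ (k + 1)), ← pow_succ', succ_nsmul]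
    abel

/-- `Ẽ_f = E_f / (b-torsion)`. -/
abbrev ReducedModule {m : ℕ} (f : PolyRing (m + 2)) : Type :=
  BrieskornModule f ⧸ bTorsion f

/-- The quotient map `E_f → Ẽ_f`. -/
def toRed {m : ℕ} (f : PolyRing (m + 2)) : BrieskornModule f →ₗ[ℂ[X]] ReducedModule f :=
  (bTorsion f).mkQ

/-- The operator induced by `a` on `Ẽ_f`. -/
def redA {m : ℕ} (f : PolyRing (m + 2)) : ReducedModule f →ₗ[ℂ[X]] ReducedModule f :=
  (bTorsion f).mapQ (bTorsion f) (opA f) (by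
    intro e he
    obtain ⟨k, hk⟩ := (mem_bTorsion f e).mp he
    refine (mem_bTorsion f _).mpr ⟨k, ?_⟩
    rw [opB_pow_opA, pow_succ', Module.End.mul_apply, hk, map_zero, map_zero, smul_zero, sub_zero])

/-- The operator induced by `b` on `Ẽ_f`. -/
def redB {m : ℕ} (f : PolyRing (m + 2)) : ReducedModule f →ₗ[ℂ[X]] ReducedModule f :=
  (bTorsion f).mapQ (bTorsion f) (opB f) (by
    intro e he
    obtain ⟨k, hk⟩ := (mem_bTorsion f e).mp he
    refine (mem_bTorsion f _).mpr ⟨k, ?_⟩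
    rw [← Module.End.mul_apply, ← pow_succ, pow_succ', Module.End.mul_apply, hk, map_zero])

/-- `Dop : M → M'`, defined on a `ℂ[λ]`-submodule `M` of `M'`, is a `λ`-connection: it is
`ℂ`-linear and `Dop (φ y) = φ' y + φ Dop y` for `φ ∈ ℂ[λ]`. -/
def IsLambdaConnection {M' : Type*} [AddCommGroup M'] [Module ℂ M'] [Module ℂ[X] M']
    [IsScalarTower ℂ ℂ[X] M'] (M : Submodule ℂ[X] M') (Dop : M →ₗ[ℂ] M') : Prop :=
  ∀ (φ : ℂ[X]) (y : M), Dop (φ • y) = Polynomial.derivative φ • (y : M') + φ • Dop y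

/-! ### Period integrals -/

/-- The value `g(x, l)` of `g ∈ ℂ[x][λ]` at a point `(x, l) ∈ ℂ^N × ℂ`. -/
def evalAt {N : ℕ} (x : Fin N → ℂ) (l : ℂ) : PolyRing N →+* ℂ :=
  MvPolynomial.eval₂Hom (Polynomial.evalRingHom l) x

theorem evalAt_smul {N : ℕ} (x : Fin N → ℂ) (l c : ℂ) (g : PolyRing N) :
    evalAt x l (c • g) = c * evalAt x l g := by
  rw [← smul_one_smul ℂ[X] c g, MvPolynomial.smul_eq_C_mul, map_mul]
  simp [evalAt, Polynomial.smul_eq_C_mul]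

/-- Evaluation at `(x, l)` as a `ℂ`-linear form. -/
def evalLin {N : ℕ} (x : Fin N → ℂ) (l : ℂ) : PolyRing N →ₗ[ℂ] ℂ where
  toFun := evalAt x l
  map_add' := map_add _
  map_smul' c g := evalAt_smul x l c g

/-- The alternating form on `ℂ^N` which is the value of the relative form `η` at `(x, l)`. -/
def formAt {N k : ℕ} (η : RelForm N k) (x : Fin N → ℂ) (l : ℂ) :
    (Fin N → ℂ) [⋀^Fin k]→ₗ[ℂ] ℂ :=
  (evalLin x l).compAlternatingMap η

/-- The relative differential `d_/ f` at `(x, l)`, a linear form on `ℂ^N`. -/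
def dfAt {N : ℕ} (f : PolyRing N) (x : Fin N → ℂ) (l : ℂ) : (Fin N → ℂ) →ₗ[ℂ] ℂ :=
  evalLin x l ∘ₗ (dirDeriv N).flip f

/-- The fibre over `p = (s, l)` of the map `(x, λ) ↦ (f(x, λ), λ)`, as a subset of `ℂ^N`. -/
def fiber {N : ℕ} (f : PolyRing N) (p : ℂ × ℂ) : Set (Fin N → ℂ) :=
  {x | evalAt x p.2 f = p.1}

/-- The set `C(f, λ)` of critical values of the map `(x, λ) ↦ (f(x, λ), λ)` from
`ℂ^N × ℂ^*` to `ℂ × ℂ^*`: a point `(x, l)` is critical when `d_/ f` vanishes there. -/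
def criticalValues {N : ℕ} (f : PolyRing N) : Set (ℂ × ℂ) :=
  {p | p.2 ≠ 0 ∧ ∃ x ∈ fiber f p, dfAt f x p.2 = 0}

/-- A vector on which `d_/ f` does not vanish at a non-critical point: the conjugate gradient. -/
def conjGrad {N : ℕ} (f : PolyRing N) (x : Fin N → ℂ) (l : ℂ) : Fin N → ℂ :=
  fun i => starRingEnd ℂ (evalAt x l (MvPolynomial.pderiv i f))

/-- The Gelfand–Leray form `ω / d_/ f` at a non-critical point `(x, l)`, evaluated on vectors
`v_1, …, v_n` tangent to the fibre: it is `ω(w, v_1, …, v_n) / (d_/ f)(w)` for any `w` with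
`(d_/ f)(w) ≠ 0`, and here `w` is the conjugate gradient. -/
def gelfandLeray {m : ℕ} (f : PolyRing (m + 2)) (ω : RelForm (m + 2) (m + 2))
    (x : Fin (m + 2) → ℂ) (l : ℂ) (v : Fin (m + 1) → Fin (m + 2) → ℂ) : ℂ :=
  formAt ω x l (Fin.cons (conjGrad f x l) v) / dfAt f x l (conjGrad f x l)

theorem dfAt_apply {N : ℕ} (f : PolyRing N) (x : Fin N → ℂ) (l : ℂ) (w : Fin N → ℂ) :
    dfAt f x l w = ∑ i, w i * evalAt x l (MvPolynomial.pderiv i f) := by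
  change evalAt x l (dirDeriv N w f) = _
  rw [dirDeriv_apply, map_sum]
  exact Finset.sum_congr rfl fun i _ => evalAt_smul _ _ _ _

theorem dfAt_conjGrad_ne_zero {N : ℕ} {f : PolyRing N} {x : Fin N → ℂ} {l : ℂ}
    (h : dfAt f x l ≠ 0) : dfAt f x l (conjGrad f x l) ≠ 0 := by
  intro h0
  have h1 : dfAt f x l (conjGrad f x l) =
      ((∑ i, Complex.normSq (evalAt x l (MvPolynomial.pderiv i f)) : ℝ) : ℂ) := by
    rw [dfAt_apply, Complex.ofReal_sum]
    exact Finset.sum_congr rfl fun i _ => by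
      rw [conjGrad, mul_comm, Complex.mul_conj]
  rw [h1, Complex.ofReal_eq_zero,
    Finset.sum_eq_zero_iff_of_nonneg fun i _ => Complex.normSq_nonneg _] at h0
  refine h (LinearMap.ext fun w => ?_)
  rw [dfAt_apply, LinearMap.zero_apply]
  exact Finset.sum_eq_zero fun i hi => by
    rw [Complex.normSq_eq_zero.mp (h0 i hi), mul_zero]

/-- The Gelfand–Leray form `u = ω / d_/ f` satisfies `d_/ f ∧ u = ω`. -/
theorem gelfandLeray_spec {m : ℕ} (f : PolyRing (m + 2)) (ω : RelForm (m + 2) (m + 2))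
    (x : Fin (m + 2) → ℂ) (l : ℂ) (hx : dfAt f x l ≠ 0)
    (v : Fin (m + 1) → Fin (m + 2) → ℂ) (hv : ∀ j, dfAt f x l (v j) = 0)
    (w : Fin (m + 2) → ℂ) :
    dfAt f x l w * gelfandLeray f ω x l v = formAt ω x l (Fin.cons w v) := by
  have hg := dfAt_conjGrad_ne_zero hx
  set g := conjGrad f x l with hg'
  let u : Fin (m + 2) → ℂ := dfAt f x l g • w - dfAt f x l w • g
  have hu : dfAt f x l u = 0 := by
    simp only [u, map_sub, map_smul, smul_eq_mul]
    ring
  have hker : Module.finrank ℂ (LinearMap.ker (dfAt f x l)) < m + 2 := by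
    have h := Submodule.finrank_lt (s := LinearMap.ker (dfAt f x l)) (by
      rwa [Ne, LinearMap.ker_eq_top])
    simpa using h
  have h0 : formAt ω x l (Fin.cons u v) = 0 := by
    refine AlternatingMap.map_linearDependent _ _ fun hli => ?_
    have hmem : ∀ j, (Fin.cons u v : Fin (m + 2) → Fin (m + 2) → ℂ) j ∈
        LinearMap.ker (dfAt f x l) := by
      intro j
      refine Fin.cases ?_ (fun j => ?_) j
      · simpa using hu
      · simpa using hv j
    have hli' : LinearIndependent ℂ fun j => (⟨_, hmem j⟩ : LinearMap.ker (dfAt f x l)) :=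
      LinearIndependent.of_comp (LinearMap.ker (dfAt f x l)).subtype hli
    have := hli'.fintype_card_le_finrank
    rw [Fintype.card_fin] at this
    omega
  have h1 : formAt ω x l (Fin.cons u v) =
      dfAt f x l g * formAt ω x l (Fin.cons w v) -
        dfAt f x l w * formAt ω x l (Fin.cons g v) := by
    have hc : ∀ y, formAt ω x l (Fin.cons y v) = (formAt ω x l).curryLeft y v := fun y => rfl
    simp only [hc, u, map_sub, map_smul, AlternatingMap.sub_apply, AlternatingMap.smul_apply,
      smul_eq_mul]
  rw [gelfandLeray, ← hg', mul_div_assoc', div_eq_iff hg]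
  rw [h0] at h1
  linear_combination h1

/-! Singular homology is computed by smooth singular cubes modulo degenerate cubes. -/

/-- Cubical chains with complex coefficients: formal combinations of maps `[0,1]^k → X`. -/
abbrev CubChain (k : ℕ) (X : Type) : Type := ((Fin k → unitInterval) → X) →₀ ℂ

/-- The face `t_i = ε` of a cube. -/
def face {k : ℕ} {X : Type} (i : Fin (k + 1)) (ε : unitInterval)
    (σ : (Fin (k + 1) → unitInterval) → X) : (Fin k → unitInterval) → X :=
  fun t => σ (i.insertNth ε t)

/-- The boundary `∂σ = ∑ i, (-1)^i (σ|_{t_i = 1} - σ|_{t_i = 0})`, with `i = 0, …, k`. -/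
def boundary (k : ℕ) (X : Type) : CubChain (k + 1) X →ₗ[ℂ] CubChain k X :=
  Finsupp.linearCombination ℂ fun σ => ∑ i : Fin (k + 1),
    (-1 : ℤ) ^ (i : ℕ) • (Finsupp.single (face i 1 σ) (1 : ℂ) - Finsupp.single (face i 0 σ) 1)

/-- The span of the degenerate cubes, those that do not depend on one of the coordinates. -/
def degenerate (k : ℕ) (X : Type) : Submodule ℂ (CubChain k X) :=
  Submodule.span ℂ {c | ∃ σ : (Fin k → unitInterval) → X,
    (∃ i, ∀ t r, σ (Function.update t i r) = σ t) ∧ c = Finsupp.single σ 1}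

/-- Extension of a cube to `ℝ^k` by projecting each coordinate to `[0,1]`; only its restriction
to `[0,1]^k` is used. -/
def cubeExt {k : ℕ} {X : Type} (σ : (Fin k → unitInterval) → X) : (Fin k → ℝ) → X :=
  fun t => σ fun i => Set.projIcc 0 1 zero_le_one (t i)

/-- All cubes of the chain are smooth, with values in `F`. -/
def IsSmoothIn {k N : ℕ} (F : Set (Fin N → ℂ)) (c : CubChain k (Fin N → ℂ)) : Prop :=
  ∀ σ ∈ c.support, ContDiffOn ℝ (⊤ : ℕ∞) (cubeExt σ) (Set.Icc 0 1) ∧ ∀ t, σ t ∈ F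

/-- Smooth singular cycles in `F` (automatically of compact support). -/
def IsCycleIn {k N : ℕ} (F : Set (Fin N → ℂ)) (c : CubChain (k + 1) (Fin N → ℂ)) : Prop :=
  IsSmoothIn F c ∧ boundary k _ c ∈ degenerate k _

/-- Two chains are homologous in `F`. -/
def HomologousIn {k N : ℕ} (F : Set (Fin N → ℂ)) (c c' : CubChain k (Fin N → ℂ)) : Prop :=
  ∃ e : CubChain (k + 1) (Fin N → ℂ), IsSmoothIn F e ∧ c - c' - boundary k _ e ∈ degenerate k _

/-- The integral of `ω / d_/ f` over a smooth `n`-cube in a fibre over `(s, l)`. -/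
def cubeIntegral {m : ℕ} (f : PolyRing (m + 2)) (ω : RelForm (m + 2) (m + 2)) (l : ℂ)
    (σ : (Fin (m + 1) → unitInterval) → Fin (m + 2) → ℂ) : ℂ :=
  ∫ t in Set.Icc (0 : Fin (m + 1) → ℝ) 1, gelfandLeray f ω (cubeExt σ t) l fun j =>
    fderivWithin ℝ (cubeExt σ) (Set.Icc 0 1) t (Pi.single j 1)

/-- The period `∫_c ω / d_/ f` over an `n`-chain `c` in a fibre over `(s, l)`. -/
def period {m : ℕ} (f : PolyRing (m + 2)) (ω : RelForm (m + 2) (m + 2)) (l : ℂ)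
    (c : CubChain (m + 1) (Fin (m + 2) → ℂ)) : ℂ :=
  c.sum fun σ a => a * cubeIntegral f ω l σ

/-- The member at `p` of a family of chains over a parameter set `V`. A family of cubes is a
cube in the space of functions on `V`. -/
def evalChain {k N : ℕ} {V : Set (ℂ × ℂ)} (p : V) (G : CubChain k (V → Fin N → ℂ)) :
    CubChain k (Fin N → ℂ) :=
  G.mapDomain fun σ t => σ t p

/-- A smooth family over `V` of cycles in the fibres of `(f, λ)`: a combination of families of
cubes, jointly smooth in the cube coordinates and the parameters, whose relative boundary
vanishes (modulo families of degenerate cubes). -/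
def IsCycleFamily {k N : ℕ} (f : PolyRing N) (V : Set (ℂ × ℂ))
    (G : CubChain (k + 1) (V → Fin N → ℂ)) : Prop :=
  (∀ σ ∈ G.support,
    (∃ g : (Fin (k + 1) → ℝ) × ℂ × ℂ → Fin N → ℂ,
      ContDiffOn ℝ (⊤ : ℕ∞) g (Set.Icc 0 1 ×ˢ V) ∧
        ∀ t ∈ Set.Icc (0 : Fin (k + 1) → ℝ) 1, ∀ p : V, g (t, p) = cubeExt σ t p) ∧
      ∀ t, ∀ p : V, σ t p ∈ fiber f p) ∧
  boundary k _ G ∈ degenerate k _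

/-- `γ` is a horizontal family over `U` of compact `n`-cycles in the fibres of `(f, λ)`: near
every point of `U`, its members are homologous, in their fibres, to the members of a smooth
family of cycles. -/
structure IsHorizontalFamily {k N : ℕ} (f : PolyRing N) (U : Set (ℂ × ℂ))
    (γ : ℂ × ℂ → CubChain (k + 1) (Fin N → ℂ)) : Prop where
  isCycle : ∀ p ∈ U, IsCycleIn (fiber f p) (γ p)
  flat : ∀ p₀ ∈ U, ∃ V : Set (ℂ × ℂ), IsOpen V ∧ p₀ ∈ V ∧ V ⊆ U ∧
    ∃ G : CubChain (k + 1) (V → Fin N → ℂ), IsCycleFamily f V G ∧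
      ∀ p : V, HomologousIn (fiber f p) (γ p) (evalChain p G)

end
end PeriodConnection

namespace PeriodConnection

noncomputable section

/-! The algebra rests on the polynomial Poincaré lemma: every top form is some $d_/\xi$, and two
primitives differ by some $d_/\eta$. Write $g=\partial f/\partial\lambda$. Since $\partial_\lambda$
commutes with $d_/$, replacing $\xi$ by $\xi+d_/\eta$ changes the formula for $\nabla$ by
$d_/f\wedge d_/(\partial_\lambda\eta)$, which is a relation. A relation $d_/f\wedge
d_/\eta=d_/(-d_/f\wedge\eta)$ is sent to $-d_/f\wedge d_/(g\eta)$, again a relation. Hence $\nabla$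
exists (`preNabla_dRel`, `preNabla_rel`), and its commutation rules follow from choosing primitives
well (`opNabla_opB`, `opNabla_opA`).

For the analysis, the Gelfand–Leray form of $d_/f\wedge\xi$ restricts to $\xi$ on a smooth fibre
(`gelfandLeray_dfWedge`), so the period of $b[d_/\xi]$ is $\int_\gamma\xi$, without denominators.
The Gelfand–Leray form is closed on smooth fibres (`extDeriv_leray_eq_zero`), so by Stokes its
integrals depend only on homology classes, and $\gamma$ may be replaced locally by a smooth family
of cycles. Stokes on the prism swept out when the parameter moves from $p$ to $p+\nu$ gives the
derivative of $\int_\gamma\xi$ as the integral of $d\xi=d_/\xi+d\lambda\wedge\partial_\lambda\xi$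
contracted with the velocity of the family (`hasFDerivAt_chainIntegral`). The fibre equation forces
the velocity $(w,\nu_2)$ to satisfy $d_/f(w)+\nu_2\,g=\nu_1$. The contraction is therefore
$\nu_1\,d_/\xi/d_/f+\nu_2\,(d_/f\wedge\partial_\lambda\xi-g\,d_/\xi)/d_/f$ (`familyDeriv_polyForm`).
Its coefficients are the integrands for $[\omega]$ and $\nabla[\omega]$ with $\omega=d_/\xi$, which
proves both derivative formulas for $b[\omega]$.

The families are only real smooth in the parameters, so holomorphy of the period of $\omega$ itself
needs an argument. Let $H$ be the period of $b[\omega]$, with $dH=A\,ds+B\,d\lambda$ where $A$, $B$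
are the periods of $\omega$ and of $\nabla[\omega]$, both real differentiable. Symmetry of the
second derivative of $H$ gives $dA(\nu)=\nu_1\,dA(1,0)+\nu_2\,dB(1,0)$, which is complex linear
(`hasFDerivAt_of_coefficient`). Its $\lambda$-component is the last identity $\partial_\lambda
A=\partial_s B$. -/

/-! ### Differentiation of coefficients in $\lambda$ -/

theorem lamDeriv_monomial {N : ℕ} (d : Fin N →₀ ℕ) (φ : ℂ[X]) :
    lamDeriv N (MvPolynomial.monomial d φ) =
      MvPolynomial.monomial d (Polynomial.derivative φ) := by
  change AddMonoidAlgebra.map _ (AddMonoidAlgebra.single d φ) = AddMonoidAlgebra.single d _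
  simp

theorem lamDeriv_mul {N : ℕ} (g h : PolyRing N) :
    lamDeriv N (g * h) = lamDeriv N g * h + g * lamDeriv N h := by
  induction g using MvPolynomial.induction_on' with
  | add p q hp hq => simp only [add_mul, map_add, hp, hq]; ring
  | monomial d φ =>
    induction h using MvPolynomial.induction_on' with
    | add p q hp hq => simp only [mul_add, map_add, hp, hq]; ring
    | monomial e ψ =>
      simp only [MvPolynomial.monomial_mul, lamDeriv_monomial, Polynomial.derivative_mul, map_add]

theorem lamDeriv_smul {N : ℕ} (φ : ℂ[X]) (g : PolyRing N) :
    lamDeriv N (φ • g) = Polynomial.derivative φ • g + φ • lamDeriv N g := by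
  rw [MvPolynomial.smul_eq_C_mul, lamDeriv_mul, MvPolynomial.smul_eq_C_mul,
    MvPolynomial.smul_eq_C_mul, ← MvPolynomial.monomial_zero', lamDeriv_monomial,
    MvPolynomial.monomial_zero']

theorem lamDeriv_pderiv {N : ℕ} (i : Fin N) (g : PolyRing N) :
    lamDeriv N (MvPolynomial.pderiv i g) = MvPolynomial.pderiv i (lamDeriv N g) := by
  induction g using MvPolynomial.induction_on' with
  | add p q hp hq => simp only [map_add, hp, hq]
  | monomial d φ =>
    simp [MvPolynomial.pderiv_monomial, lamDeriv_monomial]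

theorem lamDeriv_dirDeriv {N : ℕ} (v : Fin N → ℂ) (g : PolyRing N) :
    lamDeriv N (dirDeriv N v g) = dirDeriv N v (lamDeriv N g) := by
  simp only [dirDeriv_apply, map_sum, map_smul, lamDeriv_pderiv]

theorem lamDerivForm_apply {N k : ℕ} (η : RelForm N k) (v : Fin k → Fin N → ℂ) :
    lamDerivForm N k η v = lamDeriv N (η v) := rfl

theorem lamDerivForm_smul {N k : ℕ} (g : PolyRing N) (η : RelForm N k) :
    lamDerivForm N k (g • η) = lamDeriv N g • η + g • lamDerivForm N k η := by
  ext1 v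
  simp [lamDerivForm_apply, lamDeriv_mul]

theorem lamDerivForm_polynomial_smul {N k : ℕ} (φ : ℂ[X]) (η : RelForm N k) :
    lamDerivForm N k (φ • η) = Polynomial.derivative φ • η + φ • lamDerivForm N k η := by
  ext1 v
  simp [lamDerivForm_apply, lamDeriv_smul]

theorem lamDerivForm_dRel {N k : ℕ} (η : RelForm N k) :
    lamDerivForm N (k + 1) (dRel N k η) = dRel N k (lamDerivForm N k η) := by
  ext1 v
  simp only [lamDerivForm_apply, dRel_apply, map_sum, map_zsmul, lamDeriv_dirDeriv]

theorem lamDerivForm_dfWedge {N k : ℕ} (f : PolyRing N) (η : RelForm N k) :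
    lamDerivForm N (k + 1) (dfWedge f k η) =
      dfWedge (lamDeriv N f) k η + dfWedge f k (lamDerivForm N k η) := by
  ext1 v
  simp only [lamDerivForm_apply, dfWedge_apply, map_sum, map_zsmul, lamDeriv_mul,
    lamDeriv_dirDeriv, AlternatingMap.add_apply, smul_add, Finset.sum_add_distrib]

/-! ### The operator $\nabla$ on $E_f$ -/

/-- A surjection of vector spaces over the field $\mathbb{C}$ splits. A linear choice of primitives
makes `preNabla` linear by construction; that the choice does not matter is `preNabla_dRel`. -/
theorem exists_section_dRel (N : ℕ) :
    ∃ S : RelForm (N + 1) (N + 1) →ₗ[ℂ] RelForm (N + 1) N, ∀ ω, dRel (N + 1) N (S ω) = ω := by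
  obtain ⟨S, hS⟩ := ((dRel (N + 1) N).restrictScalars ℂ).exists_rightInverse_of_surjective
    (LinearMap.range_eq_top.mpr (dRel_top_surjective N))
  exact ⟨S, fun ω => LinearMap.congr_fun hS ω⟩

/-- The map `ω ↦ [d_/ f ∧ ∂(d_/^{-1} ω)/∂λ - (∂f/∂λ) ω]` from `Ω_/^{n+1}` to `E_f`. -/
def preNabla {m : ℕ} (f : PolyRing (m + 2)) :
    RelForm (m + 2) (m + 2) →ₗ[ℂ] BrieskornModule f :=
  (toE f).restrictScalars ℂ ∘ₗ
    ((dfWedge f (m + 1)).restrictScalars ℂ ∘ₗ lamDerivForm (m + 2) (m + 1) ∘ₗ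
        (exists_section_dRel (m + 1)).choose -
      (mulForm (lamDeriv (m + 2) f)).restrictScalars ℂ)

theorem preNabla_dRel {m : ℕ} (f : PolyRing (m + 2)) (ξ : RelForm (m + 2) (m + 1)) :
    preNabla f (dRel (m + 2) (m + 1) ξ) =
      toE f (dfWedge f (m + 1) (lamDerivForm (m + 2) (m + 1) ξ) -
        lamDeriv (m + 2) f • dRel (m + 2) (m + 1) ξ) := by
  have hS := (exists_section_dRel (m + 1)).choose_spec (dRel (m + 2) (m + 1) ξ)
  have h : preNabla f (dRel (m + 2) (m + 1) ξ) =
      toE f (dfWedge f (m + 1) (lamDerivForm (m + 2) (m + 1)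
        ((exists_section_dRel (m + 1)).choose (dRel (m + 2) (m + 1) ξ))) -
        lamDeriv (m + 2) f • dRel (m + 2) (m + 1) ξ) := rfl
  rw [h]
  set ζ := (exists_section_dRel (m + 1)).choose (dRel (m + 2) (m + 1) ξ)
  -- The chosen primitive $\zeta$ and the given $\xi$ differ by a closed, hence exact, form
  -- $d_/\eta$, which contributes only the relation $d_/f\wedge d_/(\partial_\lambda\eta)$.
  obtain ⟨η, hη⟩ := exists_dRel_eq (ζ - ξ) (by rw [map_sub, hS, sub_self])
  rw [show ζ = dRel (m + 2) m η + ξ by rw [hη, sub_add_cancel]]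
  rw [map_add, lamDerivForm_dRel, map_add, add_sub_assoc, map_add, toE_rel, zero_add]

theorem preNabla_rel {m : ℕ} (f : PolyRing (m + 2)) (η : RelForm (m + 2) m) :
    preNabla f (dfWedge f (m + 1) (dRel (m + 2) m η)) = 0 := by
  have h : dfWedge f (m + 1) (dRel (m + 2) m η) = dRel (m + 2) (m + 1) (-dfWedge f m η) := by
    rw [map_neg]
    exact eq_neg_of_add_eq_zero_right (dRel_dfWedge f η)
  -- With $g=\partial f/\partial\lambda$ and the primitive $-d_/f\wedge\eta$, the formula for
  -- $\nabla$ gives $-(d_/f\wedge d_/g\wedge\eta+g\,d_/f\wedge d_/\eta)=-d_/f\wedge d_/(g\eta)$, so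
  -- the relation attached to $g\eta$ is the one required.
  have h2 := toE_rel f (lamDeriv (m + 2) f • η)
  rw [dRel_smul_eq, map_add, dfWedge_smul_eq] at h2
  rw [h, preNabla_dRel, ← h, map_neg (lamDerivForm (m + 2) (m + 1)), lamDerivForm_dfWedge,
    map_neg, map_add, dfWedge_dfWedge, add_zero, ← neg_add', map_neg, h2, neg_zero]

/-- The operator `∇` on `E_f`. -/
def opNabla {m : ℕ} (f : PolyRing (m + 2)) : BrieskornModule f →ₗ[ℂ] BrieskornModule f :=
  ((brieskornRel f).restrictScalars ℂ).liftQ (preNabla f) (by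
    rintro _ ⟨η, rfl⟩
    exact preNabla_rel f η) ∘ₗ
  (Submodule.Quotient.restrictScalarsEquiv ℂ (brieskornRel f)).symm.toLinearMap

theorem opNabla_dRel {m : ℕ} (f : PolyRing (m + 2)) (ξ : RelForm (m + 2) (m + 1)) :
    opNabla f (toE f (dRel (m + 2) (m + 1) ξ)) =
      toE f (dfWedge f (m + 1) (lamDerivForm (m + 2) (m + 1) ξ) -
        lamDeriv (m + 2) f • dRel (m + 2) (m + 1) ξ) :=
  preNabla_dRel f ξ

theorem exists_toE_dRel_eq {m : ℕ} (f : PolyRing (m + 2)) (e : BrieskornModule f) :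
    ∃ ξ, toE f (dRel (m + 2) (m + 1) ξ) = e := by
  obtain ⟨ω, rfl⟩ := toE_surjective f e
  obtain ⟨ξ, rfl⟩ := dRel_top_surjective (m + 1) ω
  exact ⟨ξ, rfl⟩

/-- If $d_/\zeta=d_/f\wedge\xi$, differentiating in $\lambda$ shows that the representative of
$\nabla[d_/\xi]$ has the primitive $\partial_\lambda\zeta-(\partial f/\partial\lambda)\,\xi$.
Applying $b$ through this primitive gives the formula for $\nabla[d_/\zeta]$. -/
theorem opNabla_opB {m : ℕ} (f : PolyRing (m + 2)) (e : BrieskornModule f) :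
    opNabla f (opB f e) = opB f (opNabla f e) := by
  obtain ⟨ξ, rfl⟩ := exists_toE_dRel_eq f e
  obtain ⟨ζ, hζ⟩ := dRel_top_surjective (m + 1) (dfWedge f (m + 1) ξ)
  have h : dfWedge f (m + 1) (lamDerivForm (m + 2) (m + 1) ξ) -
      lamDeriv (m + 2) f • dRel (m + 2) (m + 1) ξ =
      dRel (m + 2) (m + 1) (lamDerivForm (m + 2) (m + 1) ζ - lamDeriv (m + 2) f • ξ) := by
    rw [map_sub, ← lamDerivForm_dRel, hζ, lamDerivForm_dfWedge, dRel_smul_eq]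
    abel
  rw [opB_toE, opNabla_dRel, h, opB_toE, ← hζ, opNabla_dRel, hζ,
    map_sub (dfWedge f (m + 1)), dfWedge_smul_eq]

/-- By the Leibniz rule $a[d_/\xi]=[d_/(f\xi)]-b[d_/\xi]$. In $\nabla[d_/(f\xi)]$ the two terms
$(\partial f/\partial\lambda)\,d_/f\wedge\xi$ cancel, which leaves $a\nabla[d_/\xi]$; the term
$-b\nabla$ comes from $\nabla b=b\nabla$. -/
theorem opNabla_opA {m : ℕ} (f : PolyRing (m + 2)) (e : BrieskornModule f) :
    opNabla f (opA f e) = opA f (opNabla f e) - opB f (opNabla f e) := by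
  obtain ⟨ξ, rfl⟩ := exists_toE_dRel_eq f e
  have h : opA f (toE f (dRel (m + 2) (m + 1) ξ)) =
      toE f (dRel (m + 2) (m + 1) (f • ξ)) - opB f (toE f (dRel (m + 2) (m + 1) ξ)) := by
    rw [opA_toE, opB_toE, dRel_smul_eq, map_add, add_sub_cancel_left]
  rw [h, map_sub, opNabla_opB, opNabla_dRel, opNabla_dRel, opA_toE]
  congr 2
  rw [lamDerivForm_smul, map_add, dfWedge_smul_eq, dfWedge_smul_eq, dRel_smul_eq, smul_add,
    smul_sub, smul_comm f (lamDeriv (m + 2) f)]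
  abel

theorem opNabla_smul {m : ℕ} (f : PolyRing (m + 2)) (φ : ℂ[X]) (e : BrieskornModule f) :
    opNabla f (φ • e) = Polynomial.derivative φ • opB f e + φ • opNabla f e := by
  obtain ⟨ξ, rfl⟩ := exists_toE_dRel_eq f e
  rw [← map_smul (toE f), ← map_smul (dRel (m + 2) (m + 1)), opNabla_dRel, opNabla_dRel, opB_toE,
    ← map_smul (toE f), ← map_smul (toE f), ← map_add (toE f), lamDerivForm_polynomial_smul, map_add (dfWedge f (m + 1)),
    map_smul (dfWedge f (m + 1)), map_smul (dfWedge f (m + 1)), map_smul (dRel (m + 2) (m + 1)),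
    smul_sub, smul_comm φ (lamDeriv (m + 2) f), add_sub_assoc]

/-! ### The quotient by $b$-torsion and the connection $b^{-1}\nabla$ -/

theorem opB_pow_opNabla {m : ℕ} (f : PolyRing (m + 2)) (k : ℕ) (e : BrieskornModule f) :
    (opB f ^ k) (opNabla f e) = opNabla f ((opB f ^ k) e) := by
  induction k with
  | zero => rfl
  | succ k ih => rw [pow_succ', Module.End.mul_apply, Module.End.mul_apply, ih, opNabla_opB]

/-- The operator induced by `∇` on `Ẽ_f`. -/
def redNabla {m : ℕ} (f : PolyRing (m + 2)) : ReducedModule f →ₗ[ℂ] ReducedModule f :=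
  ((bTorsion f).restrictScalars ℂ).liftQ ((toRed f).restrictScalars ℂ ∘ₗ opNabla f) (by
    intro e he
    obtain ⟨k, hk⟩ := (mem_bTorsion f e).mp he
    refine (Submodule.Quotient.mk_eq_zero (bTorsion f)).mpr ((mem_bTorsion f _).mpr ⟨k, ?_⟩)
    rw [opB_pow_opNabla, hk, map_zero]) ∘ₗ
  (Submodule.Quotient.restrictScalarsEquiv ℂ (bTorsion f)).symm.toLinearMap

theorem redNabla_toRed {m : ℕ} (f : PolyRing (m + 2)) (e : BrieskornModule f) :
    redNabla f (toRed f e) = toRed f (opNabla f e) := rfl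

theorem redB_toRed {m : ℕ} (f : PolyRing (m + 2)) (e : BrieskornModule f) :
    redB f (toRed f e) = toRed f (opB f e) := rfl

theorem redA_toRed {m : ℕ} (f : PolyRing (m + 2)) (e : BrieskornModule f) :
    redA f (toRed f e) = toRed f (opA f e) := rfl

theorem toRed_surjective {m : ℕ} (f : PolyRing (m + 2)) : Function.Surjective (toRed f) :=
  Submodule.mkQ_surjective _

theorem redB_injective {m : ℕ} (f : PolyRing (m + 2)) : Function.Injective (redB f) := by
  rw [injective_iff_map_eq_zero]
  intro z hz
  obtain ⟨e, rfl⟩ := toRed_surjective f z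
  obtain ⟨k, hk⟩ := (mem_bTorsion f _).mp ((Submodule.Quotient.mk_eq_zero _).mp hz)
  refine (Submodule.Quotient.mk_eq_zero _).mpr ((mem_bTorsion f _).mpr ⟨k + 1, ?_⟩)
  rw [pow_succ, Module.End.mul_apply, hk]

/-- The operator `b⁻¹∇` on the image of `b` in `Ẽ_f`. -/
def redConnection {m : ℕ} (f : PolyRing (m + 2)) :
    LinearMap.range (redB f) →ₗ[ℂ] ReducedModule f :=
  redNabla f ∘ₗ
    ((LinearEquiv.ofInjective (redB f) (redB_injective f)).symm.toLinearMap.restrictScalars ℂ)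

/-- The operator is built as $\nabla b^{-1}$, which equals $b^{-1}\nabla$ because $\nabla$ and $b$
commute. In this form it can be computed on $bz$ without inverting $b$. -/
theorem redConnection_redB {m : ℕ} (f : PolyRing (m + 2)) (z : ReducedModule f)
    (h : redB f z ∈ LinearMap.range (redB f)) :
    redConnection f ⟨redB f z, h⟩ = redNabla f z := by
  have : (LinearEquiv.ofInjective (redB f) (redB_injective f)).symm ⟨redB f z, h⟩ = z := by
    rw [LinearEquiv.symm_apply_eq]
    rfl
  change redNabla f ((LinearEquiv.ofInjective (redB f) (redB_injective f)).symm _) = _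
  rw [this]

theorem exists_range_redB_eq {m : ℕ} (f : PolyRing (m + 2)) (y : LinearMap.range (redB f)) :
    ∃ e, y = ⟨redB f (toRed f e), LinearMap.mem_range_self _ _⟩ := by
  obtain ⟨y, hy⟩ := y
  obtain ⟨z, rfl⟩ := LinearMap.mem_range.mp hy
  obtain ⟨e, rfl⟩ := toRed_surjective f z
  exact ⟨e, rfl⟩

theorem exists_redConnection {m : ℕ} (f : PolyRing (m + 2)) :
    ∃ nablaRed : ReducedModule f →ₗ[ℂ] ReducedModule f,
        (∀ e, nablaRed (toRed f e) = toRed f (opNabla f e)) ∧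
        Function.Injective (redB f) ∧
        ∃ Dop : LinearMap.range (redB f) →ₗ[ℂ] ReducedModule f,
          (∀ y, redB f (Dop y) = nablaRed y) ∧
          (∀ y : LinearMap.range (redB f), ∃ h : redA f y ∈ LinearMap.range (redB f),
            Dop ⟨redA f y, h⟩ = redA f (Dop y)) ∧
          (∀ y : LinearMap.range (redB f), ∃ h : redB f y ∈ LinearMap.range (redB f),
            Dop ⟨redB f y, h⟩ = redB f (Dop y)) ∧
          IsLambdaConnection (LinearMap.range (redB f)) Dop := by
  refine ⟨redNabla f, redNabla_toRed f, redB_injective f, redConnection f, ?_, ?_, ?_, ?_⟩ <;>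
    [intro y; intro y; intro y; intro φ y] <;> obtain ⟨e, rfl⟩ := exists_range_redB_eq f y
  · rw [redConnection_redB]
    simp only [redNabla_toRed, redB_toRed, opNabla_opB]
  -- The relation $ab=b(a+b)$ shows that the image of $b$ is stable under $a$; then
  -- $\nabla(a+b)=(a-b)\nabla+b\nabla=a\nabla$ gives the commutation.
  · have h : redA f (redB f (toRed f e)) = redB f (toRed f (opA f e + opB f e)) := by
      simp only [redB_toRed, redA_toRed, opA_opB, map_add]
    refine ⟨h ▸ LinearMap.mem_range_self _ _, ?_⟩
    simp only [h]
    rw [redConnection_redB, redConnection_redB, redNabla_toRed, redNabla_toRed, redA_toRed,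
      map_add, opNabla_opA, opNabla_opB, sub_add_cancel]
  · refine ⟨LinearMap.mem_range_self _ _, ?_⟩
    rw [redConnection_redB]
    simp only
    rw [redConnection_redB, redB_toRed, redNabla_toRed, redNabla_toRed, redB_toRed, opNabla_opB]
  · have h : φ • (⟨redB f (toRed f e), LinearMap.mem_range_self _ _⟩ : LinearMap.range (redB f)) =
        ⟨redB f (φ • toRed f e), LinearMap.mem_range_self _ _⟩ :=
      Subtype.ext (map_smul _ _ _).symm
    rw [h, redConnection_redB, redConnection_redB, ← map_smul, redNabla_toRed, redNabla_toRed,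
      opNabla_smul, map_add, map_smul, map_smul, ← redB_toRed]

/-! ### Stokes' theorem on the unit cube -/

section Stokes

variable {E : Type*} [NormedAddCommGroup E] [NormedSpace ℝ E]

/-- The unit cube in `ℝ^k`. -/
abbrev unitCube (k : ℕ) : Set (Fin k → ℝ) := Set.Icc 0 1

theorem uniqueDiffOn_unitCube (k : ℕ) : UniqueDiffOn ℝ (unitCube k) := by
  rw [unitCube, ← Set.pi_univ_Icc]
  exact UniqueDiffOn.univ_pi fun _ => uniqueDiffOn_Icc zero_lt_one

theorem interior_unitCube (k : ℕ) :
    interior (unitCube k) = Set.univ.pi fun _ => Set.Ioo (0 : ℝ) 1 := by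
  rw [unitCube, ← Set.pi_univ_Icc, interior_pi_set Set.finite_univ]
  simp only [Pi.zero_apply, Pi.one_apply, interior_Icc]

/-- Lets the compatibility of $d$ with pullback be used at boundary points of the cube too, where
derivatives are taken within the cube. -/
theorem unitCube_subset_closure_interior (k : ℕ) :
    unitCube k ⊆ closure (interior (unitCube k)) := by
  rw [interior_unitCube, closure_pi_set, unitCube, ← Set.pi_univ_Icc]
  simp only [Pi.zero_apply, Pi.one_apply, closure_Ioo (zero_ne_one (α := ℝ)), subset_rfl]

theorem insertNth_mem_unitCube {k : ℕ} (i : Fin (k + 1)) {ε : ℝ} (hε : ε ∈ Set.Icc (0 : ℝ) 1)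
    {t : Fin k → ℝ} (ht : t ∈ unitCube k) : i.insertNth ε t ∈ unitCube (k + 1) :=
  Fin.insertNth_mem_Icc.2 ⟨hε, ht⟩

/-- The divergence theorem on the unit cube, for the exterior derivative of a `k`-form. -/
theorem integral_extDerivWithin_unitCube {k : ℕ}
    (θ : (Fin (k + 1) → ℝ) → (Fin (k + 1) → ℝ) [⋀^Fin k]→L[ℝ] ℂ)
    (hc : ∀ v, ContinuousOn (fun t => θ t v) (unitCube (k + 1)))
    (hd : ∀ t ∈ unitCube (k + 1), DifferentiableWithinAt ℝ θ (unitCube (k + 1)) t)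
    (hi : ContinuousOn (fun t => extDerivWithin θ (unitCube (k + 1)) t
      (fun j => Pi.single j 1)) (unitCube (k + 1))) :
    ∫ t in unitCube (k + 1), extDerivWithin θ (unitCube (k + 1)) t (fun j => Pi.single j 1) =
      ∑ i : Fin (k + 1), (-1 : ℤ) ^ (i : ℕ) •
        ((∫ t in unitCube k, θ (i.insertNth 1 t) fun j => Pi.single (i.succAbove j) 1) -
          ∫ t in unitCube k, θ (i.insertNth 0 t) fun j => Pi.single (i.succAbove j) 1) := by
  -- The form $\theta$ corresponds to the vector field whose $i$-th component is
  -- $(-1)^i\theta(e_0,\dots,\hat e_i,\dots,e_k)$; its divergence is $d\theta(e_0,\dots,e_k)$.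
  let F : Fin (k + 1) → (Fin (k + 1) → ℝ) → ℂ := fun i t =>
    (-1 : ℤ) ^ (i : ℕ) • θ t fun j => Pi.single (i.succAbove j) 1
  let F' : Fin (k + 1) → (Fin (k + 1) → ℝ) → (Fin (k + 1) → ℝ) →L[ℝ] ℂ := fun i t =>
    (-1 : ℤ) ^ (i : ℕ) • fderivWithin ℝ (fun t => θ t fun j => Pi.single (i.succAbove j) 1)
      (unitCube (k + 1)) t
  have hF : ∀ t ∈ unitCube (k + 1), ∑ i, F' i t (Pi.single i 1) =
      extDerivWithin θ (unitCube (k + 1)) t (fun j => Pi.single j 1) := by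
    intro t ht
    rw [extDerivWithin_apply (hd t ht) (uniqueDiffOn_unitCube _ t ht)]
    exact Finset.sum_congr rfl fun i _ => by
      simp only [F', smul_apply]
      rfl
  have h := MeasureTheory.integral_divergence_of_hasFDerivAt_off_countable'
    (a := (0 : Fin (k + 1) → ℝ)) (b := 1) zero_le_one F F' ∅ Set.countable_empty
    (fun i => (hc _).const_smul _)
    (fun t ht i => by
      have ht' : t ∈ interior (unitCube (k + 1)) := by
        rw [interior_unitCube]; exact ht.1
      have hn : unitCube (k + 1) ∈ nhds t := mem_interior_iff_mem_nhds.mp ht'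
      have hdt := hd t (interior_subset ht')
      have h1 : DifferentiableWithinAt ℝ (fun t => θ t fun j => Pi.single (i.succAbove j) 1)
          (unitCube (k + 1)) t := by
        exact (hdt.hasFDerivWithinAt.continuousAlternatingMap_apply
          (fun j => hasFDerivWithinAt_const _ _ _)).differentiableWithinAt
      exact (h1.hasFDerivWithinAt.hasFDerivAt hn).const_smul ((-1 : ℤ) ^ (i : ℕ)))
    ((hi.congr hF).integrableOn_compact isCompact_Icc)
  rw [← MeasureTheory.setIntegral_congr_fun measurableSet_Icc hF, h]
  refine Finset.sum_congr rfl fun i _ => ?_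
  rcases neg_one_pow_eq_or ℤ (i : ℕ) with h1 | h1 <;> simp only [F, h1, one_smul, neg_smul]
  · rfl
  · rw [MeasureTheory.integral_neg, MeasureTheory.integral_neg, neg_sub_neg, neg_sub]
    rfl

/-- The integral of a differential `k`-form over a cube in `E`. -/
def formIntegral {k : ℕ} (Θ : E → E [⋀^Fin k]→L[ℝ] ℂ) (c : (Fin k → ℝ) → E) : ℂ :=
  ∫ t in unitCube k, Θ (c t) fun j => fderivWithin ℝ c (unitCube k) t (Pi.single j 1)

theorem formIntegral_congr {k : ℕ} (Θ : E → E [⋀^Fin k]→L[ℝ] ℂ) {c c' : (Fin k → ℝ) → E}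
    (h : Set.EqOn c c' (unitCube k)) : formIntegral Θ c = formIntegral Θ c' := by
  refine MeasureTheory.setIntegral_congr_fun measurableSet_Icc fun t ht => ?_
  simp only [h ht, fderivWithin_congr h (h ht)]

/-- The integral over a cube that does not depend on the `i`-th coordinate vanishes. -/
theorem formIntegral_eq_zero_of_update {k : ℕ} (Θ : E → E [⋀^Fin k]→L[ℝ] ℂ)
    {c : (Fin k → ℝ) → E} (i : Fin k) (h : ∀ t r, c (Function.update t i r) = c t) :
    formIntegral Θ c = 0 := by
  refine MeasureTheory.setIntegral_eq_zero_of_forall_eq_zero fun t ht => ?_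
  refine (Θ (c t)).map_coord_zero i ?_
  -- The $i$-th tangent vector vanishes in both cases: either it is the derivative along a line on
  -- which `c` is constant, or `fderivWithin` takes its default value zero.
  by_cases hd : DifferentiableWithinAt ℝ c (unitCube k) t
  · have hi : ∀ r : ℝ, Function.update t i r - t = (r - t i) • Pi.single i 1 := by
      intro r
      ext j
      by_cases hj : j = i
      · subst hj; simp
      · simp [hj]
    let L : ℝ → Fin k → ℝ := fun r => Function.update t i r
    have hL : HasDerivWithinAt L (Pi.single i 1) (Set.Icc 0 1) (t i) := by
      have h2 : L = fun r => t + (r - t i) • (Pi.single i 1 : Fin k → ℝ) := by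
        funext r
        rw [← hi r, add_sub_cancel]
      rw [h2]
      simpa using (((hasDerivAt_id (t i)).sub_const (t i)).smul_const
        (Pi.single i 1 : Fin k → ℝ)).const_add t |>.hasDerivWithinAt
    have hmaps : Set.MapsTo L (Set.Icc 0 1) (unitCube k) := by
      intro r hr
      rw [unitCube, ← Set.pi_univ_Icc] at ht ⊢
      intro j _
      by_cases hj : j = i
      · subst hj; simpa [L] using hr
      · simpa [L, hj] using ht j trivial
    have hLt : L (t i) = t := Function.update_eq_self i t
    have hcomp := (hLt.symm ▸ hd.hasFDerivWithinAt :
      HasFDerivWithinAt c (fderivWithin ℝ c (unitCube k) t) (unitCube k) (L (t i)))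
      |>.comp_hasDerivWithinAt (t i) hL hmaps
    have hconst : c ∘ L = fun _ => c t := funext fun r => h t r
    rw [hconst] at hcomp
    have hti : t i ∈ Set.Icc (0 : ℝ) 1 := ⟨ht.1 i, ht.2 i⟩
    exact (uniqueDiffOn_Icc zero_lt_one _ hti).eq_deriv _ hcomp (hasDerivWithinAt_const _ _ _)
  · rw [fderivWithin_zero_of_not_differentiableWithinAt hd]
    rfl

/-- Chain rule for the inclusion of a face, which is affine with linear part inserting $0$ in place
$i$. -/
theorem fderivWithin_insertNth {k : ℕ} {c : (Fin (k + 1) → ℝ) → E}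
    (hc : DifferentiableOn ℝ c (unitCube (k + 1))) (i : Fin (k + 1)) {ε : ℝ}
    (hε : ε ∈ Set.Icc (0 : ℝ) 1) {t : Fin k → ℝ} (ht : t ∈ unitCube k) (j : Fin k) :
    fderivWithin ℝ (fun t => c (i.insertNth ε t)) (unitCube k) t (Pi.single j 1) =
      fderivWithin ℝ c (unitCube (k + 1)) (i.insertNth ε t) (Pi.single (i.succAbove j) 1) := by
  let A : (Fin k → ℝ) →L[ℝ] (Fin (k + 1) → ℝ) :=
    ContinuousLinearMap.pi (i.insertNth 0 fun j => ContinuousLinearMap.proj j)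
  have hA : ∀ s, A s = i.insertNth 0 s := by
    intro s
    ext l
    refine i.succAboveCases ?_ (fun l => ?_) l <;> simp [A]
  have hL : HasFDerivWithinAt (fun t : Fin k → ℝ => (i.insertNth ε t : Fin (k + 1) → ℝ)) A
      (unitCube k) t := by
    have h2 : (fun t : Fin k → ℝ => (i.insertNth ε t : Fin (k + 1) → ℝ)) =
        fun t => i.insertNth ε 0 + A t := by
      funext s
      rw [hA]
      ext l
      refine i.succAboveCases ?_ (fun l => ?_) l <;> simp
    rw [h2]
    exact (A.hasFDerivWithinAt).const_add _
  have hd := (hc _ (insertNth_mem_unitCube i hε ht)).hasFDerivWithinAt.comp t hL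
    fun s hs => insertNth_mem_unitCube i hε hs
  have := hd.fderivWithin (uniqueDiffOn_unitCube k t ht)
  change fderivWithin ℝ (c ∘ fun t => i.insertNth ε t) (unitCube k) t (Pi.single j 1) = _
  rw [this, ContinuousLinearMap.comp_apply, hA]
  congr 1
  ext l
  refine i.succAboveCases ?_ (fun l => ?_) l
  · simp
  · simp [Pi.single_apply]

/-- The pullback of a form to the unit cube. -/
def cubePullback {k l : ℕ} (Θ : E → E [⋀^Fin l]→L[ℝ] ℂ) (c : (Fin k → ℝ) → E) (t : Fin k → ℝ) :
    (Fin k → ℝ) [⋀^Fin l]→L[ℝ] ℂ :=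
  (Θ (c t)).compContinuousLinearMap (fderivWithin ℝ c (unitCube k) t)

theorem extDerivWithin_cubePullback {k l : ℕ} {Θ : E → E [⋀^Fin l]→L[ℝ] ℂ}
    {c : (Fin k → ℝ) → E} (hc : ContDiffOn ℝ 2 c (unitCube k)) {t : Fin k → ℝ}
    (ht : t ∈ unitCube k) (hΘ : DifferentiableAt ℝ Θ (c t)) :
    extDerivWithin (cubePullback Θ c) (unitCube k) t =
      (extDeriv Θ (c t)).compContinuousLinearMap (fderivWithin ℝ c (unitCube k) t) := by
  rw [← extDerivWithin_univ]
  exact extDerivWithin_pullback hΘ.differentiableWithinAt (hc t ht) (by simp)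
    (uniqueDiffOn_unitCube k) (unitCube_subset_closure_interior k ht) ht (Set.mapsTo_univ _ _)

theorem continuousOn_form_apply {X : Type*} [TopologicalSpace X] {l : ℕ}
    {Θ : E → E [⋀^Fin l]→L[ℝ] ℂ} {c : X → E} {s : Set X} (hc : ContinuousOn c s)
    (hΘ : ∀ t ∈ s, ContinuousAt Θ (c t)) {v : Fin l → X → E}
    (hv : ∀ j, ContinuousOn (v j) s) :
    ContinuousOn (fun t => Θ (c t) fun j => v j t) s := by
  have h1 : ContinuousOn (fun t => Θ (c t)) s := fun t ht =>
    (hΘ t ht).comp_continuousWithinAt (hc t ht)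
  have h2 : ContinuousOn (fun t j => v j t) s := continuousOn_pi.mpr hv
  exact h1.eval h2

theorem continuousAt_extDeriv {k : ℕ} {Θ : E → E [⋀^Fin k]→L[ℝ] ℂ} {y : E} (hΘ : ContDiffAt ℝ 1 Θ y) :
    ContinuousAt (extDeriv Θ) y :=
  (ContinuousAlternatingMap.alternatizeUncurryFinCLM ℝ E ℂ).continuous.continuousAt.comp
    ((hΘ.fderiv_right (m := 0) (by norm_num)).continuousAt)

/-- **Stokes' theorem** for a smooth cube. -/
theorem formIntegral_extDeriv {k : ℕ} {Θ : E → E [⋀^Fin k]→L[ℝ] ℂ} {c : (Fin (k + 1) → ℝ) → E}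
    (hc : ContDiffOn ℝ 2 c (unitCube (k + 1)))
    (hΘ : ∀ t ∈ unitCube (k + 1), ContDiffAt ℝ 1 Θ (c t)) :
    formIntegral (extDeriv Θ) c = ∑ i : Fin (k + 1), (-1 : ℤ) ^ (i : ℕ) •
      (formIntegral Θ (fun t => c (i.insertNth 1 t)) -
        formIntegral Θ (fun t => c (i.insertNth 0 t))) := by
  have hu := uniqueDiffOn_unitCube (k + 1)
  have hdiff : ∀ t ∈ unitCube (k + 1), DifferentiableAt ℝ Θ (c t) := fun t ht =>
    (hΘ t ht).differentiableAt one_ne_zero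
  have hD : ∀ v, ContinuousOn (fun t => fderivWithin ℝ c (unitCube (k + 1)) t v)
      (unitCube (k + 1)) := fun v =>
    (hc.continuousOn_fderivWithin hu (by norm_num)).clm_apply continuousOn_const
  have hext : ∀ t ∈ unitCube (k + 1),
      extDerivWithin (cubePullback Θ c) (unitCube (k + 1)) t (fun j => Pi.single j 1) =
      extDeriv Θ (c t) fun j => fderivWithin ℝ c (unitCube (k + 1)) t (Pi.single j 1) := by
    intro t ht
    rw [extDerivWithin_cubePullback hc ht (hdiff t ht)]
    rfl
  have hcont' : ContinuousOn (fun t => extDeriv Θ (c t) fun j =>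
      fderivWithin ℝ c (unitCube (k + 1)) t (Pi.single j 1)) (unitCube (k + 1)) :=
    continuousOn_form_apply hc.continuousOn
      (fun t ht => continuousAt_extDeriv (hΘ t ht)) fun j => hD _
  rw [formIntegral, ← MeasureTheory.setIntegral_congr_fun measurableSet_Icc hext,
    integral_extDerivWithin_unitCube]
  · refine Finset.sum_congr rfl fun i _ => ?_
    -- The coordinate tangent vectors of a face are those of the whole cube with the $i$-th one left
    -- out, so the boundary terms of the divergence theorem are integrals over the faces.
    have hface : ∀ ε ∈ Set.Icc (0 : ℝ) 1,
        ∫ t in unitCube k, cubePullback Θ c (i.insertNth ε t)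
          (fun j => Pi.single (i.succAbove j) 1) =
        formIntegral Θ (fun t => c (i.insertNth ε t)) := by
      intro ε hε
      refine MeasureTheory.setIntegral_congr_fun measurableSet_Icc fun t ht => ?_
      simp only [fderivWithin_insertNth (hc.differentiableOn two_ne_zero) i hε ht]
      rfl
    rw [hface 1 (by simp), hface 0 (by simp)]
  · exact fun v => continuousOn_form_apply hc.continuousOn
      (fun t ht => (hdiff t ht).continuousAt) fun j => hD _
  · intro t ht
    have h1 : DifferentiableWithinAt ℝ (fun t => Θ (c t)) (unitCube (k + 1)) t :=
      (hdiff t ht).comp_differentiableWithinAt t (hc.differentiableOn two_ne_zero t ht)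
    have h2 : DifferentiableWithinAt ℝ (fderivWithin ℝ c (unitCube (k + 1)))
        (unitCube (k + 1)) t :=
      ((hc t ht).fderivWithin_right hu (m := 1) (by norm_num) ht).differentiableWithinAt
        one_ne_zero
    exact h1.continuousAlternatingMapCompContinuousLinearMap h2
  · exact hcont'.congr hext

end Stokes

/-! ### Cubical chains, chain maps and prisms -/

section Chains

variable {X Y : Type}

/-- The chain map induced by a map `F : X → Y`. -/
def pushChain (k : ℕ) (F : X → Y) : CubChain k X →ₗ[ℂ] CubChain k Y :=
  Finsupp.lmapDomain ℂ ℂ fun σ t => F (σ t)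

theorem pushChain_single {k : ℕ} (F : X → Y) (σ : (Fin k → unitInterval) → X) (a : ℂ) :
    pushChain k F (Finsupp.single σ a) = Finsupp.single (fun t => F (σ t)) a :=
  Finsupp.mapDomain_single

theorem pushChain_apply {k : ℕ} (F : X → Y) (c : CubChain k X) :
    pushChain k F c = c.mapDomain fun σ t => F (σ t) := rfl

theorem boundary_single {k : ℕ} (σ : (Fin (k + 1) → unitInterval) → X) :
    boundary k X (Finsupp.single σ 1) = ∑ i : Fin (k + 1),
      (-1 : ℤ) ^ (i : ℕ) • (Finsupp.single (face i 1 σ) (1 : ℂ) - Finsupp.single (face i 0 σ) 1) := by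
  rw [boundary, Finsupp.linearCombination_single, one_smul]

theorem boundary_pushChain {k : ℕ} (F : X → Y) (c : CubChain (k + 1) X) :
    boundary k Y (pushChain (k + 1) F c) = pushChain k F (boundary k X c) := by
  suffices h : boundary k Y ∘ₗ pushChain (k + 1) F = pushChain k F ∘ₗ boundary k X from
    LinearMap.congr_fun h c
  refine Finsupp.lhom_ext' fun σ => LinearMap.ext_ring ?_
  simp only [LinearMap.comp_apply, Finsupp.lsingle_apply, boundary_single, pushChain_single,
    map_sum, map_zsmul, map_sub]
  rfl

theorem pushChain_degenerate {k : ℕ} (F : X → Y) {c : CubChain k X} (hc : c ∈ degenerate k X) :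
    pushChain k F c ∈ degenerate k Y := by
  have h : degenerate k X ≤ (degenerate k Y).comap (pushChain k F) := by
    refine Submodule.span_le.mpr ?_
    rintro _ ⟨σ, ⟨i, hi⟩, rfl⟩
    rw [SetLike.mem_coe, Submodule.mem_comap, pushChain_single]
    exact Submodule.subset_span ⟨_, ⟨i, fun t r => by rw [hi]⟩, rfl⟩
  exact h hc

/-- The prism operator of a homotopy `H`. -/
def prism (k : ℕ) (H : unitInterval → X → Y) : CubChain k X →ₗ[ℂ] CubChain (k + 1) Y :=
  Finsupp.lmapDomain ℂ ℂ fun τ t => H (t 0) (τ (Fin.tail t))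

theorem prism_single {k : ℕ} (H : unitInterval → X → Y) (τ : (Fin k → unitInterval) → X) (a : ℂ) :
    prism k H (Finsupp.single τ a) = Finsupp.single (fun t => H (t 0) (τ (Fin.tail t))) a :=
  Finsupp.mapDomain_single

/-- A cube independent of $t_i$ has a prism independent of $t_{i+1}$. Hence the lateral part of the
boundary of a prism over a cycle is degenerate. -/
theorem prism_degenerate {k : ℕ} (H : unitInterval → X → Y) {c : CubChain k X}
    (hc : c ∈ degenerate k X) : prism k H c ∈ degenerate (k + 1) Y := by
  have h : degenerate k X ≤ (degenerate (k + 1) Y).comap (prism k H) := by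
    refine Submodule.span_le.mpr ?_
    rintro _ ⟨σ, ⟨i, hi⟩, rfl⟩
    rw [SetLike.mem_coe, Submodule.mem_comap, prism_single]
    refine Submodule.subset_span ⟨_, ⟨i.succ, fun t r => ?_⟩, rfl⟩
    rw [Fin.tail_update_succ, hi, Function.update_of_ne (Fin.succ_ne_zero i).symm]
  exact h hc

theorem face_zero_prism {k : ℕ} (H : unitInterval → X → Y) (τ : (Fin k → unitInterval) → X)
    (ε : unitInterval) :
    face 0 ε (fun t => H (t 0) (τ (Fin.tail t))) = fun t => H ε (τ t) := by
  funext t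
  simp [face]

theorem face_succ_prism {k : ℕ} (H : unitInterval → X → Y)
    (τ : (Fin (k + 1) → unitInterval) → X) (i : Fin (k + 1)) (ε : unitInterval) :
    face i.succ ε (fun t => H (t 0) (τ (Fin.tail t))) =
      fun t => H (t 0) (face i ε τ (Fin.tail t)) := by
  funext t
  have h1 : (i.succ.insertNth ε t : Fin (k + 2) → unitInterval) 0 = t 0 := by
    have := Fin.insertNth_apply_succAbove (α := fun _ => unitInterval) i.succ ε t 0
    rwa [Fin.succ_succAbove_zero] at this
  have h2 : Fin.tail (i.succ.insertNth ε t : Fin (k + 2) → unitInterval) =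
      i.insertNth ε (Fin.tail t) := by
    symm
    rw [Fin.insertNth_eq_iff]
    refine ⟨by simp [Fin.tail], ?_⟩
    funext j
    have := Fin.insertNth_apply_succAbove (α := fun _ => unitInterval) i.succ ε t j.succ
    rw [Fin.succ_succAbove_succ] at this
    simp [Fin.tail, Fin.removeNth, this]
  simp only [face, h1, h2]

/-- The faces $t_0=1$ and $t_0=0$ are the two ends. The other faces are prisms over faces, and the
shift of index by one reverses their sign. No topology on `X` is involved, so `X` may be the space
of functions on the parameter set of a family. -/
theorem boundary_prism {k : ℕ} (H : unitInterval → X → Y) (c : CubChain (k + 1) X) :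
    boundary (k + 1) Y (prism (k + 1) H c) =
      pushChain (k + 1) (H 1) c - pushChain (k + 1) (H 0) c - prism k H (boundary k X c) := by
  suffices h : boundary (k + 1) Y ∘ₗ prism (k + 1) H =
      pushChain (k + 1) (H 1) - pushChain (k + 1) (H 0) - prism k H ∘ₗ boundary k X from
    LinearMap.congr_fun h c
  refine Finsupp.lhom_ext' fun σ => LinearMap.ext_ring ?_
  simp only [LinearMap.comp_apply, Finsupp.lsingle_apply, LinearMap.sub_apply, boundary_single,
    pushChain_single, prism_single, map_sum, map_zsmul, map_sub]
  rw [Fin.sum_univ_succ, sub_eq_add_neg _ (∑ i, _), ← Finset.sum_neg_distrib]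
  simp only [face_zero_prism, face_succ_prism, Fin.val_zero, pow_zero, one_smul, Fin.val_succ,
    pow_succ, mul_neg_one, neg_smul]

end Chains

/-! ### Integration of forms over chains -/

section ChainIntegral

variable {E : Type} [NormedAddCommGroup E] [NormedSpace ℝ E]

theorem cubeExt_face {k : ℕ} {X : Type} (σ : (Fin (k + 1) → unitInterval) → X) (i : Fin (k + 1))
    (ε : unitInterval) :
    cubeExt (face i ε σ) = fun t => cubeExt σ (i.insertNth (ε : ℝ) t) := by
  funext t
  simp only [cubeExt, face]
  congr 1
  funext j
  refine i.succAboveCases ?_ (fun l => ?_) j <;> simp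

/-- The integral of a differential form over a cubical chain. -/
def chainIntegral {k : ℕ} (Θ : E → E [⋀^Fin k]→L[ℝ] ℂ) : CubChain k E →ₗ[ℂ] ℂ :=
  Finsupp.linearCombination ℂ fun σ => formIntegral Θ (cubeExt σ)

theorem chainIntegral_single {k : ℕ} (Θ : E → E [⋀^Fin k]→L[ℝ] ℂ)
    (σ : (Fin k → unitInterval) → E) :
    chainIntegral Θ (Finsupp.single σ 1) = formIntegral Θ (cubeExt σ) := by
  rw [chainIntegral, Finsupp.linearCombination_single, one_smul]

theorem chainIntegral_degenerate {k : ℕ} (Θ : E → E [⋀^Fin k]→L[ℝ] ℂ) {c : CubChain k E}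
    (hc : c ∈ degenerate k E) : chainIntegral Θ c = 0 := by
  have h : degenerate k E ≤ LinearMap.ker (chainIntegral Θ) := by
    refine Submodule.span_le.mpr ?_
    rintro _ ⟨σ, ⟨i, hi⟩, rfl⟩
    rw [SetLike.mem_coe, LinearMap.mem_ker, chainIntegral_single]
    refine formIntegral_eq_zero_of_update Θ i fun t r => ?_
    simp only [cubeExt]
    rw [← hi (fun j => Set.projIcc 0 1 zero_le_one (t j)) (Set.projIcc 0 1 zero_le_one r)]
    congr 1
    funext j
    by_cases hj : j = i
    · subst hj; simp
    · simp [hj]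
  exact h hc

/-- **Stokes' theorem** for chains of smooth cubes. -/
theorem chainIntegral_boundary {k : ℕ} (Θ : E → E [⋀^Fin k]→L[ℝ] ℂ) (e : CubChain (k + 1) E)
    (hc : ∀ σ ∈ e.support, ContDiffOn ℝ 2 (cubeExt σ) (unitCube (k + 1)))
    (hΘ : ∀ σ ∈ e.support, ∀ t, ContDiffAt ℝ 1 Θ (σ t)) :
    chainIntegral Θ (boundary k E e) = chainIntegral (extDeriv Θ) e := by
  rw [boundary, Finsupp.linearCombination_apply, Finsupp.sum, map_sum, chainIntegral,
    chainIntegral, Finsupp.linearCombination_apply, Finsupp.sum]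
  refine Finset.sum_congr rfl fun σ hσ => ?_
  rw [map_smul, formIntegral_extDeriv (hc σ hσ) fun t _ => hΘ σ hσ _, map_sum]
  congr 1
  refine Finset.sum_congr rfl fun i _ => ?_
  rw [map_zsmul, map_sub]
  simp only [Finsupp.linearCombination_single, one_smul, cubeExt_face]
  rfl

end ChainIntegral

/-! ### Relative forms as real differential forms on $\mathbb{C}^N\times\mathbb{C}$ -/

section PolynomialForms

variable {N : ℕ}

theorem evalAt_C (x : Fin N → ℂ) (l : ℂ) (φ : ℂ[X]) :
    evalAt x l (MvPolynomial.C φ) = φ.eval l := by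
  simp [evalAt]

theorem evalAt_X (x : Fin N → ℂ) (l : ℂ) (i : Fin N) :
    evalAt x l (MvPolynomial.X i) = x i := by
  simp [evalAt]

theorem contDiff_evalAt {n : WithTop ℕ∞} (g : PolyRing N) :
    ContDiff ℝ n fun y : (Fin N → ℂ) × ℂ => evalAt y.1 y.2 g := by
  induction g using MvPolynomial.induction_on with
  | C φ =>
    simp only [evalAt_C]
    have h : ContDiff ℝ n fun l : ℂ => φ.eval l := φ.differentiable.contDiff.restrict_scalars ℝ
    exact h.comp contDiff_snd
  | add p q hp hq => simpa only [map_add] using hp.add hq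
  | mul_X p i hp =>
    simp only [map_mul, evalAt_X]
    exact hp.mul ((contDiff_apply ℝ ℂ i).comp contDiff_fst)

theorem differentiable_evalAt (g : PolyRing N) :
    Differentiable ℝ fun y : (Fin N → ℂ) × ℂ => evalAt y.1 y.2 g :=
  (contDiff_evalAt (n := 1) g).differentiable one_ne_zero

/-- The total differential $dg=d_/g+(\partial g/\partial\lambda)\,d\lambda$. It is taken over
$\mathbb{R}$ because cubes, families and the conjugate gradient are only real smooth. -/
theorem fderiv_evalAt (g : PolyRing N) (y v : (Fin N → ℂ) × ℂ) :
    fderiv ℝ (fun y : (Fin N → ℂ) × ℂ => evalAt y.1 y.2 g) y v =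
      dfAt g y.1 y.2 v.1 + v.2 * evalAt y.1 y.2 (lamDeriv N g) := by
  rw [dfAt_apply]
  induction g using MvPolynomial.induction_on with
  | C φ =>
    simp only [evalAt_C]
    have h := ((φ.hasDerivAt y.2).hasFDerivAt.restrictScalars ℝ).comp y
      (hasFDerivAt_snd (𝕜 := ℝ) (p := y))
    have h' : fderiv ℝ (fun y : (Fin N → ℂ) × ℂ => φ.eval y.2) y = _ := h.fderiv
    rw [h', ← MvPolynomial.monomial_zero', lamDeriv_monomial, MvPolynomial.monomial_zero', evalAt_C]
    simp
  | add p q hp hq =>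
    have h : (fun y : (Fin N → ℂ) × ℂ => evalAt y.1 y.2 (p + q)) =
        (fun y => evalAt y.1 y.2 p) + fun y => evalAt y.1 y.2 q := by
      funext y; simp
    rw [h, fderiv_add (differentiable_evalAt p y) (differentiable_evalAt q y)]
    simp only [add_apply, hp, hq, map_add, mul_add, Finset.sum_add_distrib]
    ring
  | mul_X p i hp =>
    have h : (fun y : (Fin N → ℂ) × ℂ => evalAt y.1 y.2 (p * MvPolynomial.X i)) =
        (fun y => evalAt y.1 y.2 p) * fun y => y.1 i := by
      funext y; simp [evalAt_X]
    have hX : HasFDerivAt (fun y : (Fin N → ℂ) × ℂ => y.1 i)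
        ((ContinuousLinearMap.proj i).comp (ContinuousLinearMap.fst ℝ (Fin N → ℂ) ℂ)) y :=
      ((ContinuousLinearMap.proj (R := ℝ) (φ := fun _ : Fin N => ℂ) i).comp
        (ContinuousLinearMap.fst ℝ (Fin N → ℂ) ℂ)).hasFDerivAt
    have hlam : lamDeriv N (MvPolynomial.X i : PolyRing N) = 0 := by
      rw [MvPolynomial.X, lamDeriv_monomial, Polynomial.derivative_one, MvPolynomial.monomial_zero]
    rw [h, ((differentiable_evalAt p y).hasFDerivAt.mul hX).fderiv]
    have hsum : ∑ j, v.1 j * evalAt y.1 y.2 (MvPolynomial.pderiv j (p * MvPolynomial.X i)) =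
        evalAt y.1 y.2 p * v.1 i +
          (∑ j, v.1 j * evalAt y.1 y.2 (MvPolynomial.pderiv j p)) * y.1 i := by
      simp only [Derivation.leibniz, smul_eq_mul, map_add, map_mul, evalAt_X, mul_add,
        Finset.sum_add_distrib, Finset.sum_mul]
      congr 1
      · rw [Finset.sum_eq_single i]
        · simp; ring
        · intro j _ hj
          rw [MvPolynomial.pderiv_X_of_ne hj.symm]; simp
        · simp
      · exact Finset.sum_congr rfl fun j _ => by ring
    rw [hsum]
    simp only [add_apply, smul_apply, hp, lamDeriv_mul, hlam, map_mul, evalAt_X, mul_zero, add_zero, ContinuousLinearMap.comp_apply,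
      ContinuousLinearMap.proj_apply, ContinuousLinearMap.coe_fst', smul_eq_mul]
    ring

theorem alternating_expand {k : ℕ} (a : (Fin N → ℂ) [⋀^Fin k]→ₗ[ℂ] ℂ) (v : Fin k → Fin N → ℂ) :
    a v = ∑ I : Fin k → Fin N, (∏ j, v j (I j)) * a fun j => Pi.single (I j) 1 := by
  have h : v = fun j => ∑ i, v j i • (Pi.single i 1 : Fin N → ℂ) := by
    funext j
    exact pi_eq_sum_univ' (v j)
  conv_lhs => rw [h]
  change a.toMultilinearMap _ = _
  rw [MultilinearMap.map_sum]
  refine Finset.sum_congr rfl fun I _ => ?_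
  rw [MultilinearMap.map_smul_univ]
  rfl

/-- Pullback of alternating forms on `ℂ^N` to real forms on `ℂ^N × ℂ`. -/
def prodForm (N k : ℕ) : ((Fin N → ℂ) [⋀^Fin k]→ₗ[ℂ] ℂ) →ₗ[ℝ]
    ((Fin N → ℂ) × ℂ) [⋀^Fin k]→L[ℝ] ℂ where
  toFun a :=
    { toMultilinearMap := (a.toMultilinearMap.restrictScalars ℝ).compLinearMap
        fun _ => LinearMap.fst ℝ (Fin N → ℂ) ℂ
      map_eq_zero_of_eq' := fun v i j h hij =>
        a.map_eq_zero_of_eq (fun j => (v j).1) (congrArg Prod.fst h) hij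
      cont := by
        change Continuous fun v : Fin k → (Fin N → ℂ) × ℂ => a fun j => (v j).1
        rw [funext fun v : Fin k → (Fin N → ℂ) × ℂ => alternating_expand a fun j => (v j).1]
        fun_prop }
  map_add' _ _ := rfl
  map_smul' _ _ := rfl

/-- A family of forms is smooth when its values on all vectors are. -/
theorem contDiffAt_prodForm {k : ℕ} {n : WithTop ℕ∞} {E : Type*} [NormedAddCommGroup E]
    [NormedSpace ℝ E] {a : E → (Fin N → ℂ) [⋀^Fin k]→ₗ[ℂ] ℂ} {y : E}
    (h : ∀ v, ContDiffAt ℝ n (fun y => a y v) y) :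
    ContDiffAt ℝ n (fun y => prodForm N k (a y)) y := by
  let ev : ((Fin N → ℂ) [⋀^Fin k]→ₗ[ℂ] ℂ) →ₗ[ℝ] ((Fin k → Fin N) → ℂ) :=
    { toFun := fun a I => a fun j => Pi.single (I j) 1
      map_add' := fun _ _ => rfl
      map_smul' := fun _ _ => rfl }
  have hev : LinearMap.ker ev = ⊥ := by
    refine LinearMap.ker_eq_bot'.mpr fun a ha => ?_
    ext1 v
    rw [alternating_expand]
    exact Finset.sum_eq_zero fun I _ => by
      rw [show (a fun j => Pi.single (I j) 1) = 0 from congrFun ha I, mul_zero]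
  -- A form is determined by its values on tuples of basis vectors. A left inverse of this
  -- evaluation factors `prodForm` through a finite-dimensional coordinate space, on which every
  -- linear map is continuous and hence smooth.
  obtain ⟨ρ, hρ⟩ := ev.exists_leftInverse_of_injective hev
  let L : ((Fin k → Fin N) → ℂ) →L[ℝ] ((Fin N → ℂ) × ℂ) [⋀^Fin k]→L[ℝ] ℂ :=
    LinearMap.toContinuousLinearMap (prodForm N k ∘ₗ ρ)
  have hL : (fun y => prodForm N k (a y)) = fun y => L (ev (a y)) := by
    funext y
    change _ = prodForm N k (ρ (ev (a y)))
    rw [show ρ (ev (a y)) = a y from LinearMap.congr_fun hρ (a y)]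
  rw [hL]
  exact L.contDiff.contDiffAt.comp y (contDiffAt_pi.mpr fun I => h _)

/-- The real differential form on `ℂ^N × ℂ` given by a relative form. -/
def polyForm {k : ℕ} (η : RelForm N k) (y : (Fin N → ℂ) × ℂ) :
    ((Fin N → ℂ) × ℂ) [⋀^Fin k]→L[ℝ] ℂ :=
  prodForm N k (formAt η y.1 y.2)

theorem formAt_apply {k : ℕ} (η : RelForm N k) (x : Fin N → ℂ) (l : ℂ) (v : Fin k → Fin N → ℂ) :
    formAt η x l v = evalAt x l (η v) := rfl

theorem contDiff_polyForm {k : ℕ} {n : WithTop ℕ∞} (η : RelForm N k) :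
    ContDiff ℝ n (polyForm η) :=
  contDiff_iff_contDiffAt.mpr fun _ =>
    contDiffAt_prodForm fun v => (contDiff_evalAt (η v)).contDiffAt

theorem evalAt_zsmul (x : Fin N → ℂ) (l : ℂ) (n : ℤ) (g : PolyRing N) :
    evalAt x l (n • g) = n • evalAt x l g := map_zsmul (evalAt x l) n g

theorem formAt_dRel {k : ℕ} (η : RelForm N k) (x : Fin N → ℂ) (l : ℂ)
    (v : Fin (k + 1) → Fin N → ℂ) :
    formAt (dRel N k η) x l v =
      ∑ i : Fin (k + 1), (-1 : ℤ) ^ (i : ℕ) • dfAt (η (i.removeNth v)) x l (v i) := by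
  rw [formAt_apply, dRel_apply, map_sum]
  exact Finset.sum_congr rfl fun i _ => evalAt_zsmul _ _ _ _

theorem formAt_dfWedge {k : ℕ} (f : PolyRing N) (η : RelForm N k) (x : Fin N → ℂ) (l : ℂ)
    (v : Fin (k + 1) → Fin N → ℂ) :
    formAt (dfWedge f k η) x l v =
      ∑ i : Fin (k + 1), (-1 : ℤ) ^ (i : ℕ) • (dfAt f x l (v i) * formAt η x l (i.removeNth v)) := by
  rw [formAt_apply, dfWedge_apply, map_sum]
  exact Finset.sum_congr rfl fun i _ => by
    rw [evalAt_zsmul, map_mul]; rfl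

/-- This is $d\eta=d_/\eta+d\lambda\wedge\partial\eta/\partial\lambda$. The two terms are the source
of the two terms of $\nabla$. -/
theorem extDeriv_polyForm {k : ℕ} (η : RelForm N k) (y : (Fin N → ℂ) × ℂ)
    (v : Fin (k + 1) → (Fin N → ℂ) × ℂ) :
    extDeriv (polyForm η) y v = formAt (dRel N k η) y.1 y.2 (fun j => (v j).1) +
      ∑ i : Fin (k + 1), (-1 : ℤ) ^ (i : ℕ) • ((v i).2 *
        formAt (lamDerivForm N k η) y.1 y.2 (i.removeNth fun j => (v j).1)) := by
  rw [extDeriv_apply ((contDiff_polyForm (n := 1) η).differentiable one_ne_zero y), formAt_dRel,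
    ← Finset.sum_add_distrib]
  refine Finset.sum_congr rfl fun i _ => ?_
  rw [← smul_add]
  congr 1
  exact fderiv_evalAt (η (i.removeNth fun j => (v j).1)) y (v i)

theorem contDiff_conjGrad {n : WithTop ℕ∞} (f : PolyRing N) :
    ContDiff ℝ n fun y : (Fin N → ℂ) × ℂ => conjGrad f y.1 y.2 :=
  contDiff_pi.mpr fun _ => Complex.conjCLE.contDiff.comp (contDiff_evalAt _)

/-- Forms of top degree vanish on vectors tangent to the fibre. -/
theorem formAt_eq_zero_of_tangent (f : PolyRing N) (θ : RelForm N N) (x : Fin N → ℂ)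
    (l : ℂ) (hx : dfAt f x l ≠ 0) (v : Fin N → Fin N → ℂ) (hv : ∀ j, dfAt f x l (v j) = 0) :
    formAt θ x l v = 0 := by
  refine AlternatingMap.map_linearDependent _ _ fun hli => hx ?_
  have hspan := hli.span_eq_top_of_card_eq_finrank' (by simp)
  refine LinearMap.ext_on hspan ?_
  rintro _ ⟨j, rfl⟩
  exact hv j

end PolynomialForms

/-! ### The Gelfand–Leray form and its closedness on fibres -/

section GelfandLeray

variable {m : ℕ}

/-- The Gelfand–Leray form as a real differential form on `ℂ^N × ℂ`. -/
def leray (f : PolyRing (m + 2)) (ω : RelForm (m + 2) (m + 2)) (y : (Fin (m + 2) → ℂ) × ℂ) :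
    ((Fin (m + 2) → ℂ) × ℂ) [⋀^Fin (m + 1)]→L[ℝ] ℂ :=
  prodForm (m + 2) (m + 1) ((dfAt f y.1 y.2 (conjGrad f y.1 y.2))⁻¹ •
    (formAt ω y.1 y.2).curryLeft (conjGrad f y.1 y.2))

theorem leray_apply (f : PolyRing (m + 2)) (ω : RelForm (m + 2) (m + 2))
    (y : (Fin (m + 2) → ℂ) × ℂ) (v : Fin (m + 1) → (Fin (m + 2) → ℂ) × ℂ) :
    leray f ω y v = gelfandLeray f ω y.1 y.2 fun j => (v j).1 := by
  rw [gelfandLeray, div_eq_inv_mul]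
  rfl

theorem contDiffAt_leray {n : WithTop ℕ∞} (f : PolyRing (m + 2)) (ω : RelForm (m + 2) (m + 2))
    {y : (Fin (m + 2) → ℂ) × ℂ} (hy : dfAt f y.1 y.2 ≠ 0) : ContDiffAt ℝ n (leray f ω) y := by
  have hg := contDiff_conjGrad (n := n) f
  refine contDiffAt_prodForm fun v => ?_
  have h1 : ContDiffAt ℝ n (fun y : (Fin (m + 2) → ℂ) × ℂ =>
      dfAt f y.1 y.2 (conjGrad f y.1 y.2)) y := by
    simp only [dfAt_apply]
    exact (ContDiff.sum fun i _ => (contDiff_pi.mp hg i).mul (contDiff_evalAt _)).contDiffAt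
  have h2 : ContDiffAt ℝ n (fun y : (Fin (m + 2) → ℂ) × ℂ =>
      formAt ω y.1 y.2 (Fin.cons (conjGrad f y.1 y.2) v)) y := by
    rw [funext fun y : (Fin (m + 2) → ℂ) × ℂ => alternating_expand (formAt ω y.1 y.2) _]
    refine (ContDiff.sum fun I _ => (contDiff_prod fun j _ => ?_).mul
      (contDiff_evalAt (ω fun j => Pi.single (I j) 1))).contDiffAt
    refine Fin.cases ?_ (fun j => ?_) j
    · simpa using contDiff_pi.mp hg (I 0)
    · simpa using contDiff_const
  exact (h1.inv (dfAt_conjGrad_ne_zero hy)).mul h2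

/-- Differentiation of `f` along a differentiable map. -/
theorem dfAt_fderivWithin {N : ℕ} {E : Type*} [NormedAddCommGroup E] [NormedSpace ℝ E]
    (f : PolyRing N) {s : Set E} {c : E → (Fin N → ℂ) × ℂ} {h : E → ℂ}
    (hch : Set.EqOn (fun t => evalAt (c t).1 (c t).2 f) h s) {t : E}
    (ht : t ∈ s) (hs : UniqueDiffWithinAt ℝ s t) (hc : DifferentiableWithinAt ℝ c s t) (v : E) :
    dfAt f (c t).1 (c t).2 (fderivWithin ℝ c s t v).1 +
      (fderivWithin ℝ c s t v).2 * evalAt (c t).1 (c t).2 (lamDeriv N f) =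
      fderivWithin ℝ h s t v := by
  have h1 := (differentiable_evalAt f (c t)).hasFDerivAt.comp_hasFDerivWithinAt t
    hc.hasFDerivWithinAt
  rw [← fderivWithin_congr hch (hch ht), ← fderiv_evalAt]
  change _ = fderivWithin ℝ ((fun y : (Fin N → ℂ) × ℂ => evalAt y.1 y.2 f) ∘ c) s t v
  rw [h1.fderivWithin hs]
  rfl

/-- A cube in `ℂ^N × ℂ` lies in the fibre over `p`. -/
def CubeInFiber {N k : ℕ} (f : PolyRing N) (p : ℂ × ℂ) (c : (Fin k → ℝ) → (Fin N → ℂ) × ℂ) :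
    Prop :=
  ∀ t ∈ unitCube k, (c t).2 = p.2 ∧ (c t).1 ∈ fiber f p

/-- Along such a cube both $\lambda$ and $f$ are constant; differentiating these two identities
gives the two equations. -/
theorem CubeInFiber.tangent {N k : ℕ} {f : PolyRing N} {p : ℂ × ℂ}
    {c : (Fin k → ℝ) → (Fin N → ℂ) × ℂ} (hf : CubeInFiber f p c) {t : Fin k → ℝ}
    (ht : t ∈ unitCube k) (hc : DifferentiableWithinAt ℝ c (unitCube k) t) (v : Fin k → ℝ) :
    (fderivWithin ℝ c (unitCube k) t v).2 = 0 ∧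
      dfAt f (c t).1 (c t).2 (fderivWithin ℝ c (unitCube k) t v).1 = 0 := by
  have hu := uniqueDiffOn_unitCube k t ht
  have h2 : (fderivWithin ℝ c (unitCube k) t v).2 = 0 := by
    have h3 : HasFDerivWithinAt (fun t => (c t).2)
        ((ContinuousLinearMap.snd ℝ (Fin N → ℂ) ℂ).comp (fderivWithin ℝ c (unitCube k) t))
        (unitCube k) t := hasFDerivAt_snd.comp_hasFDerivWithinAt t hc.hasFDerivWithinAt
    have h4 : fderivWithin ℝ (fun t => (c t).2) (unitCube k) t = 0 := by
      rw [fderivWithin_congr (f := fun _ => p.2) (fun s hs => (hf s hs).1) (hf t ht).1]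
      exact fderivWithin_const_apply _
    have := congrArg (fun L => L v) (h3.fderivWithin hu)
    rw [h4] at this
    exact this.symm
  refine ⟨h2, ?_⟩
  have h5 := dfAt_fderivWithin f (h := fun _ => p.1) (c := c) (fun s hs => by
    obtain ⟨h6, h7⟩ := hf s hs
    simp only [h6]
    exact h7) ht hu hc v
  rw [h2, zero_mul, add_zero] at h5
  rw [h5, fderivWithin_const_apply]
  rfl

/-- The Gelfand–Leray form with a constant transversal vector `w` has closed pullbacks to the
fibres. -/
theorem extDeriv_inv_smul_polyForm (f : PolyRing (m + 2)) (ω : RelForm (m + 2) (m + 2))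
    (w : Fin (m + 2) → ℂ) {y : (Fin (m + 2) → ℂ) × ℂ} (hw : dfAt f y.1 y.2 w ≠ 0)
    (v : Fin (m + 2) → (Fin (m + 2) → ℂ) × ℂ) (hv : ∀ j, (v j).2 = 0)
    (hv' : ∀ j, dfAt f y.1 y.2 (v j).1 = 0) :
    DifferentiableAt ℝ (fun y : (Fin (m + 2) → ℂ) × ℂ =>
        (dfAt f y.1 y.2 w)⁻¹ • polyForm (ω.curryLeft w) y) y ∧
      extDeriv (fun y : (Fin (m + 2) → ℂ) × ℂ =>
        (dfAt f y.1 y.2 w)⁻¹ • polyForm (ω.curryLeft w) y) y v = 0 := by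
  set q : PolyRing (m + 2) := dirDeriv (m + 2) w f
  have hq : ∀ y : (Fin (m + 2) → ℂ) × ℂ, dfAt f y.1 y.2 w = evalAt y.1 y.2 q := fun _ => rfl
  simp only [hq] at hw ⊢
  set ζ : RelForm (m + 2) (m + 1) := ω.curryLeft w
  have hdq : DifferentiableAt ℝ (fun y : (Fin (m + 2) → ℂ) × ℂ => (evalAt y.1 y.2 q)⁻¹) y :=
    (differentiable_evalAt q y).inv hw
  have hdζ : DifferentiableAt ℝ (polyForm ζ) y :=
    (contDiff_polyForm (n := 1) ζ).differentiable one_ne_zero y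
  have hd := hdq.fun_smul hdζ
  refine ⟨hd, ?_⟩
  have hx : dfAt f y.1 y.2 ≠ 0 := fun h0 => hw (by
    rw [← hq y, h0, LinearMap.zero_apply])
  refine (extDeriv_apply hd v).trans ?_
  have key : ∀ i : Fin (m + 2), fderiv ℝ (fun y : (Fin (m + 2) → ℂ) × ℂ =>
      ((evalAt y.1 y.2 q)⁻¹ • polyForm ζ y) (i.removeNth v)) y (v i) =
      (evalAt y.1 y.2 q)⁻¹ * dfAt (ζ (i.removeNth fun j => (v j).1)) y.1 y.2 (v i).1 -
      (evalAt y.1 y.2 q ^ 2)⁻¹ * (dfAt q y.1 y.2 (v i).1 *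
        formAt ζ y.1 y.2 (i.removeNth fun j => (v j).1)) := by
    intro i
    have h1 := fderiv_evalAt (ζ (i.removeNth fun j => (v j).1)) y (v i)
    have h2 := fderiv_evalAt q y (v i)
    rw [hv, zero_mul, add_zero] at h1 h2
    have h3 := ((hasFDerivAt_inv hw).restrictScalars ℝ |>.comp y
      (differentiable_evalAt q y).hasFDerivAt).mul
      (differentiable_evalAt (ζ (i.removeNth fun j => (v j).1)) y).hasFDerivAt
    refine (congrArg (fun L => L (v i)) h3.fderiv).trans ?_
    simp only [add_apply, smul_apply, h1, smul_eq_mul, formAt_apply, ContinuousLinearMap.comp_apply,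
      Function.comp_apply, ContinuousLinearMap.coe_restrictScalars', h2,
      ContinuousLinearMap.toSpanSingleton_apply]
    ring
  -- This is $d(q^{-1}\zeta)=q^{-1}d_/\zeta-q^{-2}d_/q\wedge\zeta$; the $d\lambda$-terms vanish by
  -- `hv`. Both remaining forms are relative of top degree, so they vanish on vectors tangent to the
  -- fibre.
  have hsum : ∑ i : Fin (m + 2), (-1 : ℤ) ^ (i : ℕ) •
      fderiv ℝ (fun y : (Fin (m + 2) → ℂ) × ℂ =>
        ((evalAt y.1 y.2 q)⁻¹ • polyForm ζ y) (i.removeNth v)) y (v i) =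
      (evalAt y.1 y.2 q)⁻¹ * formAt (dRel (m + 2) (m + 1) ζ) y.1 y.2 (fun j => (v j).1) -
      (evalAt y.1 y.2 q ^ 2)⁻¹ *
        formAt (dfWedge q (m + 1) ζ) y.1 y.2 (fun j => (v j).1) := by
    rw [formAt_dRel, formAt_dfWedge, Finset.mul_sum, Finset.mul_sum, ← Finset.sum_sub_distrib]
    refine Finset.sum_congr rfl fun i _ => ?_
    rw [key, mul_smul_comm, mul_smul_comm, ← smul_sub]
  rw [hsum, formAt_eq_zero_of_tangent f _ _ _ hx _ hv', formAt_eq_zero_of_tangent f _ _ _ hx _ hv',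
    mul_zero, mul_zero, sub_zero]

/-- The Gelfand–Leray form is closed on the fibres. -/
theorem extDeriv_leray_eq_zero {k : ℕ} (f : PolyRing (m + 2)) (ω : RelForm (m + 2) (m + 2))
    {p : ℂ × ℂ} {c : (Fin k → ℝ) → (Fin (m + 2) → ℂ) × ℂ}
    (hc : ContDiffOn ℝ 2 c (unitCube k)) (hf : CubeInFiber f p c)
    (hreg : ∀ t ∈ unitCube k, dfAt f (c t).1 (c t).2 ≠ 0) {t : Fin k → ℝ} (ht : t ∈ unitCube k)
    (u : Fin (m + 2) → Fin k → ℝ) :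
    extDeriv (leray f ω) (c t) (fun j => fderivWithin ℝ c (unitCube k) t (u j)) = 0 := by
  -- The transversal vector is frozen at its value at the point considered. The conjugate gradient
  -- is not holomorphic, whereas a constant vector leaves only polynomial forms and an inverse
  -- polynomial to differentiate.
  set w := conjGrad f (c t).1 (c t).2
  have hdc := hc.differentiableOn two_ne_zero
  have hw : dfAt f (c t).1 (c t).2 w ≠ 0 := dfAt_conjGrad_ne_zero (hreg t ht)
  obtain ⟨hd, h0⟩ := extDeriv_inv_smul_polyForm f ω w hw
    (fun j => fderivWithin ℝ c (unitCube k) t (u j))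
    (fun j => (hf.tangent ht (hdc t ht) _).1) (fun j => (hf.tangent ht (hdc t ht) _).2)
  set Θ := fun y : (Fin (m + 2) → ℂ) × ℂ => (dfAt f y.1 y.2 w)⁻¹ • polyForm (ω.curryLeft w) y
  -- On tangent vectors the Gelfand–Leray form does not depend on the transversal vector, so the two
  -- pullbacks agree near `t` in the cube and have the same exterior derivative there.
  have hev : cubePullback (leray f ω) c =ᶠ[nhdsWithin t (unitCube k)] cubePullback Θ c := by
    have hcont : ContinuousWithinAt (fun s => dfAt f (c s).1 (c s).2 w) (unitCube k) t :=
      (contDiff_evalAt (n := 0) (dirDeriv (m + 2) w f)).continuous.continuousAt.comp_continuousWithinAt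
        (hc.continuousOn t ht)
    filter_upwards [hcont.eventually_ne hw, self_mem_nhdsWithin] with s hs hsc
    ext u'
    have h1 := gelfandLeray_spec f ω (c s).1 (c s).2 (hreg s hsc)
      (fun j => (fderivWithin ℝ c (unitCube k) s (u' j)).1)
      (fun j => (hf.tangent hsc (hdc s hsc) _).2) w
    change leray f ω (c s) (fun j => fderivWithin ℝ c (unitCube k) s (u' j)) =
      (dfAt f (c s).1 (c s).2 w)⁻¹ * formAt ω (c s).1 (c s).2
        (Fin.cons w fun j => (fderivWithin ℝ c (unitCube k) s (u' j)).1)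
    rw [leray_apply, ← h1, inv_mul_cancel_left₀ hs]
  have h1 := hev.extDerivWithin_eq_of_mem ht
  rw [extDerivWithin_cubePullback hc ht hd, extDerivWithin_cubePullback hc ht
    ((contDiffAt_leray (n := 1) f ω (hreg t ht)).differentiableAt one_ne_zero)] at h1
  have h2 := congrArg (fun L => L u) h1
  exact h2.trans h0

end GelfandLeray

/-! ### Chains in a fibre -/

section FiberChains

variable {N : ℕ}

/-- The sum runs over the support of `c`, not of its image: distinct cubes of a family may become
equal at a given parameter. -/
theorem chainIntegral_pushChain {k : ℕ} {X E : Type} [NormedAddCommGroup E] [NormedSpace ℝ E]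
    (Θ : E → E [⋀^Fin k]→L[ℝ] ℂ) (F : X → E) (c : CubChain k X) :
    chainIntegral Θ (pushChain k F c) =
      ∑ σ ∈ c.support, c σ * formIntegral Θ (cubeExt fun t => F (σ t)) := by
  rw [chainIntegral, pushChain_apply, Finsupp.linearCombination_mapDomain,
    Finsupp.linearCombination_apply, Finsupp.sum]
  rfl

theorem chainIntegral_prism {k : ℕ} {X E : Type} [NormedAddCommGroup E] [NormedSpace ℝ E]
    (Θ : E → E [⋀^Fin (k + 1)]→L[ℝ] ℂ) (H : unitInterval → X → E) (c : CubChain k X) :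
    chainIntegral Θ (prism k H c) =
      ∑ τ ∈ c.support, c τ * formIntegral Θ (cubeExt fun t => H (t 0) (τ (Fin.tail t))) := by
  rw [chainIntegral, prism, Finsupp.lmapDomain_apply, Finsupp.linearCombination_mapDomain,
    Finsupp.linearCombination_apply, Finsupp.sum]
  rfl

theorem exists_of_mem_support_pushChain {k : ℕ} {X Y : Type} {F : X → Y} {c : CubChain k X}
    {τ : (Fin k → unitInterval) → Y} (h : τ ∈ (pushChain k F c).support) :
    ∃ σ ∈ c.support, τ = fun t => F (σ t) := by
  classical
  obtain ⟨σ, hσ, rfl⟩ := Finset.mem_image.mp (Finsupp.mapDomain_support h)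
  exact ⟨σ, hσ, rfl⟩

theorem exists_of_mem_support_prism {k : ℕ} {X Y : Type} {H : unitInterval → X → Y}
    {c : CubChain k X} {τ : (Fin (k + 1) → unitInterval) → Y} (h : τ ∈ (prism k H c).support) :
    ∃ σ ∈ c.support, τ = fun t => H (t 0) (σ (Fin.tail t)) := by
  classical
  obtain ⟨σ, hσ, rfl⟩ := Finset.mem_image.mp (Finsupp.mapDomain_support h)
  exact ⟨σ, hσ, rfl⟩

theorem fderivWithin_prodMk_const {k : ℕ} {c : (Fin k → ℝ) → Fin N → ℂ} {t : Fin k → ℝ}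
    (ht : t ∈ unitCube k) (hc : DifferentiableWithinAt ℝ c (unitCube k) t) (l : ℂ)
    (v : Fin k → ℝ) :
    fderivWithin ℝ (fun t => (c t, l)) (unitCube k) t v =
      (fderivWithin ℝ c (unitCube k) t v, 0) := by
  have h := hc.hasFDerivWithinAt.prodMk (hasFDerivWithinAt_const l t (unitCube k))
  rw [h.fderivWithin (uniqueDiffOn_unitCube k t ht)]
  rfl

theorem two_le_smooth : (2 : WithTop ℕ∞) ≤ ((⊤ : ℕ∞) : WithTop ℕ∞) :=
  WithTop.coe_le_coe.mpr (le_top (a := (2 : ℕ∞)))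

/-- A chain of `C²` cubes in `ℂ^N × ℂ` with values in the fibre over `p`. -/
def IsFiberChain {k : ℕ} (f : PolyRing N) (p : ℂ × ℂ) (c : CubChain k ((Fin N → ℂ) × ℂ)) : Prop :=
  ∀ σ ∈ c.support, ContDiffOn ℝ 2 (cubeExt σ) (unitCube k) ∧ ∀ t, (σ t).2 = p.2 ∧
    (σ t).1 ∈ fiber f p

theorem IsSmoothIn.isFiberChain {k : ℕ} {f : PolyRing N} {p : ℂ × ℂ} {c : CubChain k (Fin N → ℂ)}
    (hc : IsSmoothIn (fiber f p) c) :
    IsFiberChain f p (pushChain k (fun x => (x, p.2)) c) := by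
  intro τ hτ
  obtain ⟨σ, hσ, rfl⟩ := exists_of_mem_support_pushChain hτ
  obtain ⟨h1, h2⟩ := hc σ hσ
  exact ⟨(h1.of_le two_le_smooth).prodMk contDiffOn_const, fun t => ⟨rfl, h2 t⟩⟩

theorem IsFiberChain.cubeInFiber {k : ℕ} {f : PolyRing N} {p : ℂ × ℂ}
    {c : CubChain k ((Fin N → ℂ) × ℂ)} (hc : IsFiberChain f p c)
    {σ : (Fin k → unitInterval) → (Fin N → ℂ) × ℂ} (hσ : σ ∈ c.support) :
    CubeInFiber f p (cubeExt σ) := fun _ _ => (hc σ hσ).2 _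

theorem chainIntegral_congr {k : ℕ} {E : Type} [NormedAddCommGroup E] [NormedSpace ℝ E]
    {Θ Θ' : E → E [⋀^Fin k]→L[ℝ] ℂ} {c : CubChain k E}
    (h : ∀ σ ∈ c.support, ∀ t ∈ unitCube k,
      Θ (cubeExt σ t) (fun j => fderivWithin ℝ (cubeExt σ) (unitCube k) t (Pi.single j 1)) =
      Θ' (cubeExt σ t) fun j => fderivWithin ℝ (cubeExt σ) (unitCube k) t (Pi.single j 1)) :
    chainIntegral Θ c = chainIntegral Θ' c := by
  rw [chainIntegral, chainIntegral, Finsupp.linearCombination_apply,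
    Finsupp.linearCombination_apply]
  refine Finset.sum_congr rfl fun σ hσ => ?_
  simp only [formIntegral]
  rw [MeasureTheory.setIntegral_congr_fun measurableSet_Icc fun t ht => h σ hσ t ht]

theorem chainIntegral_add {k : ℕ} {E : Type} [NormedAddCommGroup E] [NormedSpace ℝ E]
    {Θ Θ' : E → E [⋀^Fin k]→L[ℝ] ℂ} {c : CubChain k E}
    (hc : ∀ σ ∈ c.support, ContDiffOn ℝ 2 (cubeExt σ) (unitCube k))
    (hΘ : ∀ σ ∈ c.support, ∀ t, ContinuousAt Θ (σ t))
    (hΘ' : ∀ σ ∈ c.support, ∀ t, ContinuousAt Θ' (σ t)) :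
    chainIntegral (fun y => Θ y + Θ' y) c = chainIntegral Θ c + chainIntegral Θ' c := by
  simp only [chainIntegral, Finsupp.linearCombination_apply, Finsupp.sum]
  rw [← Finset.sum_add_distrib]
  refine Finset.sum_congr rfl fun σ hσ => ?_
  have hD : ∀ v, ContinuousOn (fun t => fderivWithin ℝ (cubeExt σ) (unitCube k) t v)
      (unitCube k) := fun v =>
    ((hc σ hσ).continuousOn_fderivWithin (uniqueDiffOn_unitCube k) (by norm_num)).clm_apply
      continuousOn_const
  have hi := fun (Ψ : E → E [⋀^Fin k]→L[ℝ] ℂ) (h : ∀ t, ContinuousAt Ψ (σ t)) =>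
    (continuousOn_form_apply (hc σ hσ).continuousOn (Θ := Ψ) (fun t _ => h _)
      (v := fun j t => fderivWithin ℝ (cubeExt σ) (unitCube k) t (Pi.single j 1))
      fun j => hD _).integrableOn_compact isCompact_Icc (μ := MeasureTheory.volume)
  rw [← smul_add]
  congr 1
  exact MeasureTheory.integral_add (hi Θ (hΘ σ hσ)) (hi Θ' (hΘ' σ hσ))

end FiberChains

/-! ### Periods: dependence on the homology class and on the class in $E_f$ -/

section Periods

variable {m : ℕ}

/-- The fibre over `p` is smooth. -/
def IsRegularValue {N : ℕ} (f : PolyRing N) (p : ℂ × ℂ) : Prop :=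
  ∀ x ∈ fiber f p, dfAt f x p.2 ≠ 0

theorem isRegularValue_of_disjoint {N : ℕ} {f : PolyRing N} {U : Set (ℂ × ℂ)}
    (h0 : ∀ p ∈ U, p.2 ≠ 0) (hU : Disjoint U (criticalValues f)) {p : ℂ × ℂ} (hp : p ∈ U) :
    IsRegularValue f p := fun x hx h =>
  Set.disjoint_left.mp hU hp ⟨h0 p hp, x, hx, h⟩

theorem IsFiberChain.dfAt_ne_zero {N k : ℕ} {f : PolyRing N} {p : ℂ × ℂ}
    {c : CubChain k ((Fin N → ℂ) × ℂ)} (hc : IsFiberChain f p c) (hp : IsRegularValue f p)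
    {σ : (Fin k → unitInterval) → (Fin N → ℂ) × ℂ} (hσ : σ ∈ c.support) (t) :
    dfAt f (σ t).1 (σ t).2 ≠ 0 := by
  rw [((hc σ hσ).2 t).1]
  exact hp _ ((hc σ hσ).2 t).2

/-- The cubes are placed in $\mathbb{C}^N\times\mathbb{C}$ with constant $\lambda$-coordinate, so
that periods at different $\lambda$ become integrals of one and the same form. -/
theorem period_eq_chainIntegral (f : PolyRing (m + 2)) (ω : RelForm (m + 2) (m + 2)) {p : ℂ × ℂ}
    {c : CubChain (m + 1) (Fin (m + 2) → ℂ)} (hc : IsSmoothIn (fiber f p) c) :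
    period f ω p.2 c =
      chainIntegral (leray f ω) (pushChain (m + 1) (fun x => (x, p.2)) c) := by
  rw [chainIntegral_pushChain, period, Finsupp.sum]
  refine Finset.sum_congr rfl fun σ hσ => ?_
  congr 1
  refine MeasureTheory.setIntegral_congr_fun measurableSet_Icc fun t ht => ?_
  have hd := (hc σ hσ).1.differentiableOn (by simp) t ht
  have h : (cubeExt fun t => (σ t, p.2)) = fun t => (cubeExt σ t, p.2) := rfl
  simp only [h, leray_apply, fderivWithin_prodMk_const ht hd]

/-- Periods over homologous chains in a smooth fibre agree. -/
theorem chainIntegral_leray_boundary (f : PolyRing (m + 2)) (ω : RelForm (m + 2) (m + 2))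
    {p : ℂ × ℂ} (hp : IsRegularValue f p) {e : CubChain (m + 2) ((Fin (m + 2) → ℂ) × ℂ)}
    (he : IsFiberChain f p e) : chainIntegral (leray f ω) (boundary (m + 1) _ e) = 0 := by
  rw [chainIntegral_boundary _ _ (fun σ hσ => (he σ hσ).1) fun σ hσ t =>
    contDiffAt_leray f ω (he.dfAt_ne_zero hp hσ t)]
  have h0 : chainIntegral (k := m + 2) (fun _ => 0) e = 0 := by
    rw [chainIntegral, Finsupp.linearCombination_apply]
    exact Finset.sum_eq_zero fun σ _ => by simp [formIntegral]
  rw [← h0]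
  refine chainIntegral_congr fun σ hσ t ht => ?_
  exact extDeriv_leray_eq_zero f ω (he σ hσ).1 (he.cubeInFiber hσ)
    (fun t _ => he.dfAt_ne_zero hp hσ _) ht _

/-- Up to degenerate cubes, on which integrals vanish, $c-c'$ is a boundary in the fibre, where the
Gelfand–Leray form is closed. -/
theorem period_eq_of_homologous (f : PolyRing (m + 2)) (ω : RelForm (m + 2) (m + 2)) {p : ℂ × ℂ}
    (hp : IsRegularValue f p) {c c' : CubChain (m + 1) (Fin (m + 2) → ℂ)}
    (hc : IsSmoothIn (fiber f p) c) (h : HomologousIn (fiber f p) c c') :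
    period f ω p.2 c =
      chainIntegral (leray f ω) (pushChain (m + 1) (fun x => (x, p.2)) c') := by
  obtain ⟨e, he, hdeg⟩ := h
  have h1 := chainIntegral_degenerate (leray f ω) (pushChain_degenerate (fun x => (x, p.2)) hdeg)
  rw [map_sub, map_sub, map_sub, map_sub, ← boundary_pushChain,
    chainIntegral_leray_boundary f ω hp he.isFiberChain, sub_zero, sub_eq_zero] at h1
  rw [period_eq_chainIntegral f ω hc, h1]

/-- For tangent $v_j$ the expansion of $(d_/f\wedge\xi)(w,v_1,\dots,v_n)$ reduces to its first term
$d_/f(w)\,\xi(v_1,\dots,v_n)$. Thus periods of $b[d_/\xi]$ are integrals of the polynomial form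
$\xi$. -/
theorem gelfandLeray_dfWedge (f : PolyRing (m + 2)) (ξ : RelForm (m + 2) (m + 1))
    {x : Fin (m + 2) → ℂ} {l : ℂ} (hx : dfAt f x l ≠ 0) {v : Fin (m + 1) → Fin (m + 2) → ℂ}
    (hv : ∀ j, dfAt f x l (v j) = 0) :
    gelfandLeray f (dfWedge f (m + 1) ξ) x l v = formAt ξ x l v := by
  rw [gelfandLeray, formAt_dfWedge, Fin.sum_univ_succ,
    Finset.sum_eq_zero fun i _ => by rw [Fin.cons_succ, hv, zero_mul, smul_zero], add_zero,
    div_eq_iff (dfAt_conjGrad_ne_zero hx)]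
  simp [mul_comm]

theorem leray_dfWedge_of_tangent {k : ℕ} (f : PolyRing (m + 2)) (ξ : RelForm (m + 2) (m + 1))
    {p : ℂ × ℂ} (hp : IsRegularValue f p) {c : CubChain k ((Fin (m + 2) → ℂ) × ℂ)}
    (hc : IsFiberChain f p c) {σ} (hσ : σ ∈ c.support) {t : Fin k → ℝ} (ht : t ∈ unitCube k)
    (u : Fin (m + 1) → Fin k → ℝ) :
    leray f (dfWedge f (m + 1) ξ) (cubeExt σ t)
        (fun j => fderivWithin ℝ (cubeExt σ) (unitCube k) t (u j)) =
      polyForm ξ (cubeExt σ t) fun j => fderivWithin ℝ (cubeExt σ) (unitCube k) t (u j) := by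
  rw [leray_apply]
  exact gelfandLeray_dfWedge f ξ (hc.dfAt_ne_zero hp hσ _) fun j =>
    ((hc.cubeInFiber hσ).tangent ht ((hc σ hσ).1.differentiableOn two_ne_zero t ht) _).2

theorem chainIntegral_leray_dfWedge (f : PolyRing (m + 2)) (ξ : RelForm (m + 2) (m + 1))
    {p : ℂ × ℂ} (hp : IsRegularValue f p) {c : CubChain (m + 1) ((Fin (m + 2) → ℂ) × ℂ)}
    (hc : IsFiberChain f p c) :
    chainIntegral (leray f (dfWedge f (m + 1) ξ)) c = chainIntegral (polyForm ξ) c :=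
  chainIntegral_congr fun _ hσ _ ht => leray_dfWedge_of_tangent f ξ hp hc hσ ht _

/-- On a fibre $d\lambda$ vanishes, so $d_/\eta$ and $d\eta$ have the same integral, and Stokes
moves it to the degenerate boundary. -/
theorem chainIntegral_polyForm_dRel (f : PolyRing (m + 2)) (η : RelForm (m + 2) m)
    {p : ℂ × ℂ} {c : CubChain (m + 1) ((Fin (m + 2) → ℂ) × ℂ)} (hc : IsFiberChain f p c)
    (hb : boundary m _ c ∈ degenerate m _) :
    chainIntegral (polyForm (dRel (m + 2) m η)) c = 0 := by
  rw [← chainIntegral_degenerate (polyForm η) hb,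
    chainIntegral_boundary _ _ (fun σ hσ => (hc σ hσ).1) fun σ _ t =>
      (contDiff_polyForm η).contDiffAt]
  refine chainIntegral_congr fun σ hσ t ht => ?_
  rw [extDeriv_polyForm, Finset.sum_eq_zero fun i _ => ?_, add_zero]
  · rfl
  · rw [((hc.cubeInFiber hσ).tangent ht
      ((hc σ hσ).1.differentiableOn two_ne_zero t ht) _).1, zero_mul, smul_zero]

theorem leray_add (f : PolyRing (m + 2)) (ω ω' : RelForm (m + 2) (m + 2)) :
    leray f (ω + ω') = fun y => leray f ω y + leray f ω' y := by
  funext y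
  ext v
  simp only [ContinuousAlternatingMap.add_apply, leray_apply, gelfandLeray, ← add_div]
  congr 1
  simp [formAt_apply]

/-- Periods over cycles depend only on the class in `E_f`. -/
theorem period_eq_of_toE_eq {f : PolyRing (m + 2)} {ω ω' : RelForm (m + 2) (m + 2)}
    (h : toE f ω = toE f ω') {p : ℂ × ℂ} (hp : IsRegularValue f p)
    {c : CubChain (m + 1) (Fin (m + 2) → ℂ)} (hc : IsCycleIn (fiber f p) c) :
    period f ω p.2 c = period f ω' p.2 c := by
  obtain ⟨η, hη⟩ := (Submodule.Quotient.eq (brieskornRel f)).mp h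
  have hω : ω = ω' + dfWedge f (m + 1) (dRel (m + 2) m η) := by
    rw [← sub_eq_iff_eq_add', ← hη]; rfl
  -- On the fibre the Gelfand–Leray form of the relation $d_/f\wedge d_/\eta$ is $d_/\eta$, whose
  -- integral over a cycle is zero.
  have hF := hc.1.isFiberChain
  rw [period_eq_chainIntegral f ω hc.1, period_eq_chainIntegral f ω' hc.1, hω, leray_add,
    chainIntegral_add (fun σ hσ => (hF σ hσ).1)
      (fun σ hσ t => (contDiffAt_leray (n := 0) f _ (hF.dfAt_ne_zero hp hσ t)).continuousAt)
      (fun σ hσ t => (contDiffAt_leray (n := 0) f _ (hF.dfAt_ne_zero hp hσ t)).continuousAt),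
    chainIntegral_leray_dfWedge f _ hp hF, chainIntegral_polyForm_dRel f η hF, add_zero]
  rw [boundary_pushChain]
  exact pushChain_degenerate _ hc.2

end Periods

/-! ### Integrals over thin prisms -/

section Prism

open MeasureTheory

theorem measureReal_unitCube (k : ℕ) : volume.real (unitCube k) = 1 := by
  rw [Measure.real, Real.volume_Icc_pi_toReal zero_le_one]
  simp

theorem setIntegral_unitCube_tail {F : Type*} [NormedAddCommGroup F] [NormedSpace ℝ F] {k : ℕ}
    (h : (Fin k → ℝ) → F) :
    ∫ t in unitCube (k + 1), h (Fin.tail t) = ∫ t in unitCube k, h t := by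
  have he := volume_preserving_piFinSuccAbove (fun _ : Fin (k + 1) => ℝ) 0
  have h1 := he.setIntegral_preimage_emb (MeasurableEquiv.measurableEmbedding _)
    (fun z : ℝ × (Fin k → ℝ) => h z.2) (Set.Icc 0 1 ×ˢ unitCube k)
  have h2 : (MeasurableEquiv.piFinSuccAbove (fun _ : Fin (k + 1) => ℝ) 0) ⁻¹'
      (Set.Icc 0 1 ×ˢ unitCube k) = unitCube (k + 1) := by
    ext t
    simp only [Set.mem_preimage, Set.mem_prod, Set.mem_Icc, Pi.le_def, Fin.forall_fin_succ]
    change ((0 ≤ t 0 ∧ t 0 ≤ 1) ∧ (∀ j : Fin k, 0 ≤ t j.succ) ∧ ∀ j : Fin k, t j.succ ≤ 1) ↔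
      (0 ≤ t 0 ∧ ∀ j : Fin k, 0 ≤ t j.succ) ∧ t 0 ≤ 1 ∧ ∀ j : Fin k, t j.succ ≤ 1
    tauto
  rw [h2] at h1
  refine Eq.trans ?_ (h1.trans ?_)
  · rfl
  · rw [Measure.volume_eq_prod, ← Measure.prod_restrict, integral_fun_snd]
    simp

theorem tail_mem_unitCube {k : ℕ} {t : Fin (k + 1) → ℝ} (ht : t ∈ unitCube (k + 1)) :
    Fin.tail t ∈ unitCube k :=
  ⟨fun j => ht.1 j.succ, fun j => ht.2 j.succ⟩

variable {P F : Type*} [NormedAddCommGroup P] [NormedSpace ℝ P] [NormedAddCommGroup F]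
  [NormedSpace ℝ F] {k : ℕ}

/-- The map `(r, t) ↦ (t, p + r ν)`. -/
def prismMap (p ν : P) (t : Fin (k + 1) → ℝ) : (Fin k → ℝ) × P := (Fin.tail t, p + t 0 • ν)

theorem prismMap_mem {V : Set P} {p ν : P} (hseg : ∀ r ∈ Set.Icc (0 : ℝ) 1, p + r • ν ∈ V)
    {t : Fin (k + 1) → ℝ} (ht : t ∈ unitCube (k + 1)) : prismMap p ν t ∈ unitCube k ×ˢ V :=
  ⟨tail_mem_unitCube ht, hseg _ ⟨ht.1 0, ht.2 0⟩⟩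

theorem contDiff_prismMap (p ν : P) {n : WithTop ℕ∞} :
    ContDiff ℝ n (prismMap (k := k) p ν) := by
  refine ContDiff.prodMk (contDiff_pi.mpr fun j => contDiff_apply ℝ ℝ j.succ) ?_
  exact contDiff_const.add ((contDiff_apply ℝ ℝ (0 : Fin (k + 1))).smul contDiff_const)

theorem fderiv_prismMap (p ν : P) (t v : Fin (k + 1) → ℝ) :
    fderiv ℝ (prismMap (k := k) p ν) t v = (Fin.tail v, v 0 • ν) := by
  have h1 : HasFDerivAt (fun t : Fin (k + 1) → ℝ => Fin.tail t)
      (ContinuousLinearMap.pi fun j : Fin k => ContinuousLinearMap.proj (R := ℝ)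
        (φ := fun _ : Fin (k + 1) => ℝ) j.succ) t :=
    (ContinuousLinearMap.pi fun j : Fin k => ContinuousLinearMap.proj (R := ℝ)
        (φ := fun _ : Fin (k + 1) => ℝ) j.succ).hasFDerivAt
  have h2 : HasFDerivAt (fun t : Fin (k + 1) → ℝ => p + t 0 • ν)
      ((ContinuousLinearMap.proj (R := ℝ) (φ := fun _ : Fin (k + 1) => ℝ) 0).smulRight ν) t :=
    ((ContinuousLinearMap.proj (R := ℝ) (φ := fun _ : Fin (k + 1) => ℝ) 0).smulRight
      ν).hasFDerivAt.const_add p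
  have h3 : fderiv ℝ (prismMap (k := k) p ν) t = _ := (h1.prodMk h2).fderiv
  rw [h3]
  rfl

theorem eventually_segment_mem {V : Set P} (hV : IsOpen V) {p : P} (hp : p ∈ V) :
    ∀ᶠ ν : P in nhds 0, ∀ r ∈ Set.Icc (0 : ℝ) 1, p + r • ν ∈ V := by
  obtain ⟨δ, hδ, hball⟩ := Metric.isOpen_iff.mp hV p hp
  filter_upwards [Metric.ball_mem_nhds 0 hδ] with ν hν r hr
  refine hball ?_
  rw [mem_ball_zero_iff] at hν
  rw [Metric.mem_ball, dist_self_add_left, norm_smul, Real.norm_of_nonneg hr.1]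
  exact (mul_le_of_le_one_left (norm_nonneg ν) hr.2).trans_lt hν

theorem continuousOn_comp_prismMap {Y : Type*} [TopologicalSpace Y] {A : (Fin k → ℝ) × P → Y} {V : Set P}
    (hA : ContinuousOn A (unitCube k ×ˢ V)) {p ν : P}
    (hseg : ∀ r ∈ Set.Icc (0 : ℝ) 1, p + r • ν ∈ V) :
    ContinuousOn (fun t => A (prismMap p ν t)) (unitCube (k + 1)) :=
  hA.comp (contDiff_prismMap (n := 0) p ν).continuous.continuousOn fun _ ht => prismMap_mem hseg ht

/-- The left side averages `A` over the segment from $p$ to $p+\nu$. By compactness of the cube,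
$A(t,q)\to A(t,p)$ as $q\to p$ uniformly in $t$, and for the constant segment the first coordinate
integrates out. -/
theorem tendsto_integral_prismMap {A : (Fin k → ℝ) × P → F} {V : Set P} (hV : IsOpen V) {p : P}
    (hp : p ∈ V) (hA : ContinuousOn A (unitCube k ×ˢ V)) :
    Filter.Tendsto (fun ν => ∫ t in unitCube (k + 1), A (prismMap p ν t)) (nhds 0)
      (nhds (∫ t in unitCube k, A (t, p))) := by
  rw [Metric.tendsto_nhds]
  intro ε hε
  have hswap : ContinuousOn (Function.uncurry fun q t => A (t, q)) (V ×ˢ unitCube k) :=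
    hA.comp continuous_swap.continuousOn fun z hz => ⟨hz.2, hz.1⟩
  obtain ⟨W, hW, hWA⟩ := isCompact_Icc.mem_uniformity_of_prod hswap hp
    (Metric.dist_mem_uniformity (half_pos hε))
  rw [hV.nhdsWithin_eq hp] at hW
  obtain ⟨W', hW', hWo, hpW⟩ := mem_nhds_iff.mp hW
  filter_upwards [eventually_segment_mem hV hp, eventually_segment_mem hWo hpW] with ν h1 h2
  have hc1 := continuousOn_comp_prismMap hA h1
  have hc2 : ContinuousOn (fun t => A (Fin.tail t, p)) (unitCube (k + 1)) :=
    hA.comp ((continuous_pi fun j => continuous_apply (Fin.succ j)).prodMk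
      continuous_const).continuousOn fun t ht => ⟨tail_mem_unitCube ht, hp⟩
  rw [dist_eq_norm, ← setIntegral_unitCube_tail fun t => A (t, p),
    ← integral_sub (hc1.integrableOn_compact isCompact_Icc)
      (hc2.integrableOn_compact isCompact_Icc)]
  refine (norm_setIntegral_le_of_norm_le_const (C := ε / 2) isCompact_Icc.measure_lt_top
    fun t ht => ?_).trans_lt ?_
  · rw [← dist_eq_norm]
    exact (hWA _ (hW' (h2 _ ⟨ht.1 0, ht.2 0⟩)) _ (tail_mem_unitCube ht)).le
  · rw [measureReal_unitCube, mul_one]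
    exact half_lt_self hε

end Prism

/-! ### Smooth families of cubes -/

section Families

variable {N k : ℕ}

/-- `g` is a smooth extension of the family of cubes `σ` over `V`. -/
def IsFamilyExt (V : Set (ℂ × ℂ)) (σ : (Fin k → unitInterval) → V → Fin N → ℂ)
    (g : (Fin k → ℝ) × ℂ × ℂ → Fin N → ℂ) : Prop :=
  ContDiffOn ℝ (⊤ : ℕ∞) g (unitCube k ×ˢ V) ∧
    ∀ t ∈ unitCube k, ∀ p : V, g (t, p) = cubeExt σ t p

/-- The pullback of `d Θ` to the parameter space of a family of cubes `g`, contracted with the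
coordinate vectors of the cube. -/
def familyDeriv (Θ : (Fin N → ℂ) × ℂ → ((Fin N → ℂ) × ℂ) [⋀^Fin k]→L[ℝ] ℂ) (V : Set (ℂ × ℂ))
    (g : (Fin k → ℝ) × ℂ × ℂ → Fin N → ℂ) (z : (Fin k → ℝ) × ℂ × ℂ) : ℂ × ℂ →L[ℝ] ℂ :=
  ((ContinuousAlternatingMap.apply ℝ ((Fin N → ℂ) × ℂ) ℂ fun j : Fin k =>
      (fderivWithin ℝ g (unitCube k ×ˢ V) z (Pi.single j 1, 0), (0 : ℂ))).comp
    (extDeriv Θ (g z, z.2.2)).curryLeft).comp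
  (((fderivWithin ℝ g (unitCube k ×ˢ V) z).comp
    (ContinuousLinearMap.inr ℝ (Fin k → ℝ) (ℂ × ℂ))).prod (ContinuousLinearMap.snd ℝ ℂ ℂ))

theorem familyDeriv_apply (Θ : (Fin N → ℂ) × ℂ → ((Fin N → ℂ) × ℂ) [⋀^Fin k]→L[ℝ] ℂ)
    (V : Set (ℂ × ℂ)) (g : (Fin k → ℝ) × ℂ × ℂ → Fin N → ℂ) (z : (Fin k → ℝ) × ℂ × ℂ)
    (ν : ℂ × ℂ) :
    familyDeriv Θ V g z ν = extDeriv Θ (g z, z.2.2)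
      (Fin.cons (fderivWithin ℝ g (unitCube k ×ˢ V) z (0, ν), ν.2) fun j =>
        (fderivWithin ℝ g (unitCube k ×ˢ V) z (Pi.single j 1, 0), (0 : ℂ))) := rfl

theorem uniqueDiffOn_unitCube_prod {V : Set (ℂ × ℂ)} (hV : IsOpen V) :
    UniqueDiffOn ℝ (unitCube k ×ˢ V) :=
  (uniqueDiffOn_unitCube k).prod hV.uniqueDiffOn

theorem continuousOn_familyDeriv {Θ : (Fin N → ℂ) × ℂ → ((Fin N → ℂ) × ℂ) [⋀^Fin k]→L[ℝ] ℂ}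
    {V : Set (ℂ × ℂ)} (hV : IsOpen V) {g : (Fin k → ℝ) × ℂ × ℂ → Fin N → ℂ}
    (hg : ContDiffOn ℝ (⊤ : ℕ∞) g (unitCube k ×ˢ V))
    (hΘ : ∀ z ∈ unitCube k ×ˢ V, ContDiffAt ℝ 1 Θ (g z, z.2.2)) :
    ContinuousOn (familyDeriv Θ V g) (unitCube k ×ˢ V) := by
  rw [continuousOn_clm_apply]
  intro ν
  simp only [familyDeriv_apply]
  have hD : ∀ v, ContinuousOn (fun z => fderivWithin ℝ g (unitCube k ×ˢ V) z v)
      (unitCube k ×ˢ V) := fun v =>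
    (hg.continuousOn_fderivWithin (uniqueDiffOn_unitCube_prod hV) (by simp)).clm_apply
      continuousOn_const
  refine continuousOn_form_apply (c := fun z : (Fin k → ℝ) × ℂ × ℂ => (g z, z.2.2))
    (hg.continuousOn.prodMk (continuous_snd.snd.continuousOn))
    (fun z hz => continuousAt_extDeriv (hΘ z hz))
    (v := fun j z => (Fin.cons (fderivWithin ℝ g (unitCube k ×ˢ V) z (0, ν), ν.2) fun j =>
        (fderivWithin ℝ g (unitCube k ×ˢ V) z (Pi.single j 1, 0), (0 : ℂ)) :
          Fin (k + 1) → (Fin N → ℂ) × ℂ) j) fun j => ?_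
  refine Fin.cases ?_ (fun j => ?_) j
  · exact (hD _).prodMk continuousOn_const
  · exact (hD _).prodMk continuousOn_const

variable {V : Set (ℂ × ℂ)}

/-- The straight path in the parameter space. -/
def segmentPath {p ν : ℂ × ℂ} (hseg : ∀ r ∈ Set.Icc (0 : ℝ) 1, p + r • ν ∈ V) (r : unitInterval) :
    V :=
  ⟨p + (r : ℝ) • ν, hseg r r.2⟩

/-- The members of a family of chains over a path, as a homotopy. -/
def pathHomotopy (q : unitInterval → V) (r : unitInterval) (h : V → Fin N → ℂ) :
    (Fin N → ℂ) × ℂ :=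
  (h (q r), (q r).1.2)

theorem cubeExt_prism_eqOn {σ : (Fin k → unitInterval) → V → Fin N → ℂ}
    {g : (Fin k → ℝ) × ℂ × ℂ → Fin N → ℂ} (hg : IsFamilyExt V σ g) {p ν : ℂ × ℂ}
    (hseg : ∀ r ∈ Set.Icc (0 : ℝ) 1, p + r • ν ∈ V) :
    Set.EqOn (cubeExt fun t : Fin (k + 1) → unitInterval =>
        pathHomotopy (segmentPath hseg) (t 0) (σ (Fin.tail t)))
      (fun t => (g (prismMap p ν t), (prismMap p ν t).2.2)) (unitCube (k + 1)) := by
  intro t ht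
  have h0 : ((Set.projIcc (0 : ℝ) 1 zero_le_one (t 0) : unitInterval) : ℝ) = t 0 := by
    rw [Set.projIcc_of_mem zero_le_one ⟨ht.1 0, ht.2 0⟩]
  have h1 : (segmentPath hseg (Set.projIcc (0 : ℝ) 1 zero_le_one (t 0)) : ℂ × ℂ) =
      (prismMap p ν t).2 := by
    simp only [segmentPath, h0]
    rfl
  have h2 := hg.2 _ (tail_mem_unitCube ht)
    (segmentPath hseg (Set.projIcc (0 : ℝ) 1 zero_le_one (t 0)))
  rw [h1] at h2
  change (cubeExt σ (Fin.tail t) (segmentPath hseg _), (segmentPath hseg _).1.2) = _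
  rw [← h2, h1]
  rfl

theorem contDiffOn_prism {g : (Fin k → ℝ) × ℂ × ℂ → Fin N → ℂ}
    (hg : ContDiffOn ℝ (⊤ : ℕ∞) g (unitCube k ×ˢ V)) {p ν : ℂ × ℂ}
    (hseg : ∀ r ∈ Set.Icc (0 : ℝ) 1, p + r • ν ∈ V) :
    ContDiffOn ℝ 2 (fun t => (g (prismMap p ν t), (prismMap p ν t).2.2)) (unitCube (k + 1)) := by
  have h1 := contDiff_prismMap (k := k) p ν (n := 2)
  exact ((hg.of_le two_le_smooth).comp h1.contDiffOn fun t ht => prismMap_mem hseg ht).prodMk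
    h1.snd.snd.contDiffOn

/-- The tangent vector of the prism along $t_0$ is the image of $\nu$, and the others are those of
the member cube. The integrand is therefore a linear form, continuous in the parameter, applied to
$\nu$. -/
theorem formIntegral_prism
    (Θ : (Fin N → ℂ) × ℂ → ((Fin N → ℂ) × ℂ) [⋀^Fin k]→L[ℝ] ℂ)
    {g : (Fin k → ℝ) × ℂ × ℂ → Fin N → ℂ}
    (hg : ContDiffOn ℝ (⊤ : ℕ∞) g (unitCube k ×ˢ V)) {p ν : ℂ × ℂ}
    (hseg : ∀ r ∈ Set.Icc (0 : ℝ) 1, p + r • ν ∈ V) :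
    formIntegral (extDeriv Θ) (fun t => (g (prismMap p ν t), (prismMap p ν t).2.2)) =
      ∫ t in unitCube (k + 1), familyDeriv Θ V g (prismMap p ν t) ν := by
  refine MeasureTheory.setIntegral_congr_fun measurableSet_Icc fun t ht => ?_
  simp only [familyDeriv_apply]
  congr 1
  have hp := ((contDiff_prismMap (k := k) p ν (n := 1)).differentiable one_ne_zero t).hasFDerivAt
  have h1 := (hg.differentiableOn (by simp) _ (prismMap_mem hseg ht)).hasFDerivWithinAt.comp t
    hp.hasFDerivWithinAt fun s hs => prismMap_mem hseg hs
  have h2 := (hasFDerivAt_snd (𝕜 := ℝ) (p := (prismMap p ν t).2)).comp t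
    ((hasFDerivAt_snd (𝕜 := ℝ) (p := prismMap p ν t)).comp t hp)
  have h3 : fderivWithin ℝ (fun t => (g (prismMap p ν t), (prismMap p ν t).2.2))
      (unitCube (k + 1)) t = _ :=
    (h1.prodMk h2.hasFDerivWithinAt).fderivWithin (uniqueDiffOn_unitCube _ t ht)
  have h4 : ∀ v, fderivWithin ℝ (fun t => (g (prismMap p ν t), (prismMap p ν t).2.2))
      (unitCube (k + 1)) t v =
      (fderivWithin ℝ g (unitCube k ×ˢ V) (prismMap p ν t) (Fin.tail v, v 0 • ν),
        (v 0 • ν).2) := by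
    intro v
    rw [h3, ← fderiv_prismMap p ν t v]
    simp only [ContinuousLinearMap.prod_apply, ContinuousLinearMap.comp_apply,
      ContinuousLinearMap.coe_snd', fderiv_prismMap]
  funext j
  rw [h4]
  refine Fin.cases ?_ (fun j => ?_) j
  · have : Fin.tail (Pi.single 0 1 : Fin (k + 1) → ℝ) = 0 := by
      funext j; simp [Fin.tail]
    rw [this]
    simp
  · have : Fin.tail (Pi.single j.succ 1 : Fin (k + 1) → ℝ) = Pi.single j 1 := by
      funext i; simp [Fin.tail, Pi.single_apply]
    rw [this]
    simp

end Families

/-! ### Differentiation under a moving cycle -/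

section Differentiation

variable {N k : ℕ} {V : Set (ℂ × ℂ)}

/-- Integrals of a form over the members of a smooth family of cycles are differentiable in the
parameters. -/
theorem hasFDerivAt_chainIntegral {f : PolyRing N} (hV : IsOpen V)
    {G : CubChain (k + 1) (V → Fin N → ℂ)} (hG : IsCycleFamily f V G)
    {g : ((Fin (k + 1) → unitInterval) → V → Fin N → ℂ) →
      (Fin (k + 1) → ℝ) × ℂ × ℂ → Fin N → ℂ}
    (hg : ∀ σ ∈ G.support, IsFamilyExt V σ (g σ))
    {Θ : (Fin N → ℂ) × ℂ → ((Fin N → ℂ) × ℂ) [⋀^Fin (k + 1)]→L[ℝ] ℂ}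
    (hΘ : ∀ p ∈ V, ∀ x ∈ fiber f p, ContDiffAt ℝ 1 Θ (x, p.2)) {F : ℂ × ℂ → ℂ}
    (hF : ∀ p : V, F p =
      chainIntegral Θ (pushChain (k + 1) (fun h : V → Fin N → ℂ => (h p, p.1.2)) G))
    {p : ℂ × ℂ} (hp : p ∈ V) :
    HasFDerivAt F (∑ σ ∈ G.support,
      G σ • ∫ t in unitCube (k + 1), familyDeriv Θ V (g σ) (t, p)) p := by
  have hΘg : ∀ σ ∈ G.support, ∀ z ∈ unitCube (k + 1) ×ˢ V,
      ContDiffAt ℝ 1 Θ (g σ z, z.2.2) := by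
    intro σ hσ z hz
    refine hΘ z.2 hz.2 _ ?_
    have : g σ z = cubeExt σ z.1 ⟨z.2, hz.2⟩ := (hg σ hσ).2 z.1 hz.1 ⟨z.2, hz.2⟩
    rw [this]
    exact (hG.1 σ hσ).2 _ ⟨z.2, hz.2⟩
  have hcont : ∀ σ ∈ G.support,
      ContinuousOn (familyDeriv Θ V (g σ)) (unitCube (k + 1) ×ˢ V) := fun σ hσ =>
    continuousOn_familyDeriv hV (hg σ hσ).1 (hΘg σ hσ)
  -- By Stokes on the prism over the segment, $F(p+\nu)-F(p)=M(\nu)\,\nu$ exactly for small $\nu$,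
  -- where $M(\nu)$ is a linear map that converges as $\nu\to0$. The limit is then the derivative of
  -- $F$ at $p$.
  let M : ℂ × ℂ → ℂ × ℂ →L[ℝ] ℂ := fun ν => ∑ σ ∈ G.support,
    G σ • ∫ t in unitCube (k + 2), familyDeriv Θ V (g σ) (prismMap p ν t)
  have hM : Filter.Tendsto M (nhds 0) (nhds (∑ σ ∈ G.support,
      G σ • ∫ t in unitCube (k + 1), familyDeriv Θ V (g σ) (t, p))) :=
    tendsto_finsetSum _ fun σ hσ => (tendsto_integral_prismMap hV hp (hcont σ hσ)).const_smul _
  have hdiff : ∀ᶠ ν in nhds (0 : ℂ × ℂ), F (p + ν) - F p = M ν ν := by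
    filter_upwards [eventually_segment_mem hV hp] with ν hseg
    have h1 : ((segmentPath hseg 1 : V) : ℂ × ℂ) = p + ν := by simp [segmentPath]
    have h0 : ((segmentPath hseg 0 : V) : ℂ × ℂ) = p := by simp [segmentPath]
    set H := pathHomotopy (N := N) (segmentPath hseg)
    -- The relative boundary of the family is degenerate, so only the two end members contribute to
    -- the boundary of the prism.
    have hb := congrArg (chainIntegral Θ) (boundary_prism H G)
    rw [map_sub, map_sub, chainIntegral_degenerate Θ (prism_degenerate H hG.2), sub_zero] at hb
    have hF1 : F (p + ν) = chainIntegral Θ (pushChain (k + 1) (H 1) G) := by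
      rw [← h1]; exact hF _
    have hF0 : F p = chainIntegral Θ (pushChain (k + 1) (H 0) G) := by
      conv_lhs => rw [← h0]
      exact hF _
    have hsupp : ∀ σ ∈ G.support, ContDiffOn ℝ 2
        (cubeExt fun t : Fin (k + 2) → unitInterval => H (t 0) (σ (Fin.tail t)))
        (unitCube (k + 2)) := fun σ hσ =>
      (contDiffOn_prism (hg σ hσ).1 hseg).congr (cubeExt_prism_eqOn (hg σ hσ) hseg)
    rw [hF1, hF0]
    refine hb.symm.trans ?_
    rw [chainIntegral_boundary, chainIntegral_prism]
    · simp only [M, sum_apply, smul_apply, smul_eq_mul]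
      refine Finset.sum_congr rfl fun σ hσ => ?_
      rw [formIntegral_congr _ (cubeExt_prism_eqOn (hg σ hσ) hseg),
        formIntegral_prism Θ (hg σ hσ).1 hseg, ContinuousLinearMap.integral_apply]
      exact (continuousOn_comp_prismMap (hcont σ hσ) hseg).integrableOn_compact isCompact_Icc
    · intro τ hτ
      obtain ⟨σ, hσ, rfl⟩ := exists_of_mem_support_prism hτ
      exact hsupp σ hσ
    · intro τ hτ t
      obtain ⟨σ, hσ, rfl⟩ := exists_of_mem_support_prism hτ
      exact hΘ _ (segmentPath hseg (t 0)).2 _ ((hG.1 σ hσ).2 _ _)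
  rw [hasFDerivAt_iff_isLittleO_nhds_zero, Asymptotics.isLittleO_iff]
  intro ε hε
  filter_upwards [hdiff, Metric.tendsto_nhds.mp hM ε hε] with ν h1 h2
  rw [h1, ← sub_apply]
  refine (ContinuousLinearMap.le_opNorm _ _).trans ?_
  rw [← dist_eq_norm]
  exact mul_le_mul_of_nonneg_right h2.le (norm_nonneg _)

end Differentiation

/-! ### The derivative of $\int_\gamma\xi$ along a family -/

section FamilyPeriods

variable {m : ℕ} {V : Set (ℂ × ℂ)}

theorem isFiberChain_pushChain_family {N k : ℕ} {f : PolyRing N}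
    {G : CubChain (k + 1) (V → Fin N → ℂ)} (hG : IsCycleFamily f V G) (p : V) :
    IsFiberChain f p (pushChain (k + 1) (fun h : V → Fin N → ℂ => (h p, p.1.2)) G) := by
  intro τ hτ
  obtain ⟨σ, hσ, rfl⟩ := exists_of_mem_support_pushChain hτ
  obtain ⟨⟨g, hg, hgσ⟩, hfib⟩ := hG.1 σ hσ
  refine ⟨?_, fun t => ⟨rfl, hfib t p⟩⟩
  have h : ContDiffOn ℝ 2 (fun t => (g (t, p), p.1.2)) (unitCube (k + 1)) :=
    ((hg.of_le two_le_smooth).comp (contDiff_id.prodMk contDiff_const).contDiffOn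
      fun t ht => ⟨ht, p.2⟩).prodMk contDiffOn_const
  exact h.congr fun t ht => by rw [hgσ t ht p]; rfl

theorem pushChain_evalChain {N k : ℕ} (G : CubChain k (V → Fin N → ℂ)) (p : V) :
    pushChain k (fun x : Fin N → ℂ => (x, p.1.2)) (evalChain p G) =
      pushChain k (fun h : V → Fin N → ℂ => (h p, p.1.2)) G := by
  rw [pushChain_apply, pushChain_apply, evalChain, ← Finsupp.mapDomain_comp]
  rfl

/-- Differentiation of the fibre equation $f(g(t,s,\lambda),\lambda)=s$. Along the cube it gives
tangency to the fibre; along the parameters it ties $d_/f$ of the velocity to the change of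
$(s,\lambda)$. -/
theorem fderivWithin_family {N k : ℕ} (hV : IsOpen V) {f : PolyRing N}
    {σ : (Fin k → unitInterval) → V → Fin N → ℂ} (hσ : ∀ t, ∀ p : V, σ t p ∈ fiber f p)
    {g : (Fin k → ℝ) × ℂ × ℂ → Fin N → ℂ} (hg : IsFamilyExt V σ g)
    {z : (Fin k → ℝ) × ℂ × ℂ} (hz : z ∈ unitCube k ×ˢ V) (v : (Fin k → ℝ) × ℂ × ℂ) :
    dfAt f (g z) z.2.2 (fderivWithin ℝ g (unitCube k ×ˢ V) z v) +
      v.2.2 * evalAt (g z) z.2.2 (lamDeriv N f) = v.2.1 := by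
  have hu := uniqueDiffOn_unitCube_prod hV z hz
  have hd := hg.1.differentiableOn (by simp) z hz
  have hs : HasFDerivWithinAt (fun z : (Fin k → ℝ) × ℂ × ℂ => z.2.2)
      ((ContinuousLinearMap.snd ℝ ℂ ℂ).comp (ContinuousLinearMap.snd ℝ (Fin k → ℝ) (ℂ × ℂ)))
      (unitCube k ×ˢ V) z :=
    ((ContinuousLinearMap.snd ℝ ℂ ℂ).comp
      (ContinuousLinearMap.snd ℝ (Fin k → ℝ) (ℂ × ℂ))).hasFDerivWithinAt
  have hf : HasFDerivWithinAt (fun z : (Fin k → ℝ) × ℂ × ℂ => z.2.1)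
      ((ContinuousLinearMap.fst ℝ ℂ ℂ).comp (ContinuousLinearMap.snd ℝ (Fin k → ℝ) (ℂ × ℂ)))
      (unitCube k ×ˢ V) z :=
    ((ContinuousLinearMap.fst ℝ ℂ ℂ).comp
      (ContinuousLinearMap.snd ℝ (Fin k → ℝ) (ℂ × ℂ))).hasFDerivWithinAt
  have hc := hd.hasFDerivWithinAt.prodMk hs
  have h := dfAt_fderivWithin f (c := fun z : (Fin k → ℝ) × ℂ × ℂ => (g z, z.2.2))
    (h := fun z => z.2.1) (s := unitCube k ×ˢ V) (t := z) (fun y hy => by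
      have : g y = cubeExt σ y.1 ⟨y.2, hy.2⟩ := hg.2 y.1 hy.1 ⟨y.2, hy.2⟩
      simp only [this]
      exact hσ _ ⟨y.2, hy.2⟩) hz hu hc.differentiableWithinAt v
  rw [hc.fderivWithin hu, hf.fderivWithin hu] at h
  exact h

theorem fderivWithin_member {N k : ℕ}
    {σ : (Fin k → unitInterval) → V → Fin N → ℂ}
    {g : (Fin k → ℝ) × ℂ × ℂ → Fin N → ℂ} (hg : IsFamilyExt V σ g) (p : V) {t : Fin k → ℝ}
    (ht : t ∈ unitCube k) (v : Fin k → ℝ) :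
    fderivWithin ℝ (cubeExt fun t => (σ t p, p.1.2)) (unitCube k) t v =
      (fderivWithin ℝ g (unitCube k ×ˢ V) (t, p) (v, 0), 0) := by
  have hz : (t, (p : ℂ × ℂ)) ∈ unitCube k ×ˢ V := ⟨ht, p.2⟩
  have hpair : HasFDerivWithinAt (fun t : Fin k → ℝ => (t, (p : ℂ × ℂ)))
      (ContinuousLinearMap.inl ℝ (Fin k → ℝ) (ℂ × ℂ)) (unitCube k) t :=
    (hasFDerivWithinAt_id t _).prodMk (hasFDerivWithinAt_const _ _ _)
  have hmaps : Set.MapsTo (fun t : Fin k → ℝ => (t, (p : ℂ × ℂ))) (unitCube k)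
      (unitCube k ×ˢ V) := fun s hs => ⟨hs, p.2⟩
  have h1 : HasFDerivWithinAt (fun t => g (t, (p : ℂ × ℂ))) _ (unitCube k) t :=
    (hg.1.differentiableOn (by simp) _ hz).hasFDerivWithinAt.comp t hpair hmaps
  have heq : Set.EqOn (cubeExt fun t => (σ t p, p.1.2)) (fun t => (g (t, p), p.1.2))
      (unitCube k) := fun s hs => by
    simp only [hg.2 s hs p]; rfl
  rw [fderivWithin_congr heq (heq ht), fderivWithin_prodMk_const ht h1.differentiableWithinAt]
  have h2 : fderivWithin ℝ (fun t => g (t, (p : ℂ × ℂ))) (unitCube k) t = _ :=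
    h1.fderivWithin (uniqueDiffOn_unitCube k t ht)
  rw [h2]
  rfl

theorem gelfandLeray_sub_smul (f h : PolyRing (m + 2)) (α β : RelForm (m + 2) (m + 2))
    (x : Fin (m + 2) → ℂ) (l : ℂ) (v : Fin (m + 1) → Fin (m + 2) → ℂ) :
    gelfandLeray f (α - h • β) x l v =
      gelfandLeray f α x l v - evalAt x l h * gelfandLeray f β x l v := by
  simp only [gelfandLeray, formAt_apply, AlternatingMap.sub_apply, AlternatingMap.smul_apply,
    smul_eq_mul, map_sub, map_mul]
  ring

/-- The form `d_/ f ∧ ∂ξ/∂λ - (∂f/∂λ) d_/ ξ`, which represents `∇[d_/ ξ]`. -/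
def nablaForm (f : PolyRing (m + 2)) (ξ : RelForm (m + 2) (m + 1)) : RelForm (m + 2) (m + 2) :=
  dfWedge f (m + 1) (lamDerivForm (m + 2) (m + 1) ξ) -
    lamDeriv (m + 2) f • dRel (m + 2) (m + 1) ξ

/-- The pointwise identity behind both derivative formulas. With velocity $w$,
$d_/\xi(w,v)=d_/f(w)\,(d_/\xi/d_/f)(v)$ and $d_/f(w)=\nu_1-\nu_2\,\partial f/\partial\lambda$; the
part $d\lambda\wedge\partial_\lambda\xi$ adds $\nu_2\,\partial_\lambda\xi(v)$. -/
theorem familyDeriv_polyForm (hV : IsOpen V) {f : PolyRing (m + 2)}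
    {σ : (Fin (m + 1) → unitInterval) → V → Fin (m + 2) → ℂ}
    (hσ : ∀ t, ∀ p : V, σ t p ∈ fiber f p)
    {g : (Fin (m + 1) → ℝ) × ℂ × ℂ → Fin (m + 2) → ℂ} (hg : IsFamilyExt V σ g)
    (hreg : ∀ p ∈ V, IsRegularValue f p) (ξ : RelForm (m + 2) (m + 1)) {t : Fin (m + 1) → ℝ}
    (ht : t ∈ unitCube (m + 1)) (p : V) (ν : ℂ × ℂ) :
    familyDeriv (polyForm ξ) V g (t, p) ν =
      ν.1 * leray f (dRel (m + 2) (m + 1) ξ) (cubeExt (fun t => (σ t p, p.1.2)) t) (fun j =>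
        fderivWithin ℝ (cubeExt fun t => (σ t p, p.1.2)) (unitCube (m + 1)) t (Pi.single j 1)) +
      ν.2 * leray f (nablaForm f ξ) (cubeExt (fun t => (σ t p, p.1.2)) t) (fun j =>
        fderivWithin ℝ (cubeExt fun t => (σ t p, p.1.2)) (unitCube (m + 1)) t
          (Pi.single j 1)) := by
  have hz : (t, (p : ℂ × ℂ)) ∈ unitCube (m + 1) ×ˢ V := ⟨ht, p.2⟩
  set D := fderivWithin ℝ g (unitCube (m + 1) ×ˢ V) (t, (p : ℂ × ℂ))
  have hgt : (cubeExt (fun t => (σ t p, p.1.2)) t) = (g (t, (p : ℂ × ℂ)), p.1.2) := by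
    rw [hg.2 t ht p]; rfl
  have hx : dfAt f (g (t, (p : ℂ × ℂ))) p.1.2 ≠ 0 := by
    rw [hg.2 t ht p]
    exact hreg p p.2 _ (hσ _ p)
  have hv : ∀ j : Fin (m + 1), dfAt f (g (t, (p : ℂ × ℂ))) p.1.2 (D (Pi.single j 1, 0)) = 0 := by
    intro j
    simpa using fderivWithin_family hV hσ hg hz (Pi.single j 1, 0)
  have hw := fderivWithin_family hV hσ hg hz (0, ν)
  simp only at hw
  -- Only the velocity has a $\lambda$-component, so a single term of
  -- $d\lambda\wedge\partial_\lambda\xi$ survives.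
  rw [familyDeriv_apply, extDeriv_polyForm, Fin.sum_univ_succ, Finset.sum_eq_zero fun i _ => by
    rw [Fin.cons_succ, zero_mul, smul_zero]]
  simp only [fderivWithin_member hg p ht, hgt, leray_apply, nablaForm, gelfandLeray_sub_smul]
  rw [gelfandLeray_dfWedge f _ hx hv]
  have hcons : (fun j => ((Fin.cons (D (0, ν), ν.2) fun j => (D (Pi.single j 1, 0), (0 : ℂ)) :
      Fin (m + 2) → (Fin (m + 2) → ℂ) × ℂ) j).1) =
      Fin.cons (D (0, ν)) fun j => D (Pi.single j 1, 0) := by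
    funext j
    refine Fin.cases ?_ (fun j => ?_) j <;> rfl
  rw [hcons, ← gelfandLeray_spec f (dRel (m + 2) (m + 1) ξ) _ _ hx _ hv]
  simp only [Fin.val_zero, pow_zero, one_smul, Fin.cons_zero, Fin.removeNth_zero, Fin.tail_cons,
    add_zero]
  rw [← hw]
  ring

theorem integrableOn_leray_pullback {k : ℕ} {f : PolyRing (k + 2)}
    (ω : RelForm (k + 2) (k + 2))
    {τ : (Fin (k + 1) → unitInterval) → (Fin (k + 2) → ℂ) × ℂ}
    (hsm : ContDiffOn ℝ 2 (cubeExt τ) (unitCube (k + 1)))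
    (hτ : ∀ t, dfAt f (τ t).1 (τ t).2 ≠ 0) :
    MeasureTheory.IntegrableOn (fun t => leray f ω (cubeExt τ t) fun j =>
      fderivWithin ℝ (cubeExt τ) (unitCube (k + 1)) t (Pi.single j 1)) (unitCube (k + 1)) := by
  refine ContinuousOn.integrableOn_compact isCompact_Icc ?_
  have hv : ∀ j : Fin (k + 1), ContinuousOn (fun t =>
      fderivWithin ℝ (cubeExt τ) (unitCube (k + 1)) t (Pi.single j 1)) (unitCube (k + 1)) :=
    fun j => (hsm.continuousOn_fderivWithin (uniqueDiffOn_unitCube _) (by norm_num)).clm_apply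
      continuousOn_const
  have hl : ∀ t ∈ unitCube (k + 1), ContinuousAt (leray f ω) (cubeExt τ t) := fun t _ =>
    (contDiffAt_leray (n := 0) f ω (hτ _)).continuousAt
  exact continuousOn_form_apply hsm.continuousOn hl hv

theorem integral_familyDeriv_polyForm (hV : IsOpen V) {f : PolyRing (m + 2)}
    {G : CubChain (m + 1) (V → Fin (m + 2) → ℂ)} (hG : IsCycleFamily f V G)
    {g : ((Fin (m + 1) → unitInterval) → V → Fin (m + 2) → ℂ) →
      (Fin (m + 1) → ℝ) × ℂ × ℂ → Fin (m + 2) → ℂ}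
    (hg : ∀ σ ∈ G.support, IsFamilyExt V σ (g σ))
    (hreg : ∀ p ∈ V, IsRegularValue f p) (ξ : RelForm (m + 2) (m + 1)) (p : V) (ν : ℂ × ℂ) :
    (∑ σ ∈ G.support,
      G σ • ∫ t in unitCube (m + 1), familyDeriv (polyForm ξ) V (g σ) (t, p)) ν =
      ν.1 * chainIntegral (leray f (dRel (m + 2) (m + 1) ξ))
        (pushChain (m + 1) (fun h : V → Fin (m + 2) → ℂ => (h p, p.1.2)) G) +
      ν.2 * chainIntegral (leray f (nablaForm f ξ))
        (pushChain (m + 1) (fun h : V → Fin (m + 2) → ℂ => (h p, p.1.2)) G) := by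
  rw [chainIntegral_pushChain, chainIntegral_pushChain, Finset.mul_sum, Finset.mul_sum,
    ← Finset.sum_add_distrib, sum_apply]
  refine Finset.sum_congr rfl fun σ hσ => ?_
  have hcont : ContinuousOn (familyDeriv (polyForm ξ) V (g σ)) (unitCube (m + 1) ×ˢ V) :=
    continuousOn_familyDeriv hV (hg σ hσ).1 fun z _ => (contDiff_polyForm ξ).contDiffAt
  have hcont' : ContinuousOn (fun t => familyDeriv (polyForm ξ) V (g σ) (t, p))
      (unitCube (m + 1)) :=
    hcont.comp (continuous_id.prodMk continuous_const).continuousOn fun t ht => ⟨ht, p.2⟩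
  have hsm : ContDiffOn ℝ 2 (cubeExt fun t => (σ t p, p.1.2)) (unitCube (m + 1)) := by
    have h : ContDiffOn ℝ 2 (fun t => (g σ (t, p), p.1.2)) (unitCube (m + 1)) :=
      (((hg σ hσ).1.of_le two_le_smooth).comp (contDiff_id.prodMk contDiff_const).contDiffOn
        fun t ht => ⟨ht, p.2⟩).prodMk contDiffOn_const
    exact h.congr fun t ht => by rw [(hg σ hσ).2 t ht p]; rfl
  have hint := fun ω => integrableOn_leray_pullback (f := f) ω hsm
    (fun t => hreg p p.2 _ ((hG.1 σ hσ).2 t p))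
  rw [smul_apply, ContinuousLinearMap.integral_apply
    (hcont'.integrableOn_compact isCompact_Icc),
    MeasureTheory.setIntegral_congr_fun measurableSet_Icc fun t ht =>
      familyDeriv_polyForm hV (hG.1 σ hσ).2 (hg σ hσ) hreg ξ ht p ν,
    MeasureTheory.integral_add ((hint _).const_mul _) ((hint _).const_mul _),
    MeasureTheory.integral_const_mul, MeasureTheory.integral_const_mul, smul_eq_mul]
  simp only [formIntegral]
  ring

end FamilyPeriods

/-! ### Holomorphy of periods and the derivative formulas -/

/-- A real differentiable function on `ℂ²` that is the first coefficient of a complex linear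
derivative is complex differentiable, and the mixed derivatives agree. -/
theorem hasFDerivAt_of_coefficient {H A B : ℂ × ℂ → ℂ} {p : ℂ × ℂ} {A' B' : ℂ × ℂ →L[ℝ] ℂ}
    (hH : ∀ᶠ q in nhds p, HasFDerivAt H
      (A q • ContinuousLinearMap.fst ℝ ℂ ℂ + B q • ContinuousLinearMap.snd ℝ ℂ ℂ) q)
    (hA : HasFDerivAt A A' p) (hB : HasFDerivAt B B' p) :
    HasFDerivAt A (A' (1, 0) • ContinuousLinearMap.fst ℂ ℂ ℂ +
      B' (1, 0) • ContinuousLinearMap.snd ℂ ℂ ℂ) p := by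
  have h2 := (hA.smul_const (ContinuousLinearMap.fst ℝ ℂ ℂ)).add
    (hB.smul_const (ContinuousLinearMap.snd ℝ ℂ ℂ))
  -- Evaluated at $(\nu,(1,0))$ the second derivative of `H` is $A'(\nu)$; with the arguments
  -- exchanged it is $\nu_1A'(1,0)+\nu_2B'(1,0)$, which is complex linear in $\nu$.
  have hsymm := fun ν => second_derivative_symmetric_of_eventually (𝕜 := ℝ) hH h2 ν (1, 0)
  refine hasFDerivAt_of_restrictScalars ℝ hA ?_
  refine ContinuousLinearMap.ext fun ν => ?_
  have h := hsymm ν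
  simp only [add_apply, ContinuousLinearMap.smulRight_apply, smul_apply,
    ContinuousLinearMap.coe_fst', ContinuousLinearMap.coe_snd', smul_eq_mul, mul_one, mul_zero,
    add_zero] at h
  simp [h]

section Main

variable {m : ℕ} {f : PolyRing (m + 2)} {U : Set (ℂ × ℂ)}
  {γ : ℂ × ℂ → CubChain (m + 1) (Fin (m + 2) → ℂ)}

/-- Periods are real differentiable, and the derivatives of `∫ b[d_/ ξ]` are periods. -/
theorem period_hasFDerivAt_real (hreg : ∀ p ∈ U, IsRegularValue f p)
    (hγ : IsHorizontalFamily f U γ) {p : ℂ × ℂ} (hp : p ∈ U) :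
    (∀ ω, DifferentiableAt ℝ (fun p => period f ω p.2 (γ p)) p) ∧
    ∀ ξ, HasFDerivAt (fun p => period f (dfWedge f (m + 1) ξ) p.2 (γ p))
      (period f (dRel (m + 2) (m + 1) ξ) p.2 (γ p) • ContinuousLinearMap.fst ℝ ℂ ℂ +
        period f (nablaForm f ξ) p.2 (γ p) • ContinuousLinearMap.snd ℝ ℂ ℂ) p := by
  obtain ⟨V, hV, hpV, hVU, G, hG, hhom⟩ := hγ.flat p hp
  have hex : ∀ σ : (Fin (m + 1) → unitInterval) → V → Fin (m + 2) → ℂ,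
      ∃ g : (Fin (m + 1) → ℝ) × ℂ × ℂ → Fin (m + 2) → ℂ, σ ∈ G.support → IsFamilyExt V σ g := by
    intro σ
    by_cases hσ : σ ∈ G.support
    · obtain ⟨⟨g, hg⟩, _⟩ := hG.1 σ hσ
      exact ⟨g, fun _ => hg⟩
    · exact ⟨0, fun h => absurd h hσ⟩
  choose g hg using hex
  have hregV : ∀ q ∈ V, IsRegularValue f q := fun q hq => hreg q (hVU hq)
  -- No regularity of `γ` in the parameters is assumed. It enters only through its homology class,
  -- so on `V` its periods are those of the smooth family `G`.
  have hper : ∀ ω, ∀ q : V, period f ω q.1.2 (γ q) = chainIntegral (leray f ω)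
      (pushChain (m + 1) (fun h : V → Fin (m + 2) → ℂ => (h q, q.1.2)) G) := by
    intro ω q
    rw [← pushChain_evalChain]
    exact period_eq_of_homologous f ω (hregV q q.2) (hγ.isCycle q (hVU q.2)).1 (hhom q)
  refine ⟨fun ω => (hasFDerivAt_chainIntegral hV hG hg (Θ := leray f ω) (fun q hq x hx =>
    contDiffAt_leray f ω (hregV q hq x hx)) (hper ω) hpV).differentiableAt, fun ξ => ?_⟩
  have h := hasFDerivAt_chainIntegral hV hG hg (Θ := polyForm ξ)
    (F := fun p => period f (dfWedge f (m + 1) ξ) p.2 (γ p))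
    (fun q hq x hx => (contDiff_polyForm ξ).contDiffAt) (fun q => by
      rw [hper, chainIntegral_leray_dfWedge f ξ (hregV q q.2)
        (isFiberChain_pushChain_family hG q)]) hpV
  refine h.congr_fderiv ?_
  refine ContinuousLinearMap.ext fun ν => ?_
  rw [integral_familyDeriv_polyForm hV hG hg hregV ξ ⟨p, hpV⟩ ν, ← hper, ← hper]
  simp [mul_comm]

/-- The $\lambda$-coefficient `b` is the real derivative in direction $(1,0)$ of the period of
`nablaForm f ξ`. It is described through an arbitrary complex derivative `L` because holomorphy of
that period is obtained afterwards, from this same result applied to a primitive of `nablaForm f ξ`.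
-/
theorem period_hasFDerivAt (hU : IsOpen U) (hreg : ∀ p ∈ U, IsRegularValue f p)
    (hγ : IsHorizontalFamily f U γ) {p : ℂ × ℂ} (hp : p ∈ U) (ξ : RelForm (m + 2) (m + 1)) :
    ∃ a b : ℂ, HasFDerivAt (fun p => period f (dRel (m + 2) (m + 1) ξ) p.2 (γ p))
      (a • ContinuousLinearMap.fst ℂ ℂ ℂ + b • ContinuousLinearMap.snd ℂ ℂ ℂ) p ∧
      ∀ L : ℂ × ℂ →L[ℂ] ℂ, HasFDerivAt (fun p => period f (nablaForm f ξ) p.2 (γ p)) L p →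
        L (1, 0) = b := by
  have h := fun q (hq : q ∈ U) => period_hasFDerivAt_real hreg hγ hq
  have hA := ((h p hp).1 (dRel (m + 2) (m + 1) ξ)).hasFDerivAt
  have hB := ((h p hp).1 (nablaForm f ξ)).hasFDerivAt
  refine ⟨_, _, hasFDerivAt_of_coefficient (Filter.mem_of_superset (hU.mem_nhds hp) fun q hq =>
    (h q hq).2 ξ) hA hB, fun L hL => ?_⟩
  rw [← (hL.restrictScalars ℝ).unique hB]
  rfl

theorem period_eventuallyEq (hU : IsOpen U) (hreg : ∀ p ∈ U, IsRegularValue f p)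
    (hγ : IsHorizontalFamily f U γ) {p : ℂ × ℂ} (hp : p ∈ U)
    {ω ω' : RelForm (m + 2) (m + 2)} (h : toE f ω = toE f ω') :
    (fun p => period f ω p.2 (γ p)) =ᶠ[nhds p] fun p => period f ω' p.2 (γ p) :=
  Filter.mem_of_superset (hU.mem_nhds hp) fun q hq =>
    period_eq_of_toE_eq h (hreg q hq) (hγ.isCycle q hq)

/-- The real derivative of the period of $d_/f\wedge\xi$ is already complex linear; dependence on
classes alone allows arbitrary representatives. -/
theorem period_hasFDerivAt_opB (hU : IsOpen U) (hreg : ∀ p ∈ U, IsRegularValue f p)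
    (hγ : IsHorizontalFamily f U γ) {p : ℂ × ℂ} (hp : p ∈ U)
    {ω ω' ω'' : RelForm (m + 2) (m + 2)} (h : toE f ω' = opB f (toE f ω))
    (h' : toE f ω'' = opNabla f (toE f ω)) :
    HasFDerivAt (fun p => period f ω' p.2 (γ p))
      (period f ω p.2 (γ p) • ContinuousLinearMap.fst ℂ ℂ ℂ +
        period f ω'' p.2 (γ p) • ContinuousLinearMap.snd ℂ ℂ ℂ) p := by
  obtain ⟨ξ, rfl⟩ := dRel_top_surjective (m + 1) ω
  rw [opB_toE] at h
  rw [opNabla_dRel] at h'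
  refine HasFDerivAt.congr_of_eventuallyEq ?_ (period_eventuallyEq hU hreg hγ hp h)
  refine hasFDerivAt_of_restrictScalars ℝ ((period_hasFDerivAt_real hreg hγ hp).2 ξ) ?_
  rw [(period_eventuallyEq hU hreg hγ hp h').eq_of_nhds]
  rfl

theorem hasDerivAt_fst_of_hasFDerivAt {F : ℂ × ℂ → ℂ} {s l : ℂ} {L : ℂ × ℂ →L[ℂ] ℂ}
    (h : HasFDerivAt F L (s, l)) : HasDerivAt (fun z => F (z, l)) (L (1, 0)) s :=
  h.comp_hasDerivAt s ((hasDerivAt_id s).prodMk (hasDerivAt_const s l))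

theorem hasDerivAt_snd_of_hasFDerivAt {F : ℂ × ℂ → ℂ} {s l : ℂ} {L : ℂ × ℂ →L[ℂ] ℂ}
    (h : HasFDerivAt F L (s, l)) : HasDerivAt (fun z => F (s, z)) (L (0, 1)) l :=
  h.comp_hasDerivAt l ((hasDerivAt_const l s).prodMk (hasDerivAt_id l))

end Main

end

end PeriodConnection

open PeriodConnection in
theorem mainTheorem1 (m : ℕ) (f : PolyRing (m + 2)) :
    ∃ nabla : BrieskornModule f →ₗ[ℂ] BrieskornModule f,
      -- the formula for `∇`, and its relations with `b`, `a` and `ℂ[λ]` on `E_f`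
      (∀ ξ : RelForm (m + 2) (m + 1),
        nabla (toE f (dRel (m + 2) (m + 1) ξ)) =
          toE f (dfWedge f (m + 1) (lamDerivForm (m + 2) (m + 1) ξ) -
            lamDeriv (m + 2) f • dRel (m + 2) (m + 1) ξ)) ∧
      (∀ e, nabla (opB f e) = opB f (nabla e)) ∧
      (∀ e, nabla (opA f e) = opA f (nabla e) - opB f (nabla e)) ∧
      (∀ (φ : Polynomial ℂ) (e : BrieskornModule f),
        nabla (φ • e) = Polynomial.derivative φ • opB f e + φ • nabla e) ∧
      -- `∇` induces a map on `E_f / (b-torsion)`, where `b` is injective, and `b⁻¹∇` is a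
      -- `λ`-connection from the image of `b` that commutes with `a` and `b`
      (∃ nablaRed : ReducedModule f →ₗ[ℂ] ReducedModule f,
        (∀ e, nablaRed (toRed f e) = toRed f (nabla e)) ∧
        Function.Injective (redB f) ∧
        ∃ Dop : LinearMap.range (redB f) →ₗ[ℂ] ReducedModule f,
          (∀ y, redB f (Dop y) = nablaRed y) ∧
          (∀ y : LinearMap.range (redB f), ∃ h : redA f y ∈ LinearMap.range (redB f),
            Dop ⟨redA f y, h⟩ = redA f (Dop y)) ∧
          (∀ y : LinearMap.range (redB f), ∃ h : redB f y ∈ LinearMap.range (redB f),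
            Dop ⟨redB f y, h⟩ = redB f (Dop y)) ∧
          IsLambdaConnection (LinearMap.range (redB f)) Dop) ∧
      -- period integrals over horizontal families of compact `n`-cycles
      (∀ (U : Set (ℂ × ℂ)) (γ : ℂ × ℂ → CubChain (m + 1) (Fin (m + 2) → ℂ)),
        IsOpen U → (∀ p ∈ U, p.2 ≠ 0) → Disjoint U (criticalValues f) →
        IsHorizontalFamily f U γ →
        (∀ ω ω' : RelForm (m + 2) (m + 2), toE f ω = toE f ω' →
          ∀ p ∈ U, period f ω p.2 (γ p) = period f ω' p.2 (γ p)) ∧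
        (∀ ω : RelForm (m + 2) (m + 2),
          DifferentiableOn ℂ (fun p => period f ω p.2 (γ p)) U) ∧
        (∀ ω ω' : RelForm (m + 2) (m + 2), toE f ω' = opB f (toE f ω) →
          ∀ s l : ℂ, (s, l) ∈ U →
            deriv (fun z => period f ω' l (γ (z, l))) s = period f ω l (γ (s, l))) ∧
        (∀ ω ω' ω'' : RelForm (m + 2) (m + 2), toE f ω' = opB f (toE f ω) →
          toE f ω'' = nabla (toE f ω) → ∀ s l : ℂ, (s, l) ∈ U →
            deriv (fun z => period f ω' z (γ (s, z))) l = period f ω'' l (γ (s, l))) ∧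
        (∀ ω ω' : RelForm (m + 2) (m + 2), toE f ω' = nabla (toE f ω) →
          ∀ s l : ℂ, (s, l) ∈ U →
            deriv (fun z => period f ω z (γ (s, z))) l =
              deriv (fun z => period f ω' l (γ (z, l))) s)) := by
  refine ⟨opNabla f, opNabla_dRel f, opNabla_opB f, opNabla_opA f, opNabla_smul f,
    exists_redConnection f, fun U γ hU h0 hdisj hγ => ?_⟩
  have hreg : ∀ p ∈ U, IsRegularValue f p := fun p hp =>
    isRegularValue_of_disjoint h0 hdisj hp
  -- Every top form has a primitive $\xi$, so each period occurs as the $s$-coefficient of the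
  -- derivative of the period of $d_/f\wedge\xi$, and is therefore holomorphic.
  have hdiff : ∀ ω : RelForm (m + 2) (m + 2), ∀ p ∈ U,
      DifferentiableAt ℂ (fun p => period f ω p.2 (γ p)) p := by
    intro ω p hp
    obtain ⟨ξ, rfl⟩ := dRel_top_surjective (m + 1) ω
    obtain ⟨a, b, h, -⟩ := period_hasFDerivAt hU hreg hγ hp ξ
    exact h.differentiableAt
  refine ⟨fun ω ω' h p hp => period_eq_of_toE_eq h (hreg p hp) (hγ.isCycle p hp),
    fun ω p hp => (hdiff ω p hp).differentiableWithinAt, ?_, ?_, ?_⟩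
  · intro ω ω' h s l hp
    obtain ⟨ω'', h''⟩ := toE_surjective f (opNabla f (toE f ω))
    have := hasDerivAt_fst_of_hasFDerivAt (period_hasFDerivAt_opB hU hreg hγ hp h h'')
    rw [this.deriv]
    simp
  · intro ω ω' ω'' h h'' s l hp
    have := hasDerivAt_snd_of_hasFDerivAt (period_hasFDerivAt_opB hU hreg hγ hp h h'')
    rw [this.deriv]
    simp
  · intro ω ω' h s l hp
    obtain ⟨ξ, rfl⟩ := dRel_top_surjective (m + 1) ω
    rw [opNabla_dRel] at h
    obtain ⟨a, b, hA, hB⟩ := period_hasFDerivAt hU hreg hγ hp ξ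
    -- The period of `ω'` agrees near the point with that of `nablaForm f ξ`, which is holomorphic;
    -- its $s$-derivative is thus the coefficient `b`.
    have hL := (hdiff (nablaForm f ξ) _ hp).hasFDerivAt
    have hL' := hL.congr_of_eventuallyEq (period_eventuallyEq hU hreg hγ hp h)
    rw [(hasDerivAt_snd_of_hasFDerivAt hA).deriv, (hasDerivAt_fst_of_hasFDerivAt hL').deriv,
      hB _ hL]
    simp
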